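/- **Setting.** Let $G=(V,E)$ be a connected simple graph and let $\Gamma\subset \mathrm{Aut}(G)$ be a free abelian group of rank two acting without fixed vertices or fixed edges and with $V/\Gamma$ and $E/\Gamma$ finite. A *periodic framework* $(G,\Gamma,p,\pi)$ consists of an injective homomorphism $\pi:\Gamma\to\mathbb{R}^2$ onto a lattice of translations of rank two and a map $p:V\to\mathbb{R}^2$ with $p(\gamma v)=p(v)+\pi(\gamma)$ and $p(u)\neq p(v)$ for every edge $\{u,v\}$. It is *non-crossing* if the closed segments of two distinct edges meet at most in a common endpoint; its *faces* are the connected components of the complement of the union of all vertices and edge segments. It is a *(pointed) periodic pseudo-triangulation* if it is non-crossing, if every face is a pseudo-triangle, i.e. the region bounded by a simple closed polygon (formed by a cycle of edges of $G$) with exactly three internal angles smaller than $\pi$, and if at every vertex all incident edge vectors lie strictly on one side of some line through the vertex. Choose two generators of $\Gamma$, representatives of the vertex orbits, and for every edge orbit $\beta\in E/\Gamma$ a representative edge going from a vertex representative $i$ to $\gamma_\beta j$, with $j$ a vertex representative and $\gamma_\beta\in\Gamma$; let $c_\beta\in\mathbb{Z}^2$ be the coordinates of $\gamma_\beta$ and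 $e_\beta=p(\gamma_\beta j)-p(i)$. A *periodic stress* is a $\Gamma$-invariant function $s:E\to\mathbb{R}$ with $\sum_{v:\{u,v\}\in E}s_{\{u,v\}}(p(v)-p(u))=0$ for all $u\in V$ and $\sum_{\beta\in E/\Gamma}s_\beta c_\beta^{j}e_\beta=0$ for $j=1,2$; this does not depend on the choices. It is trivial if $s=0$. A *realization* is a periodic framework $(G,\Gamma,p',\pi')$ on the same $(G,\Gamma)$ (crossings allowed) with the same edge lengths as $(G,\Gamma,p,\pi)$; the *deformation space* of $(G,\Gamma,p,\pi)$ is the set of realizations, with the topology of pointwise convergence, modulo isometries of the plane. An *infinitesimal periodic motion* of a realization $(p',\pi')$ is a pair $(\dot p,\dot\pi)$, with $\dot\pi:\Gamma\to\mathbb{R}^2$ a homomorphism and $\dot p(\gamma v)=\dot p(v)+\dot\pi(\gamma)$, such that $\langle p'(v)-p'(u),\dot p(v)-\dot p(u)\rangle=0$ for all edges $\{u,v\}$; it is trivial if it is induced by an infinitesimal isometry $x\mapsto Ax+b$, $A$ skew-symmetric, i.e. $\dot p=Ap'+b$ and $\dot\pi=A\pi'$. We say that the deformation space is *smooth and one-dimensional*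 at a realization $(p',\pi')$ if the space of infinitesimal periodic motions of $(p',\pi')$ modulo trivial ones is one-dimensional, and if there is a $C^\infty$ one-parameter family $(p_t,\pi_t)_{t\in\mathbb{R}}$ of realizations with $(p_0,\pi_0)=(p',\pi')$, whose velocity is at no $t$ a trivial infinitesimal motion of $(p_t,\pi_t)$, such that $t\mapsto[(p_t,\pi_t)]$ is a homeomorphism of $\mathbb{R}$ onto an open subset of the deformation space. **Proposition.** Let $(G,\Gamma,p,\pi)$ be a periodic pseudo-triangulation. Then: 1. $(G,\Gamma,p,\pi)$ has no nontrivial periodic stress. 2. Its deformation space is smooth and one-dimensional at $(p,\pi)$. 3. Its deformation space is smooth and one-dimensional at every realization that is again a pseudo-triangulation; in particular this persists along any deformation for as long as the framework remains a pseudo-triangulation. Moreover, for every subgroup $\tilde\Gamma\subset\Gamma$ of finite index, statements 1, 2 and 3 also hold for the framework with relaxed periodicity $(G,\tilde\Gamma,p,\pi|_{\tilde\Gamma})$, with periodic stresses, realizations and the deformation space taken with respect to $\tilde\Gamma$. -/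

import Mathlib

open scoped ContDiff

noncomputable section

namespace PeriodicFramework

/-- The Euclidean plane. -/
abbrev Plane : Type := EuclideanSpace ℝ (Fin 2)

variable {V : Type*}

/-- Automorphisms of a graph act on its edges. -/
instance edgeAction (G : SimpleGraph V) : MulAction (G ≃g G) G.edgeSet where
  smul γ e := SimpleGraph.Iso.mapEdgeSet γ e
  one_smul e := by
    apply Subtype.ext
    change Sym2.map (fun v => v) e.1 = e.1
    simp
  mul_smul γ δ e := by
    apply Subtype.ext
    change Sym2.map (fun v => γ (δ v)) e.1 = Sym2.map γ (Sym2.map δ e.1)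
    rw [Sym2.map_map]
    rfl

/-- The set `V/Γ` of vertex orbits. -/
abbrev VertexOrbit (G : SimpleGraph V) (Γ : Subgroup (G ≃g G)) : Type _ :=
  MulAction.orbitRel.Quotient Γ V

/-- The set `E/Γ` of edge orbits. -/
abbrev EdgeOrbit (G : SimpleGraph V) (Γ : Subgroup (G ≃g G)) : Type _ :=
  MulAction.orbitRel.Quotient Γ G.edgeSet

/-- `(G, Γ)` is a 2-periodic graph: `G` is connected (and simple), and `Γ ⊆ Aut(G)` is free abelian
of rank two, acts without fixed vertices or fixed edges, and has a finite quotient graph. -/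
structure IsPeriodicGraph (G : SimpleGraph V) (Γ : Subgroup (G ≃g G)) : Prop where
  connected : G.Connected
  free_abelian : Nonempty (Γ ≃* Multiplicative (Fin 2 → ℤ))
  no_fixed_vertex : ∀ γ : Γ, γ ≠ 1 → ∀ v : V, γ • v ≠ v
  no_fixed_edge : ∀ γ : Γ, γ ≠ 1 → ∀ e : G.edgeSet, γ • e ≠ e
  finite_vertices : Finite (VertexOrbit G Γ)
  finite_edges : Finite (EdgeOrbit G Γ)

/-- Pairs `(p, π)`: positions of the vertices, and translation vectors for the elements of `Γ`.
The topology is that of pointwise convergence; on equivariant pairs it is the usual topology of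
the finite-dimensional space of vertex representatives and period matrices. -/
abbrev Configuration (G : SimpleGraph V) (Γ : Subgroup (G ≃g G)) : Type _ :=
  (V → Plane) × (Γ → Plane)

/-- `(G, Γ, p, π)` is a periodic framework: `π` is a faithful representation of `Γ` by a rank two
lattice of translations, `p` is `Γ`-equivariant, and the two endpoints of an edge are distinct. -/
structure IsPeriodicPlacement (G : SimpleGraph V) (Γ : Subgroup (G ≃g G))
    (q : Configuration G Γ) : Prop where
  map_mul : ∀ γ δ : Γ, q.2 (γ * δ) = q.2 γ + q.2 δ
  injective : Function.Injective q.2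
  rank_two : Submodule.span ℝ (Set.range q.2) = ⊤
  equivariant : ∀ (γ : Γ) (v : V), q.1 (γ • v) = q.1 v + q.2 γ
  ne_of_adj : ∀ u v : V, G.Adj u v → q.1 u ≠ q.1 v

/-- Relaxation of periodicity: the same placement, with `π` restricted to a subgroup. -/
def relax {G : SimpleGraph V} {Γ Γ' : Subgroup (G ≃g G)} (h : Γ' ≤ Γ)
    (q : Configuration G Γ) : Configuration G Γ' :=
  (q.1, fun γ => q.2 ⟨γ.1, h γ.2⟩)

/-! ### Non-crossing frameworks, faces, pseudo-triangulations -/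

/-- Closed edge segments of two different edges meet at most in the common endpoint. -/
def IsNonCrossing (G : SimpleGraph V) (p : V → Plane) : Prop :=
  ∀ a b c d : V, G.Adj a b → G.Adj c d → s(a, b) ≠ s(c, d) →
    segment ℝ (p a) (p b) ∩ segment ℝ (p c) (p d) ⊆ p '' ({a, b} ∩ {c, d})

/-- The subset of the plane made of all vertices and all edge segments. -/
def drawing (G : SimpleGraph V) (p : V → Plane) : Set Plane :=
  Set.range p ∪ {x | ∃ u v : V, G.Adj u v ∧ x ∈ segment ℝ (p u) (p v)}

/-- A face is a connected component of the complement of the drawing. -/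
def IsFace (G : SimpleGraph V) (p : V → Plane) (U : Set Plane) : Prop :=
  ∃ x ∈ (drawing G p)ᶜ, U = connectedComponentIn (drawing G p)ᶜ x

open Classical in
/-- The internal angle, in the region `U` bounded by a simple polygon, at the polygon vertex `b`
with neighbouring polygon vertices `a` and `c`: it is the convex angle `∠ a b c ∈ [0, π]` when the
points close to `b` inside that convex angle belong to `U`, and `2π - ∠ a b c` otherwise (both
values are `π` for a straight angle). -/
def internalAngle (U : Set Plane) (a b c : Plane) : ℝ :=
  if ∀ᶠ t : ℝ in nhdsWithin 0 (Set.Ioi 0), b + t • ((a - b) + (c - b)) ∈ U then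
    EuclideanGeometry.angle a b c
  else
    2 * Real.pi - EuclideanGeometry.angle a b c

/-- The face `U` of a non-crossing framework is a pseudo-triangle: it is the bounded region whose
boundary is a simple closed polygon, given by a cycle `c` of `k ≥ 3` distinct vertices of the graph
(indexed cyclically), exactly three of whose internal angles are smaller than `π`. -/
def IsPseudoTriangle (G : SimpleGraph V) (p : V → Plane) (U : Set Plane) : Prop :=
  Bornology.IsBounded U ∧
  ∃ (k : ℕ) (c : ZMod k → V), 3 ≤ k ∧ Function.Injective c ∧
    (∀ i, G.Adj (c i) (c (i + 1))) ∧
    frontier U = ⋃ i, segment ℝ (p (c i)) (p (c (i + 1))) ∧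
    {i | internalAngle U (p (c (i - 1))) (p (c i)) (p (c (i + 1))) < Real.pi}.ncard = 3

/-- The framework is pointed at `u`: all edge vectors at `u` lie strictly on one side of some line
through their common origin. -/
def IsPointedAt (G : SimpleGraph V) (p : V → Plane) (u : V) : Prop :=
  ∃ n : Plane, ∀ v : V, G.Adj u v → 0 < inner ℝ n (p v - p u)

/-- Pointed pseudo-triangulation: non-crossing, all faces are pseudo-triangles, and pointed at
every vertex. -/
structure IsPseudoTriangulation (G : SimpleGraph V) (p : V → Plane) : Prop where
  nonCrossing : IsNonCrossing G p
  faces : ∀ U : Set Plane, IsFace G p U → IsPseudoTriangle G p U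
  pointed : ∀ u : V, IsPointedAt G p u

/-! ### Periodic stresses -/

/-- A choice of two generators of `Γ`, of representatives for the vertex orbits, and of
representatives for the edge orbits: the edge orbit `β` is represented by the edge from the
representative of the orbit `tail β` to the translate by `shift β` of the representative of the
orbit `head β`. -/
structure Representatives (G : SimpleGraph V) (Γ : Subgroup (G ≃g G)) where
  gen : Γ ≃* Multiplicative (Fin 2 → ℤ)
  vert : VertexOrbit G Γ → V
  vert_mem : ∀ o, (Quotient.mk'' (vert o) : VertexOrbit G Γ) = o
  tail : EdgeOrbit G Γ → VertexOrbit G Γ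
  head : EdgeOrbit G Γ → VertexOrbit G Γ
  shift : EdgeOrbit G Γ → Γ
  adj : ∀ β, G.Adj (vert (tail β)) (shift β • vert (head β))
  edge_mem : ∀ β, (Quotient.mk'' (⟨s(vert (tail β), shift β • vert (head β)), adj β⟩ : G.edgeSet) :
    EdgeOrbit G Γ) = β

namespace Representatives

variable {G : SimpleGraph V} {Γ : Subgroup (G ≃g G)} (R : Representatives G Γ)

/-- The edge representing the orbit `β`. -/
def edge (β : EdgeOrbit G Γ) : G.edgeSet :=
  ⟨s(R.vert (R.tail β), R.shift β • R.vert (R.head β)), R.adj β⟩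

/-- The edge vector `e_β` of the edge representing `β`. -/
def edgeVector (p : V → Plane) (β : EdgeOrbit G Γ) : Plane :=
  p (R.shift β • R.vert (R.head β)) - p (R.vert (R.tail β))

/-- The integer coordinates `c_β` of the period of the edge representing `β`. -/
def coord (β : EdgeOrbit G Γ) : Fin 2 → ℤ :=
  Multiplicative.toAdd (R.gen (R.shift β))

end Representatives

/-- Equilibrium stress: at every vertex the edge vectors, scaled by the stress, sum to zero (the
sum is finite for a periodic graph). -/
def IsEquilibriumStress (G : SimpleGraph V) (p : V → Plane) (s : G.edgeSet → ℝ) : Prop :=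
  ∀ u : V, ∑ᶠ v : G.neighborSet u, s ⟨s(u, v.1), v.2⟩ • (p v.1 - p u) = 0

/-- Periodic stress: a `Γ`-invariant equilibrium stress such that
`∑_{β ∈ E/Γ} s_β c_β^j e_β = 0` for `j = 1, 2`. The last condition does not depend on the choice of
representatives. -/
structure IsPeriodicStress (G : SimpleGraph V) (Γ : Subgroup (G ≃g G)) (q : Configuration G Γ)
    (s : G.edgeSet → ℝ) : Prop where
  invariant : ∀ (γ : Γ) (e : G.edgeSet), s (γ • e) = s e
  equilibrium : IsEquilibriumStress G q.1 s
  periods : ∃ R : Representatives G Γ, ∀ j : Fin 2,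
    ∑ᶠ β : EdgeOrbit G Γ, (s (R.edge β) * (R.coord β j : ℝ)) • R.edgeVector q.1 β = 0

/-! ### Infinitesimal motions and the deformation space -/

/-- Infinitesimal periodic motions: `Γ`-equivariant velocities `(p', π')`, with `π'` a homomorphism,
that preserve the squared edge lengths to first order. -/
def infinitesimalMotions (G : SimpleGraph V) (Γ : Subgroup (G ≃g G)) (q : Configuration G Γ) :
    Submodule ℝ (Configuration G Γ) where
  carrier := {w | (∀ γ δ : Γ, w.2 (γ * δ) = w.2 γ + w.2 δ) ∧
    (∀ (γ : Γ) (v : V), w.1 (γ • v) = w.1 v + w.2 γ) ∧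
    ∀ u v : V, G.Adj u v → inner ℝ (q.1 v - q.1 u) (w.1 v - w.1 u) = 0}
  add_mem' := by
    rintro w z ⟨hw1, hw2, hw3⟩ ⟨hz1, hz2, hz3⟩
    refine ⟨fun γ δ => ?_, fun γ v => ?_, fun u v h => ?_⟩
    · simp only [Prod.snd_add, Pi.add_apply, hw1, hz1]; abel
    · simp only [Prod.snd_add, Prod.fst_add, Pi.add_apply, hw2, hz2]; abel
    · have e : (w + z).1 v - (w + z).1 u = (w.1 v - w.1 u) + (z.1 v - z.1 u) := by
        simp only [Prod.fst_add, Pi.add_apply]; abel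
      rw [e, inner_add_right, hw3 u v h, hz3 u v h, add_zero]
  zero_mem' := by simp
  smul_mem' := by
    rintro a w ⟨hw1, hw2, hw3⟩
    refine ⟨fun γ δ => ?_, fun γ v => ?_, fun u v h => ?_⟩
    · simp only [Prod.smul_snd, Pi.smul_apply, hw1, smul_add]
    · simp only [Prod.smul_snd, Prod.smul_fst, Pi.smul_apply, hw2, smul_add]
    · have e : (a • w).1 v - (a • w).1 u = a • (w.1 v - w.1 u) := by
        simp only [Prod.smul_fst, Pi.smul_apply, smul_sub]
      rw [e, inner_smul_right, hw3 u v h, mul_zero]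

/-- Trivial infinitesimal motions: those induced by infinitesimal isometries `x ↦ A x + b`, with `A`
skew-symmetric. -/
def trivialMotions (G : SimpleGraph V) (Γ : Subgroup (G ≃g G)) (q : Configuration G Γ) :
    Submodule ℝ (Configuration G Γ) where
  carrier := {w | ∃ (A : Plane →ₗ[ℝ] Plane) (b : Plane), (∀ x, inner ℝ (A x) x = 0) ∧
    (∀ v : V, w.1 v = A (q.1 v) + b) ∧ ∀ γ : Γ, w.2 γ = A (q.2 γ)}
  add_mem' := by
    rintro w z ⟨A, b, hA, hw1, hw2⟩ ⟨B, d, hB, hz1, hz2⟩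
    refine ⟨A + B, b + d, fun x => ?_, fun v => ?_, fun γ => ?_⟩
    · rw [LinearMap.add_apply, inner_add_left, hA, hB, add_zero]
    · simp only [Prod.fst_add, Pi.add_apply, hw1, hz1, LinearMap.add_apply]; abel
    · simp only [Prod.snd_add, Pi.add_apply, hw2, hz2, LinearMap.add_apply]
  zero_mem' := ⟨0, 0, by simp, by simp, by simp⟩
  smul_mem' := by
    rintro a w ⟨A, b, hA, hw1, hw2⟩
    refine ⟨a • A, a • b, fun x => ?_, fun v => ?_, fun γ => ?_⟩
    · rw [LinearMap.smul_apply, real_inner_smul_left, hA, mul_zero]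
    · simp only [Prod.smul_fst, Pi.smul_apply, hw1, LinearMap.smul_apply, smul_add]
    · simp only [Prod.smul_snd, Pi.smul_apply, hw2, LinearMap.smul_apply]

/-- The space of infinitesimal flexes: infinitesimal periodic motions modulo trivial ones. -/
abbrev InfinitesimalFlexes (G : SimpleGraph V) (Γ : Subgroup (G ≃g G)) (q : Configuration G Γ) :
    Type _ :=
  infinitesimalMotions G Γ q ⧸ (trivialMotions G Γ q).submoduleOf (infinitesimalMotions G Γ q)

/-- All periodic frameworks on `(G, Γ)` (crossings allowed) with the edge lengths of `q`. -/
def realizationSpace (G : SimpleGraph V) (Γ : Subgroup (G ≃g G)) (q : Configuration G Γ) :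
    Set (Configuration G Γ) :=
  {q' | IsPeriodicPlacement G Γ q' ∧
    ∀ u v : V, G.Adj u v → dist (q'.1 u) (q'.1 v) = dist (q.1 u) (q.1 v)}

/-- Realizations are congruent when an isometry of the plane carries one to the other. -/
def congruence (G : SimpleGraph V) (Γ : Subgroup (G ≃g G)) (q : Configuration G Γ) :
    Setoid (realizationSpace G Γ q) where
  r a b := ∃ T : Plane ≃ᵃⁱ[ℝ] Plane, (∀ v : V, b.1.1 v = T (a.1.1 v)) ∧
    ∀ γ : Γ, b.1.2 γ = T.linearIsometryEquiv (a.1.2 γ)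
  iseqv :=
    { refl := fun _ => ⟨AffineIsometryEquiv.refl ℝ Plane, fun _ => rfl, fun _ => rfl⟩
      symm := by
        rintro a b ⟨T, h1, h2⟩
        refine ⟨T.symm, fun v => ?_, fun γ => ?_⟩
        · rw [h1, AffineIsometryEquiv.symm_apply_apply]
        · rw [h2]
          exact (T.linearIsometryEquiv.symm_apply_apply _).symm
      trans := by
        rintro a b d ⟨T, h1, h2⟩ ⟨S, k1, k2⟩
        refine ⟨T.trans S, fun v => ?_, fun γ => ?_⟩
        · rw [k1, h1]; rfl
        · rw [k2, h2]; rfl }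

/-- The deformation space: realizations modulo congruence, with the quotient topology. -/
abbrev DeformationSpace (G : SimpleGraph V) (Γ : Subgroup (G ≃g G)) (q : Configuration G Γ) :
    Type _ :=
  Quotient (congruence G Γ q)

/-- The velocity of a one-parameter family of configurations. -/
def velocity {G : SimpleGraph V} {Γ : Subgroup (G ≃g G)} (c : ℝ → Configuration G Γ) (t : ℝ) :
    Configuration G Γ :=
  (fun v => deriv (fun r => (c r).1 v) t, fun γ => deriv (fun r => (c r).2 γ) t)

/-- The deformation space of `q` is smooth and one-dimensional near the class of `q₀`: its tangent
space there (the space of infinitesimal flexes) has dimension one, and a neighbourhood of the class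
of `q₀` is parametrized by a smooth family `c` of realizations with `c 0 = q₀`, homeomorphically and
with a velocity that is never induced by an infinitesimal isometry. (An open interval as parameter
domain can be replaced by `ℝ`.) -/
def IsSmoothOneDimensionalAt (G : SimpleGraph V) (Γ : Subgroup (G ≃g G))
    (q q₀ : Configuration G Γ) : Prop :=
  Module.finrank ℝ (InfinitesimalFlexes G Γ q₀) = 1 ∧
  ∃ c : ℝ → realizationSpace G Γ q,
    (c 0 : Configuration G Γ) = q₀ ∧
    (∀ v : V, ContDiff ℝ ∞ (fun t => (c t).1.1 v)) ∧
    (∀ γ : Γ, ContDiff ℝ ∞ (fun t => (c t).1.2 γ)) ∧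
    (∀ t : ℝ, velocity (fun r => (c r).1) t ∉ trivialMotions G Γ (c t).1) ∧
    Topology.IsOpenEmbedding
      (fun t : ℝ => (Quotient.mk (congruence G Γ q) (c t) : DeformationSpace G Γ q))

end PeriodicFramework

end

open scoped ContDiff
noncomputable section

namespace PeriodicFramework

/-! ### Free actions and double counting over orbits. -/

section FreeAction

variable {Γ X Y A : Type*} [Group Γ] [MulAction Γ X] [MulAction Γ Y]

/-! Write v, e, f for the numbers of vertex, edge and face orbits. The heart of the proof is a
statement on stresses (`stress_eq_zero`): in a pointed non-crossing periodic framework, an invariant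
equilibrium stress σ vanishes as soon as its stress tensor S = ∑ σ_d w_d ⊗ w_d, summed over edge
orbits with edge vectors w_d, has nonnegative determinant.

To see this, regard σ as a tensor-valued measure carried by the edges in the torus of periods.
Equilibrium makes it divergence-free, so its Fourier coefficient at a frequency ℓ ≠ 0 annihilates ℓ.
The coefficients at ℓ and -ℓ are therefore multiples of one rank-one tensor, and their mixed
discriminant is zero. Hence the correlation of σ with itself, weighted by (w_d × w_e)², is a
multiple of Haar measure, with a factor of the sign of det S (`stress_correlation`). Test this
correlation against a small bump at 0. As edges do not cross, only pairs of edges with a common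
endpoint interact. A change of variables and the equilibrium at the vertex turn the contribution of
a vertex into a positive multiple of ∑ σ_i σ_j |u_i × u_j| over the edge vectors there
(`cross_mul_integral_planeBump`, `sum_abs_cross_cone`). The edge vectors lie in an open half plane;
in terms of slopes x_i this sum is ∑ c_i c_j |x_i - x_j| with ∑ c_i = 0, which is negative unless c
= 0 (`sum_abs_cross_nonpos`). If det S ≥ 0, all local sums must vanish, and so does σ.

For a periodic stress the period equations give S = 0, so it is trivial. A linear dependence among
the first variations of the edge lengths and of the period area is an equilibrium stress with S a
multiple of the identity, so again det S ≥ 0. Thus lengths and area are independent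
(`rigidityMap_prod_surjective`). Infinitesimal isometries preserve both, whence e + 1 ≤ (2v + 4) -
3, i.e. e ≤ 2v. Conversely, pointedness produces at least 2e - v convex corners and each face has at
most three, so 2e ≤ v + 3f (`two_mul_card_edgeOrbit_le`). A duality modulo two on the torus gives f
+ v ≤ e (`card_faceOrbit_add_le`). Together 2v ≤ e, hence e = 2v, and the infinitesimal motions have
dimension 4, three of which are trivial.

For smoothness, the squared lengths, a normalization against isometries and one further linear
functional are local coordinates by the inverse function theorem (`exists_chart`), so the normalized
realizations form a smooth curve. Normalizing is continuous and stays in the congruence class, so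
this curve is open in the deformation space. Nothing distinguishes the initial framework from
another pseudo-triangulated realization, and a subgroup of finite index again satisfies the
hypotheses. -/

/-- No element other than the identity fixes a point. -/
def ActsFreely (Γ X : Type*) [Group Γ] [MulAction Γ X] : Prop :=
  ∀ γ : Γ, γ ≠ 1 → ∀ x : X, γ • x ≠ x

theorem ActsFreely.eq_of_smul_eq (h : ActsFreely Γ X) {γ δ : Γ} {x : X} (e : γ • x = δ • x) :
    γ = δ := by
  by_contra hne
  refine h (δ⁻¹ * γ) (fun h1 => hne (inv_mul_eq_one.1 h1).symm) x ?_
  rw [mul_smul, e, inv_smul_smul]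

theorem exists_smul_of_mk_eq {x y : X}
    (h : (Quotient.mk'' x : MulAction.orbitRel.Quotient Γ X) = Quotient.mk'' y) :
    ∃ γ : Γ, γ • y = x := by
  have := Quotient.exact h
  exact MulAction.orbitRel_apply.1 this

theorem mk_smul (γ : Γ) (x : X) :
    (Quotient.mk'' (γ • x) : MulAction.orbitRel.Quotient Γ X) = Quotient.mk'' x :=
  Quotient.sound (MulAction.orbitRel_apply.2 ⟨γ, rfl⟩)

/-- A free action identifies the set with the product of the orbit space and the group. -/
def orbitProdEquiv (h : ActsFreely Γ X) (r : MulAction.orbitRel.Quotient Γ X → X)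
    (hr : ∀ o, (Quotient.mk'' (r o) : MulAction.orbitRel.Quotient Γ X) = o) :
    MulAction.orbitRel.Quotient Γ X × Γ ≃ X :=
  Equiv.ofBijective (fun a => a.2 • r a.1) <| by
    constructor
    · rintro ⟨o, γ⟩ ⟨o', γ'⟩ e
      have e' : γ • r o = γ' • r o' := e
      have ho : o = o' := by
        rw [← hr o, ← hr o', ← mk_smul γ (r o), e', mk_smul]
      subst ho
      rw [h.eq_of_smul_eq e']
    · intro x
      obtain ⟨γ, hγ⟩ := exists_smul_of_mk_eq (Γ := Γ) (hr (Quotient.mk'' x)).symm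
      exact ⟨(_, γ), hγ⟩

theorem finsum_eq_sum_orbits [AddCommMonoid A] [Fintype (MulAction.orbitRel.Quotient Γ X)]
    (h : ActsFreely Γ X) (r : MulAction.orbitRel.Quotient Γ X → X)
    (hr : ∀ o, (Quotient.mk'' (r o) : MulAction.orbitRel.Quotient Γ X) = o)
    (F : X → A) (hF : F.support.Finite) :
    ∑ᶠ x, F x = ∑ o, ∑ᶠ γ : Γ, F (γ • r o) := by
  rw [← finsum_comp_equiv (orbitProdEquiv h r hr) (f := F), finsum_curry, finsum_eq_sum_of_fintype]
  · rfl
  · exact hF.preimage (orbitProdEquiv h r hr).injective.injOn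

/-- Double counting of a relation modulo two free actions. -/
theorem orbit_sum_comm [AddCommMonoid A] [Fintype (MulAction.orbitRel.Quotient Γ X)]
    [Fintype (MulAction.orbitRel.Quotient Γ Y)] (hX : ActsFreely Γ X) (hY : ActsFreely Γ Y)
    (r : MulAction.orbitRel.Quotient Γ X → X)
    (hr : ∀ o, (Quotient.mk'' (r o) : MulAction.orbitRel.Quotient Γ X) = o)
    (r' : MulAction.orbitRel.Quotient Γ Y → Y)
    (hr' : ∀ o, (Quotient.mk'' (r' o) : MulAction.orbitRel.Quotient Γ Y) = o)
    (F : X → Y → A) (hF : ∀ (γ : Γ) x y, F (γ • x) (γ • y) = F x y)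
    (h1 : ∀ x, (Function.support fun y => F x y).Finite)
    (h2 : ∀ y, (Function.support fun x => F x y).Finite) :
    ∑ o, ∑ᶠ y, F (r o) y = ∑ o', ∑ᶠ x, F x (r' o') := by
  have e1 : ∀ o, ∑ᶠ y, F (r o) y = ∑ o', ∑ᶠ γ : Γ, F (r o) (γ • r' o') := fun o =>
    finsum_eq_sum_orbits hY r' hr' _ (h1 _)
  have e2 : ∀ o', ∑ᶠ x, F x (r' o') = ∑ o, ∑ᶠ γ : Γ, F (γ • r o) (r' o') := fun o' =>
    finsum_eq_sum_orbits hX r hr (fun x => F x (r' o')) (h2 _)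
  simp_rw [e1, e2]
  rw [Finset.sum_comm]
  refine Finset.sum_congr rfl fun o' _ => Finset.sum_congr rfl fun o _ => ?_
  -- The pair (`r o`, `γ • r' o'`) is the translate by `γ` of (`γ⁻¹ • r o`, `r' o'`).
  rw [← finsum_comp_equiv (Equiv.inv Γ)]
  refine finsum_congr fun γ => ?_
  rw [← hF γ, Equiv.inv_apply, smul_inv_smul]

theorem exists_orbit_section (Γ X : Type*) [Group Γ] [MulAction Γ X] :
    ∃ r : MulAction.orbitRel.Quotient Γ X → X,
      ∀ o, (Quotient.mk'' (r o) : MulAction.orbitRel.Quotient Γ X) = o :=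
  ⟨Quotient.out, fun o => Quotient.out_eq' o⟩

end FreeAction

/-! ### Periodic graphs: integer coordinates, orbit representatives, equivariant extension. -/

section Graph

variable {V : Type*} {G : SimpleGraph V} {Γ : Subgroup (G ≃g G)}

theorem adj_smul_iff (γ : Γ) {u v : V} : G.Adj (γ • u) (γ • v) ↔ G.Adj u v :=
  γ.1.map_adj_iff

variable (hG : IsPeriodicGraph G Γ)
include hG

namespace IsPeriodicGraph

theorem free_vertices : ActsFreely Γ V := hG.no_fixed_vertex

theorem free_edges : ActsFreely Γ G.edgeSet := hG.no_fixed_edge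

theorem mul_comm (γ δ : Γ) : γ * δ = δ * γ := by
  obtain ⟨e⟩ := hG.free_abelian
  exact e.injective (by rw [map_mul, map_mul, _root_.mul_comm])

/-- An identification of `Γ` with `ℤ²`. -/
def gen : Γ ≃* Multiplicative (Fin 2 → ℤ) := hG.free_abelian.some

/-- The integer coordinates of an element of `Γ`. -/
def deg (γ : Γ) : Fin 2 → ℤ := Multiplicative.toAdd (hG.gen γ)

theorem deg_mul (γ δ : Γ) : hG.deg (γ * δ) = hG.deg γ + hG.deg δ := by
  simp [deg, map_mul]

theorem deg_one : hG.deg 1 = 0 := by simp [deg]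

theorem deg_injective : Function.Injective hG.deg :=
  Multiplicative.toAdd.injective.comp hG.gen.injective

/-- The element of `Γ` with given coordinates. -/
def ofDeg (c : Fin 2 → ℤ) : Γ := hG.gen.symm (Multiplicative.ofAdd c)

theorem deg_ofDeg (c : Fin 2 → ℤ) : hG.deg (hG.ofDeg c) = c := by simp [deg, ofDeg]

theorem ofDeg_deg (γ : Γ) : hG.ofDeg (hG.deg γ) = γ := by simp [deg, ofDeg]

theorem ofDeg_add (c d : Fin 2 → ℤ) : hG.ofDeg (c + d) = hG.ofDeg c * hG.ofDeg d := by
  simp [ofDeg]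

/-- The two generators of `Γ`. -/
def basis (j : Fin 2) : Γ := hG.ofDeg (Pi.single j 1)

theorem deg_basis (j : Fin 2) : hG.deg (hG.basis j) = Pi.single j 1 := hG.deg_ofDeg _

theorem hom_eq_sum {A : Type*} [AddCommGroup A] (f : Γ → A) (hf : ∀ γ δ, f (γ * δ) = f γ + f δ)
    (γ : Γ) : f γ = ∑ j, hG.deg γ j • f (hG.basis j) := by
  let F : (Fin 2 → ℤ) →+ A := AddMonoidHom.mk' (fun c => f (hG.ofDeg c)) fun c d => by
    rw [ofDeg_add, hf]
  have h1 : f γ = F (hG.deg γ) := by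
    change _ = f (hG.ofDeg _); rw [ofDeg_deg]
  have h2 : hG.deg γ = ∑ j, hG.deg γ j • (Pi.single j 1 : Fin 2 → ℤ) := by
    ext i; simp [Finset.sum_apply, Pi.single_apply]
  rw [h1]
  conv_lhs => rw [h2]
  rw [map_sum]
  simp_rw [map_zsmul]
  rfl

/-- The representative of a vertex orbit. -/
def rep (_ : IsPeriodicGraph G Γ) (o : VertexOrbit G Γ) : V := Quotient.out o

theorem mk_rep (o : VertexOrbit G Γ) : (Quotient.mk'' (hG.rep o) : VertexOrbit G Γ) = o :=
  Quotient.out_eq' o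

theorem exists_shift (v : V) : ∃ γ : Γ, γ • hG.rep (Quotient.mk'' v) = v :=
  exists_smul_of_mk_eq (hG.mk_rep (Quotient.mk'' v)).symm

/-- The group element carrying the representative of the orbit of `v` to `v`. -/
def shift (v : V) : Γ := (hG.exists_shift v).choose

theorem shift_smul_rep (v : V) : hG.shift v • hG.rep (Quotient.mk'' v) = v :=
  (hG.exists_shift v).choose_spec

theorem shift_smul (γ : Γ) (v : V) : hG.shift (γ • v) = γ * hG.shift v := by
  apply hG.free_vertices.eq_of_smul_eq (x := hG.rep (Quotient.mk'' v))
  rw [mul_smul, hG.shift_smul_rep v]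
  conv_lhs => rw [← mk_smul γ v]
  exact hG.shift_smul_rep (γ • v)

theorem shift_rep (o : VertexOrbit G Γ) : hG.shift (hG.rep o) = 1 := by
  apply hG.free_vertices.eq_of_smul_eq (x := hG.rep o)
  have := hG.shift_smul_rep (hG.rep o)
  rw [mk_rep] at this
  rw [this, one_smul]

/-- One edge orbit contains at most two edges at `u`: an element carrying an edge at `u` to another
one either fixes `u`, hence is the identity, or carries the other endpoint to `u`, which determines
it by freeness. -/
theorem finite_neighborSet (u : V) : (G.neighborSet u).Finite := by
  have := hG.finite_edges
  let f : G.neighborSet u → EdgeOrbit G Γ := fun v => Quotient.mk'' ⟨s(u, v.1), v.2⟩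
  have hfib : ∀ β, {v : G.neighborSet u | f v = β}.Finite := by
    intro β
    by_cases hne : ∃ v : G.neighborSet u, f v = β
    · obtain ⟨v₀, hv₀⟩ := hne
      obtain ⟨w, hw⟩ := exists_smul_of_mk_eq (Γ := Γ) (X := V) (x := u) (y := u) rfl
      by_cases hγ : ∃ γ : Γ, γ • v₀.1 = u
      · obtain ⟨γ, hγ⟩ := hγ
        refine Set.Finite.subset (s := {v : G.neighborSet u | v.1 = v₀.1 ∨ v.1 = γ • u}) ?_ ?_
        · have : {v : G.neighborSet u | v.1 = v₀.1 ∨ v.1 = γ • u} ⊆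
              Subtype.val ⁻¹' {v₀.1, γ • u} := fun v hv => hv
          exact ((Set.toFinite _).preimage Subtype.val_injective.injOn).subset this
        · intro v hv
          obtain ⟨δ, hδ⟩ := exists_smul_of_mk_eq (Γ := Γ) (hv.trans hv₀.symm)
          have h2 : s(δ • u, δ • v₀.1) = s(u, v.1) := congrArg Subtype.val hδ
          rw [Sym2.eq_iff] at h2
          rcases h2 with ⟨h3, h4⟩ | ⟨h3, h4⟩
          · have : δ = 1 := hG.free_vertices.eq_of_smul_eq (x := u) (by rw [h3, one_smul])
            left; rw [← h4, this, one_smul]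
          · have : δ = γ := hG.free_vertices.eq_of_smul_eq (x := v₀.1) (by rw [h4, hγ])
            right; rw [← h3, this]
      · refine Set.Finite.subset (s := {v : G.neighborSet u | v.1 = v₀.1}) ?_ ?_
        · have : {v : G.neighborSet u | v.1 = v₀.1} ⊆ Subtype.val ⁻¹' {v₀.1} := fun v hv => hv
          exact ((Set.toFinite _).preimage Subtype.val_injective.injOn).subset this
        · intro v hv
          obtain ⟨δ, hδ⟩ := exists_smul_of_mk_eq (Γ := Γ) (hv.trans hv₀.symm)
          have h2 : s(δ • u, δ • v₀.1) = s(u, v.1) := congrArg Subtype.val hδ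
          rw [Sym2.eq_iff] at h2
          rcases h2 with ⟨h3, h4⟩ | ⟨h3, h4⟩
          · have : δ = 1 := hG.free_vertices.eq_of_smul_eq (x := u) (by rw [h3, one_smul])
            change v.1 = v₀.1
            rw [← h4, this, one_smul]
          · exact absurd ⟨δ, h4⟩ hγ
    · convert Set.finite_empty
      ext v; simp only [Set.mem_ofPred_eq, Set.mem_empty_iff_false, iff_false]
      exact fun h => hne ⟨v, h⟩
  have : Finite (G.neighborSet u) := by
    have h := Set.Finite.biUnion (Set.finite_univ (α := EdgeOrbit G Γ)) (fun β _ => hfib β)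
    rw [← Set.finite_univ_iff]
    exact h.subset fun v _ => by simp
  exact Set.toFinite _

theorem infinite_group : Infinite Γ := by
  have : Infinite (Fin 2 → ℤ) := inferInstance
  exact Infinite.of_injective hG.ofDeg (fun a b h => by
    rw [← hG.deg_ofDeg a, h, hG.deg_ofDeg])

theorem exists_adj (u : V) : ∃ v, G.Adj u v := by
  have := hG.infinite_group
  obtain ⟨γ, hγ⟩ := exists_ne (1 : Γ)
  have : Nontrivial V := ⟨u, γ • u, (hG.no_fixed_vertex γ hγ u).symm⟩
  exact hG.connected.preconnected.exists_adj_of_nontrivial u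

theorem countable_vertices : Countable V := by
  have := hG.finite_vertices
  have : Countable Γ := hG.deg_injective.countable
  exact (orbitProdEquiv hG.free_vertices hG.rep hG.mk_rep).symm.injective.countable

/-- The equivariant pair of functions determined by the values at the vertex representatives and
at the generators of `Γ`. -/
def extend {A : Type*} [AddCommGroup A] (z : (VertexOrbit G Γ → A) × (Fin 2 → A)) :
    (V → A) × (Γ → A) :=
  (fun v => z.1 (Quotient.mk'' v) + ∑ j, hG.deg (hG.shift v) j • z.2 j,
    fun γ => ∑ j, hG.deg γ j • z.2 j)

/-- The values of an equivariant pair at the vertex representatives and at the generators. -/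
def restrict {A : Type*} (w : (V → A) × (Γ → A)) : (VertexOrbit G Γ → A) × (Fin 2 → A) :=
  (fun o => w.1 (hG.rep o), fun j => w.2 (hG.basis j))

variable {A : Type*} [AddCommGroup A]

theorem extend_mul (z : (VertexOrbit G Γ → A) × (Fin 2 → A)) (γ δ : Γ) :
    (hG.extend z).2 (γ * δ) = (hG.extend z).2 γ + (hG.extend z).2 δ := by
  simp only [extend, deg_mul, Pi.add_apply, add_smul, Finset.sum_add_distrib]

theorem extend_smul (z : (VertexOrbit G Γ → A) × (Fin 2 → A)) (γ : Γ) (v : V) :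
    (hG.extend z).1 (γ • v) = (hG.extend z).1 v + (hG.extend z).2 γ := by
  simp only [extend, mk_smul, hG.shift_smul, deg_mul, Pi.add_apply, add_smul,
    Finset.sum_add_distrib]
  abel

theorem restrict_extend (z : (VertexOrbit G Γ → A) × (Fin 2 → A)) :
    hG.restrict (hG.extend z) = z := by
  refine Prod.ext (funext fun o => ?_) (funext fun j => ?_)
  · simp [restrict, extend, mk_rep, shift_rep, deg_one]
  · simp only [restrict, extend, deg_basis]
    rw [Finset.sum_eq_single j (fun i _ hi => by rw [Pi.single_eq_of_ne hi, zero_smul]) (by simp),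
      Pi.single_eq_same, one_smul]

theorem extend_restrict (w : (V → A) × (Γ → A)) (h1 : ∀ γ δ, w.2 (γ * δ) = w.2 γ + w.2 δ)
    (h2 : ∀ (γ : Γ) v, w.1 (γ • v) = w.1 v + w.2 γ) : hG.extend (hG.restrict w) = w := by
  refine Prod.ext (funext fun v => ?_) (funext fun γ => ?_)
  · simp only [restrict, extend]
    rw [← hG.hom_eq_sum w.2 h1, ← h2, shift_smul_rep]
  · simp only [restrict, extend]
    rw [← hG.hom_eq_sum w.2 h1]

end IsPeriodicGraph

end Graph

end PeriodicFramework
end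

open scoped ContDiff
noncomputable section

namespace PeriodicFramework

/-! ### Sums over oriented edges modulo translations. -/

section Darts

variable {V : Type*} {G : SimpleGraph V} {Γ : Subgroup (G ≃g G)} (hG : IsPeriodicGraph G Γ)

namespace IsPeriodicGraph

/-- The neighbours of a vertex, as a finite set. -/
def nbr (u : V) : Finset V := (hG.finite_neighborSet u).toFinset

theorem mem_nbr {u v : V} : v ∈ hG.nbr u ↔ G.Adj u v := by simp [nbr]

theorem smul_mem_nbr {u v : V} (γ : Γ) : γ • v ∈ hG.nbr (γ • u) ↔ v ∈ hG.nbr u := by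
  rw [mem_nbr, mem_nbr, adj_smul_iff]

theorem finite_darts : {d : V × V | d.1 ∈ Set.range hG.rep ∧ G.Adj d.1 d.2}.Finite := by
  have := hG.finite_vertices
  refine Set.Finite.subset (Set.Finite.biUnion (Set.finite_range hG.rep) fun u _ =>
    ((hG.finite_neighborSet u).image fun v => (u, v))) ?_
  rintro ⟨u, v⟩ ⟨h1, h2⟩
  exact Set.mem_biUnion h1 ⟨v, h2, rfl⟩

/-- Representatives of the orbits of oriented edges: those starting at a vertex representative. -/
def darts : Finset (V × V) := hG.finite_darts.toFinset

theorem mem_darts {d : V × V} : d ∈ hG.darts ↔ d.1 ∈ Set.range hG.rep ∧ G.Adj d.1 d.2 := by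
  simp [darts]

theorem rep_injective : Function.Injective hG.rep := fun a b h => by
  rw [← hG.mk_rep a, h, hG.mk_rep]

variable {A : Type*} [AddCommMonoid A]

theorem sum_darts [Fintype (VertexOrbit G Γ)] (H : V × V → A) :
    ∑ d ∈ hG.darts, H d = ∑ o, ∑ v ∈ hG.nbr (hG.rep o), H (hG.rep o, v) := by
  rw [Finset.sum_sigma']
  symm
  refine Finset.sum_bij (fun a _ => (hG.rep a.1, a.2)) ?_ ?_ ?_ ?_
  · rintro ⟨o, v⟩ h
    simp only [Finset.mem_sigma, mem_nbr, Finset.mem_univ, true_and] at h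
    exact hG.mem_darts.2 ⟨⟨o, rfl⟩, h⟩
  · rintro ⟨o, v⟩ _ ⟨o', v'⟩ _ h
    simp only [Prod.mk.injEq] at h
    obtain ⟨h1, h2⟩ := h
    rw [hG.rep_injective h1, h2]
  · rintro ⟨u, v⟩ h
    obtain ⟨⟨o, ho⟩, h2⟩ := hG.mem_darts.1 h
    simp only at ho h2
    subst ho
    exact ⟨⟨o, v⟩, by simpa [mem_nbr] using h2, rfl⟩
  · rintro ⟨o, v⟩ _; rfl

open Classical in
theorem sum_nbr_eq_finsum (u : V) (H : V → A) :
    ∑ v ∈ hG.nbr u, H v = ∑ᶠ v, if G.Adj u v then H v else 0 := by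
  rw [finsum_eq_sum_of_support_subset (s := hG.nbr u)]
  · exact Finset.sum_congr rfl fun v hv => by rw [if_pos (hG.mem_nbr.1 hv)]
  · intro v hv
    by_contra h
    exact hv (if_neg fun h' => h (hG.mem_nbr.2 h'))

/-- Double counting of the adjacency relation with itself: reversing a dart and translating its new
start back to a representative permutes the dart orbits. -/
theorem sum_darts_swap (H : V × V → A) (hH : ∀ (γ : Γ) u v, H (γ • u, γ • v) = H (u, v)) :
    ∑ d ∈ hG.darts, H d = ∑ d ∈ hG.darts, H d.swap := by
  classical
  have := hG.finite_vertices
  have := Fintype.ofFinite (VertexOrbit G Γ)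
  rw [sum_darts, sum_darts]
  simp_rw [sum_nbr_eq_finsum]
  have h1 : ∀ x, (Function.support fun y => if G.Adj x y then H (x, y) else 0).Finite := fun x =>
    (hG.finite_neighborSet x).subset fun y hy => by
      by_contra h; exact hy (if_neg h)
  have h2 : ∀ y, (Function.support fun x => if G.Adj x y then H (x, y) else 0).Finite := fun y =>
    (hG.finite_neighborSet y).subset fun x hx => by
      by_contra h; exact hx (if_neg fun h' => h h'.symm)
  have := orbit_sum_comm hG.free_vertices hG.free_vertices hG.rep hG.mk_rep hG.rep hG.mk_rep
    (fun x y => if G.Adj x y then H (x, y) else 0)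
    (fun γ x y => by simp only [adj_smul_iff, hH]) h1 h2
  rw [this]
  refine Finset.sum_congr rfl fun o _ => finsum_congr fun v => ?_
  simp only [G.adj_comm v, Prod.swap_prod_mk]

theorem sum_darts_eq_sum_edges [Fintype (EdgeOrbit G Γ)] (r : EdgeOrbit G Γ → V × V)
    (hr : ∀ β, G.Adj (r β).1 (r β).2)
    (hr' : ∀ β, (Quotient.mk'' (⟨s((r β).1, (r β).2), hr β⟩ : G.edgeSet) : EdgeOrbit G Γ) = β)
    (H : V × V → A) (hH : ∀ (γ : Γ) u v, H (γ • u, γ • v) = H (u, v)) :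
    ∑ d ∈ hG.darts, H d = ∑ β, (H (r β) + H (r β).swap) := by
  classical
  have := hG.finite_vertices
  have := Fintype.ofFinite (VertexOrbit G Γ)
  -- `F` lives on flags of a vertex and an incident edge, where it is the value of `H` on the edge
  -- oriented away from the vertex. Summing flags by vertices or by edges gives the two sides.
  let F : V → G.edgeSet → A := fun v e => if h : v ∈ e.1 then H (v, Sym2.Mem.other h) else 0
  have hF : ∀ u v (h : G.Adj u v), F u ⟨s(u, v), h⟩ = H (u, v) := by
    intro u v h
    have hm : u ∈ s(u, v) := Sym2.mem_mk_left u v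
    have : Sym2.Mem.other hm = v := Sym2.congr_right.1 (Sym2.other_spec hm)
    simp only [F]
    rw [dif_pos hm, this]
  have hF0 : ∀ u (e : G.edgeSet), u ∉ e.1 → F u e = 0 := fun u e h => dif_neg h
  have hinv : ∀ (γ : Γ) x y, F (γ • x) (γ • y) = F x y := by
    rintro γ x ⟨e, he⟩
    induction e using Sym2.ind with
    | _ a b =>
      have he' : G.Adj a b := he
      have e1 : γ • (⟨s(a, b), he⟩ : G.edgeSet) = ⟨s(γ • a, γ • b), (adj_smul_iff γ).2 he'⟩ := rfl
      rw [e1]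
      by_cases hx : x = a
      · subst hx; rw [hF _ _ ((adj_smul_iff γ).2 he'), hH]; exact (hF _ _ he').symm
      · by_cases hx' : x = b
        · subst hx'
          have e2 : (⟨s(γ • a, γ • x), (adj_smul_iff γ).2 he'⟩ : G.edgeSet) =
            ⟨s(γ • x, γ • a), (adj_smul_iff γ).2 he'.symm⟩ := Subtype.ext Sym2.eq_swap
          have e3 : (⟨s(a, x), he⟩ : G.edgeSet) = ⟨s(x, a), he'.symm⟩ := Subtype.ext Sym2.eq_swap
          rw [e2, e3, hF _ _ ((adj_smul_iff γ).2 he'.symm), hH]; exact (hF _ _ he'.symm).symm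
        · rw [hF0, hF0]
          · simp [hx, hx']
          · simp only [Sym2.mem_iff, smul_left_cancel_iff]; simp [hx, hx']
  have hsupp : ∀ x : V, Function.support (F x) ⊆
      ((hG.nbr x).attach.image fun v => (⟨s(x, v.1), hG.mem_nbr.1 v.2⟩ : G.edgeSet)) := by
    rintro x ⟨e, he⟩ hy
    have hm : x ∈ e := by by_contra h; exact hy (hF0 _ _ h)
    obtain ⟨v, rfl⟩ := hm
    simp only [Finset.coe_image, Set.mem_image]
    exact ⟨⟨v, hG.mem_nbr.2 he⟩, by simp, rfl⟩
  have key := orbit_sum_comm hG.free_vertices hG.free_edges hG.rep hG.mk_rep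
    (fun β => ⟨s((r β).1, (r β).2), hr β⟩) hr' F hinv
    (fun x => (Finset.finite_toSet _).subset (hsupp x)) (by
      rintro ⟨e, he⟩
      induction e using Sym2.ind with
      | _ a b =>
        refine (Set.toFinite {a, b}).subset fun x hx => ?_
        by_contra h
        exact hx (hF0 _ _ (by simpa using h)))
  rw [sum_darts]
  have e1 : ∀ o, ∑ v ∈ hG.nbr (hG.rep o), H (hG.rep o, v) = ∑ᶠ e, F (hG.rep o) e := by
    intro o
    rw [finsum_eq_sum_of_support_subset _ (hsupp _), Finset.sum_image, ← Finset.sum_attach]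
    · exact Finset.sum_congr rfl fun v _ => (hF _ _ _).symm
    · rintro v _ w _ h
      exact Subtype.ext (Sym2.congr_right.1 (congrArg Subtype.val h))
  simp_rw [e1]
  rw [key]
  refine Finset.sum_congr rfl fun β _ => ?_
  rw [finsum_eq_sum_of_support_subset (s := {(r β).1, (r β).2}), Finset.sum_pair (hr β).ne]
  · rw [hF]
    have e2 : (⟨s((r β).1, (r β).2), hr β⟩ : G.edgeSet) = ⟨s((r β).2, (r β).1), (hr β).symm⟩ :=
      Subtype.ext Sym2.eq_swap
    rw [e2, hF]; rfl
  · intro x hx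
    by_contra h
    exact hx (hF0 _ _ (by simpa using h))

theorem exists_edge_section (_ : IsPeriodicGraph G Γ) : ∃ r : EdgeOrbit G Γ → V × V, ∃ hr : ∀ β, G.Adj (r β).1 (r β).2,
    ∀ β, (Quotient.mk'' (⟨s((r β).1, (r β).2), hr β⟩ : G.edgeSet) : EdgeOrbit G Γ) = β := by
  have : ∀ β : EdgeOrbit G Γ, ∃ d : V × V, ∃ h : G.Adj d.1 d.2,
      (Quotient.mk'' (⟨s(d.1, d.2), h⟩ : G.edgeSet) : EdgeOrbit G Γ) = β := by
    intro β
    induction β using Quotient.inductionOn' with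
    | h e =>
      obtain ⟨e, he⟩ := e
      induction e using Sym2.ind with
      | _ a b => exact ⟨(a, b), he, rfl⟩
  choose r hr hr' using this
  exact ⟨r, hr, hr'⟩

/-- A dart is carried to a dart representative. -/
theorem exists_smul_dart {u v : V} (h : G.Adj u v) :
    ∃ (γ : Γ) (d : V × V), d ∈ hG.darts ∧ γ • d.1 = u ∧ γ • d.2 = v := by
  refine ⟨hG.shift u, (hG.rep (Quotient.mk'' u), (hG.shift u)⁻¹ • v), ?_, hG.shift_smul_rep u,
    smul_inv_smul _ _⟩
  refine hG.mem_darts.2 ⟨⟨_, rfl⟩, (adj_smul_iff (hG.shift u)).1 ?_⟩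
  rwa [hG.shift_smul_rep, smul_inv_smul]

end IsPeriodicGraph

end Darts

/-! ### Geometry of periodic placements: lattice coordinates and local finiteness. -/

section Placement

variable {V : Type*} {G : SimpleGraph V} {Γ : Subgroup (G ≃g G)} {q : Configuration G Γ}

theorem IsPeriodicPlacement.map_one (hq : IsPeriodicPlacement G Γ q) : q.2 1 = 0 := by
  have := hq.map_mul 1 1
  rw [mul_one] at this
  exact left_eq_add.1 this

theorem IsPeriodicPlacement.sub_smul (hq : IsPeriodicPlacement G Γ q) (γ : Γ) (u v : V) :
    q.1 (γ • v) - q.1 (γ • u) = q.1 v - q.1 u := by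
  rw [hq.equivariant, hq.equivariant, add_sub_add_right_eq_sub]

theorem span_basis_eq_top (hG : IsPeriodicGraph G Γ) (hq : IsPeriodicPlacement G Γ q) :
    Submodule.span ℝ (Set.range fun j => q.2 (hG.basis j)) = ⊤ := by
  rw [eq_top_iff, ← hq.rank_two, Submodule.span_le]
  rintro _ ⟨γ, rfl⟩
  rw [hG.hom_eq_sum q.2 hq.map_mul γ]
  refine Submodule.sum_mem _ fun j _ => ?_
  rw [← Int.cast_smul_eq_zsmul ℝ]
  exact Submodule.smul_mem _ _ (Submodule.subset_span ⟨j, rfl⟩)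

/-- The periods of the two generators form a basis of the plane. -/
def periodBasis (hG : IsPeriodicGraph G Γ) (hq : IsPeriodicPlacement G Γ q) :
    Module.Basis (Fin 2) ℝ Plane :=
  basisOfTopLeSpanOfCardEqFinrank (fun j => q.2 (hG.basis j)) (span_basis_eq_top hG hq).ge (by simp)

theorem periodBasis_apply (hG : IsPeriodicGraph G Γ) (hq : IsPeriodicPlacement G Γ q) (j : Fin 2) :
    periodBasis hG hq j = q.2 (hG.basis j) := by
  simp [periodBasis]

/-- Coordinates in which the lattice of periods is `ℤ²`. -/
def latticeCoord (hG : IsPeriodicGraph G Γ) (hq : IsPeriodicPlacement G Γ q) :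
    Plane ≃L[ℝ] (Fin 2 → ℝ) :=
  (periodBasis hG hq).equivFun.toContinuousLinearEquiv

theorem latticeCoord_period (hG : IsPeriodicGraph G Γ) (hq : IsPeriodicPlacement G Γ q) (γ : Γ) :
    latticeCoord hG hq (q.2 γ) = fun j => (hG.deg γ j : ℝ) := by
  have h : q.2 γ = ∑ j, (hG.deg γ j : ℝ) • periodBasis hG hq j := by
    rw [hG.hom_eq_sum q.2 hq.map_mul γ]
    refine Finset.sum_congr rfl fun j _ => ?_
    rw [periodBasis_apply, Int.cast_smul_eq_zsmul]
  change (periodBasis hG hq).equivFun (q.2 γ) = _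
  rw [h, Module.Basis.equivFun_apply, Module.Basis.repr_sum_self]

/-- Bounded periods have bounded integer coordinates with respect to the lattice basis. -/
theorem finite_period_norm_le (hG : IsPeriodicGraph G Γ) (hq : IsPeriodicPlacement G Γ q) (C : ℝ) :
    {γ : Γ | ‖q.2 γ‖ ≤ C}.Finite := by
  obtain ⟨N, hN⟩ := exists_nat_ge (‖(latticeCoord hG hq : Plane →L[ℝ] (Fin 2 → ℝ))‖ * C)
  refine Set.Finite.subset ((Set.finite_Icc (fun _ : Fin 2 => -(N : ℤ)) (fun _ => (N : ℤ))).preimage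
    hG.deg_injective.injOn) fun γ hγ => ?_
  have h1 : ∀ j, |(hG.deg γ j : ℝ)| ≤ N := fun j => by
    have h2 := (latticeCoord hG hq : Plane →L[ℝ] (Fin 2 → ℝ)).le_opNorm (q.2 γ)
    have h3 := norm_le_pi_norm (latticeCoord hG hq (q.2 γ)) j
    rw [latticeCoord_period] at h3
    calc |(hG.deg γ j : ℝ)| ≤ _ := h3
      _ ≤ ‖(latticeCoord hG hq : Plane →L[ℝ] (Fin 2 → ℝ))‖ * ‖q.2 γ‖ := by
        rw [← latticeCoord_period hG hq]; exact h2
      _ ≤ _ := (mul_le_mul_of_nonneg_left hγ (norm_nonneg _)).trans hN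
  refine ⟨fun j => ?_, fun j => ?_⟩
  · have := (abs_le.1 (h1 j)).1; exact_mod_cast this
  · have := (abs_le.1 (h1 j)).2; exact_mod_cast this

theorem segment_smul (hq : IsPeriodicPlacement G Γ q) (γ : Γ) (a b : V) (x : Plane) :
    x ∈ segment ℝ (q.1 (γ • a)) (q.1 (γ • b)) ↔ x - q.2 γ ∈ segment ℝ (q.1 a) (q.1 b) := by
  rw [hq.equivariant, hq.equivariant, add_comm (q.1 a), add_comm (q.1 b), ← segment_translate_image]
  constructor
  · rintro ⟨y, hy, rfl⟩; simpa using hy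
  · intro h; exact ⟨_, h, by simp⟩

/-- Only finitely many edges meet a bounded set. -/
theorem finite_edges_meeting_ball (hG : IsPeriodicGraph G Γ) (hq : IsPeriodicPlacement G Γ q)
    (C : ℝ) : {d : V × V | G.Adj d.1 d.2 ∧
      (segment ℝ (q.1 d.1) (q.1 d.2) ∩ Metric.closedBall 0 C).Nonempty}.Finite := by
  have hbd : ∃ R, ∀ d ∈ hG.darts, ∀ x ∈ segment ℝ (q.1 d.1) (q.1 d.2), ‖x‖ ≤ R := by
    have : Bornology.IsBounded (⋃ d ∈ hG.darts, segment ℝ (q.1 d.1) (q.1 d.2)) :=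
      (Bornology.isBounded_biUnion_finset _).2 fun d _ => by
        rw [← convexHull_pair]
        exact isBounded_convexHull.2 (Set.Finite.isBounded (Set.toFinite {q.1 d.1, q.1 d.2}))
    obtain ⟨R, hR⟩ := this.exists_norm_le
    exact ⟨R, fun d hd x hx => hR x (Set.mem_biUnion hd hx)⟩
  obtain ⟨R, hR⟩ := hbd
  refine Set.Finite.subset (Set.Finite.image (fun a : Γ × (V × V) => (a.1 • a.2.1, a.1 • a.2.2))
    ((finite_period_norm_le hG hq (C + R)).prod hG.darts.finite_toSet)) ?_
  rintro ⟨u, v⟩ ⟨h, x, hx, hxC⟩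
  obtain ⟨γ, d, hd, h1, h2⟩ := hG.exists_smul_dart h
  simp only at hx h1 h2
  refine ⟨(γ, d), ⟨?_, hd⟩, by simp only [h1, h2]⟩
  rw [← h1, ← h2, segment_smul hq] at hx
  have h3 := hR d hd _ hx
  rw [Metric.mem_closedBall, dist_zero_right] at hxC
  change ‖q.2 γ‖ ≤ C + R
  calc ‖q.2 γ‖ = ‖x - (x - q.2 γ)‖ := by rw [sub_sub_cancel]
    _ ≤ ‖x‖ + ‖x - q.2 γ‖ := norm_sub_le _ _
    _ ≤ C + R := add_le_add hxC h3

theorem isClosed_segment' (a b : Plane) : IsClosed (segment ℝ a b) := by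
  rw [← convexHull_pair]
  exact (Set.toFinite {a, b}).isClosed_convexHull ℝ

theorem isCompact_segment' (a b : Plane) : IsCompact (segment ℝ a b) := by
  rw [← convexHull_pair]
  exact (Set.toFinite {a, b}).isCompact_convexHull ℝ

/-- Near any point, only the edges through that point are present. -/
theorem exists_ball_edges (hG : IsPeriodicGraph G Γ) (hq : IsPeriodicPlacement G Γ q) (x : Plane) :
    ∃ r > 0, ∀ a b, G.Adj a b → ∀ y ∈ Metric.ball x r, y ∈ segment ℝ (q.1 a) (q.1 b) →
      x ∈ segment ℝ (q.1 a) (q.1 b) := by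
  have hfin := finite_edges_meeting_ball hG hq (‖x‖ + 1)
  -- Only finitely many edges come within distance one; each of those missing `x` is a closed set
  -- that stays away from `x`.
  have h : (⋂ d ∈ {d ∈ {d : V × V | G.Adj d.1 d.2 ∧ (segment ℝ (q.1 d.1) (q.1 d.2) ∩
      Metric.closedBall 0 (‖x‖ + 1)).Nonempty} | x ∉ segment ℝ (q.1 d.1) (q.1 d.2)},
      (segment ℝ (q.1 d.1) (q.1 d.2))ᶜ) ∈ nhds x := by
    rw [Filter.biInter_mem (hfin.subset (Set.sep_subset _ _))]
    rintro d ⟨_, hd⟩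
    exact (isClosed_segment' _ _).isOpen_compl.mem_nhds hd
  obtain ⟨r, hr, hsub⟩ := Metric.mem_nhds_iff.1 h
  refine ⟨min r 1, lt_min hr one_pos, fun a b hab y hy hys => ?_⟩
  by_contra hx
  have hy' := Metric.mem_ball.1 hy
  have hyr : y ∈ Metric.ball x r := Metric.mem_ball.2 (hy'.trans_le (min_le_left _ _))
  have := hsub hyr
  rw [Set.mem_iInter₂] at this
  refine this (a, b) ⟨⟨hab, y, hys, ?_⟩, hx⟩ hys
  rw [Metric.mem_closedBall, dist_zero_right]
  have : ‖y‖ ≤ ‖x‖ + ‖y - x‖ := by simpa using norm_add_le x (y - x)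
  rw [dist_eq_norm] at hy'
  linarith [min_le_right r 1]

/-- The non-crossing condition speaks of edges only, so a vertex lying on an edge is detected
through some edge that ends at this vertex. -/
theorem eq_or_eq_of_mem_segment (hG : IsPeriodicGraph G Γ) (hq : IsPeriodicPlacement G Γ q)
    (hnc : IsNonCrossing G q.1) {v a b : V} (hab : G.Adj a b)
    (h : q.1 v ∈ segment ℝ (q.1 a) (q.1 b)) : v = a ∨ v = b := by
  by_contra hne
  obtain ⟨w, hw⟩ := hG.exists_adj v
  have hs : s(v, w) ≠ s(a, b) := fun e => by
    have : v ∈ s(a, b) := e ▸ Sym2.mem_mk_left v w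
    exact hne (by simpa using this)
  obtain ⟨x, ⟨hx1, hx2⟩, hx⟩ := hnc v w a b hw hab hs ⟨left_mem_segment ℝ _ _, h⟩
  rcases hx1 with rfl | hx1
  · exact hne (by simpa using hx2)
  · rw [Set.mem_singleton_iff] at hx1
    subst hx1
    exact hq.ne_of_adj _ _ hw hx.symm

/-- The determinant of two vectors of the plane. -/
def cross (x y : Plane) : ℝ := x 0 * y 1 - x 1 * y 0

theorem cross_swap (x y : Plane) : cross x y = -cross y x := by simp only [cross]; ring

theorem cross_self (x : Plane) : cross x x = 0 := by simp only [cross]; ring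

theorem cross_sum_left {ι : Type*} (s : Finset ι) (f : ι → Plane) (y : Plane) :
    cross (∑ i ∈ s, f i) y = ∑ i ∈ s, cross (f i) y := by
  simp [cross, WithLp.ofLp_sum, Finset.sum_apply, Finset.sum_mul, Finset.sum_sub_distrib]

theorem inner_plane (x y : Plane) : inner ℝ x y = x 0 * y 0 + x 1 * y 1 := by
  simp [PiLp.inner_apply, Fin.sum_univ_two, mul_comm]

theorem plane_ext {x y : Plane} (h0 : x 0 = y 0) (h1 : x 1 = y 1) : x = y := by
  ext i; fin_cases i <;> assumption

/-- Two edges at a pointed vertex of a non-crossing framework are not parallel. -/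
theorem cross_ne_zero_of_nbr (hG : IsPeriodicGraph G Γ) (hq : IsPeriodicPlacement G Γ q)
    (hnc : IsNonCrossing G q.1) {n : Plane} {u a b : V}
    (hn : ∀ v, G.Adj u v → 0 < inner ℝ n (q.1 v - q.1 u)) (ha : G.Adj u a) (hb : G.Adj u b)
    (hab : a ≠ b) : cross (q.1 a - q.1 u) (q.1 b - q.1 u) ≠ 0 := by
  -- Parallel edges would point the same way, both being on the positive side of `n`; the shorter
  -- one would then end inside the longer one.
  have key : ∀ a b, G.Adj u a → G.Adj u b → a ≠ b →
      cross (q.1 a - q.1 u) (q.1 b - q.1 u) = 0 →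
      inner ℝ n (q.1 b - q.1 u) ≤ inner ℝ n (q.1 a - q.1 u) → False := by
    intro a b ha hb hab h hle
    have ha' := hn a ha
    have hb' := hn b hb
    set x := q.1 a - q.1 u with hx
    set y := q.1 b - q.1 u with hy
    set t := inner ℝ n y / inner ℝ n x with ht
    have hxy : y = t • x := by
      have hne := ha'.ne'
      rw [inner_plane] at hne
      simp only [cross] at h
      apply plane_ext
      · simp only [PiLp.smul_apply, smul_eq_mul, ht, inner_plane]
        field_simp
        linear_combination (-n 1) * h
      · simp only [PiLp.smul_apply, smul_eq_mul, ht, inner_plane]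
        field_simp
        linear_combination (n 0) * h
    have ht0 : 0 ≤ t := (div_pos hb' ha').le
    have ht1 : t ≤ 1 := (div_le_one ha').2 hle
    have hmem : q.1 b ∈ segment ℝ (q.1 u) (q.1 a) := by
      rw [segment_eq_image']
      refine ⟨t, ⟨ht0, ht1⟩, ?_⟩
      change q.1 u + t • x = q.1 b
      rw [← hxy, hy]; abel
    rcases eq_or_eq_of_mem_segment hG hq hnc ha hmem with h1 | h1
    · subst h1; exact hb.ne rfl
    · exact hab h1.symm
  intro h
  rcases le_total (inner ℝ n (q.1 b - q.1 u)) (inner ℝ n (q.1 a - q.1 u)) with h1 | h1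
  · exact key a b ha hb hab h h1
  · exact key b a hb ha hab.symm (by rw [cross_swap, h, neg_zero]) h1

end Placement

end PeriodicFramework
end

open scoped ContDiff
noncomputable section

namespace PeriodicFramework

/-! ### Negativity of the local quadratic form at a pointed vertex. -/

section Quadratic

variable {ι : Type*} [DecidableEq ι]

theorem sum_mul_abs_sub_insert (s : Finset ι) (a : ι) (ha : a ∉ s) (x c : ι → ℝ)
    (hx : ∀ i ∈ s, x i ≤ x a) :
    ∑ i ∈ insert a s, ∑ j ∈ insert a s, c i * c j * |x i - x j| =
      ∑ i ∈ s, ∑ j ∈ s, c i * c j * |x i - x j| + 2 * c a * ∑ i ∈ s, c i * (x a - x i) := by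
  have h1 : ∀ i, ∑ j ∈ insert a s, c i * c j * |x i - x j| =
      c i * c a * |x i - x a| + ∑ j ∈ s, c i * c j * |x i - x j| := fun i =>
    Finset.sum_insert ha
  rw [Finset.sum_insert ha, h1]
  simp_rw [h1]
  rw [Finset.sum_add_distrib, sub_self, abs_zero, mul_zero, zero_add]
  have h2 : ∑ j ∈ s, c a * c j * |x a - x j| = c a * ∑ i ∈ s, c i * (x a - x i) := by
    rw [Finset.mul_sum]
    refine Finset.sum_congr rfl fun i hi => ?_
    rw [abs_of_nonneg (sub_nonneg.2 (hx i hi))]; ring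
  have h3 : ∑ j ∈ s, c j * c a * |x j - x a| = c a * ∑ i ∈ s, c i * (x a - x i) := by
    rw [Finset.mul_sum]
    refine Finset.sum_congr rfl fun i hi => ?_
    rw [abs_sub_comm, abs_of_nonneg (sub_nonneg.2 (hx i hi))]; ring
  rw [h2, h3]; ring

/-- The right side minus the left side is twice the integral, up to `M`, of the square of the
partial sums of `c` in the order of `x`. The induction adds the points in increasing order; `M` is
arbitrary so that the next point can serve as the bound. -/
theorem sum_mul_abs_sub_le (s : Finset ι) (x c : ι → ℝ) (M : ℝ) (hM : ∀ i ∈ s, x i ≤ M) :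
    ∑ i ∈ s, ∑ j ∈ s, c i * c j * |x i - x j| ≤
      2 * (∑ i ∈ s, c i) * ∑ i ∈ s, c i * (M - x i) := by
  induction s using Finset.induction_on_max_value x generalizing M with
  | empty => simp
  | insert a s ha hx ih =>
    have h := ih (x a) hx
    rw [sum_mul_abs_sub_insert s a ha x c hx, Finset.sum_insert ha, Finset.sum_insert ha]
    have h2 : ∑ i ∈ s, c i * (M - x i) = ∑ i ∈ s, c i * (x a - x i) + (∑ i ∈ s, c i) * (M - x a) := by
      rw [Finset.sum_mul, ← Finset.sum_add_distrib]
      exact Finset.sum_congr rfl fun i _ => by ring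
    rw [h2]
    have h3 : 0 ≤ (c a + ∑ i ∈ s, c i) ^ 2 * (M - x a) :=
      mul_nonneg (sq_nonneg _) (sub_nonneg.2 (hM a (Finset.mem_insert_self _ _)))
    nlinarith [h, h3]

/-- Equality makes every partial sum vanish, because distinct points below `M` leave intervals of
positive length between them. Consecutive partial sums differ by the coefficients. -/
theorem eq_zero_of_sum_mul_abs_sub (s : Finset ι) (x c : ι → ℝ) (M : ℝ) (hM : ∀ i ∈ s, x i < M)
    (hx : Set.InjOn x s) (h : 2 * (∑ i ∈ s, c i) * (∑ i ∈ s, c i * (M - x i)) ≤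
      ∑ i ∈ s, ∑ j ∈ s, c i * c j * |x i - x j|) : ∀ i ∈ s, c i = 0 := by
  induction s using Finset.induction_on_max_value x generalizing M with
  | empty => simp
  | insert a s ha hxa ih =>
    have hlt : ∀ i ∈ s, x i < x a := fun i hi => lt_of_le_of_ne (hxa i hi) fun e =>
      ha (hx (by simp [hi]) (by simp) e ▸ hi)
    have hle := sum_mul_abs_sub_le s x c (x a) hxa
    rw [sum_mul_abs_sub_insert s a ha x c hxa, Finset.sum_insert ha, Finset.sum_insert ha] at h
    have h2 : ∑ i ∈ s, c i * (M - x i) = ∑ i ∈ s, c i * (x a - x i) + (∑ i ∈ s, c i) * (M - x a) := by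
      rw [Finset.sum_mul, ← Finset.sum_add_distrib]
      exact Finset.sum_congr rfl fun i _ => by ring
    rw [h2] at h
    have hpos : 0 < M - x a := sub_pos.2 (hM a (Finset.mem_insert_self _ _))
    have h3 : (c a + ∑ i ∈ s, c i) ^ 2 * (M - x a) ≤ 0 := by nlinarith [h, hle]
    have h4 : c a + ∑ i ∈ s, c i = 0 := by
      have : (c a + ∑ i ∈ s, c i) ^ 2 ≤ 0 := by
        by_contra hc
        exact absurd h3 (not_le.2 (mul_pos (not_le.1 hc) hpos))
      exact pow_eq_zero_iff two_ne_zero |>.1 (le_antisymm this (sq_nonneg _))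
    have h5 := ih (x a) hlt (hx.mono (by simp)) (by
      have h6 : c a = -∑ i ∈ s, c i := by linarith
      rw [h6] at h
      nlinarith [h])
    intro i hi
    rcases Finset.mem_insert.1 hi with rfl | hi
    · rw [Finset.sum_eq_zero h5] at h4; linarith
    · exact h5 i hi

variable (s : Finset ι) (u : ι → Plane) (σ : ι → ℝ) (n : Plane)

theorem cross_mul_inner (n x y : Plane) :
    cross x y * inner ℝ n n = inner ℝ n x * cross n y - inner ℝ n y * cross n x := by
  simp only [inner_plane, cross]; ring

/-- Central projection of the half plane to a line orthogonal to `n`: vectors become points with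
coordinate `cross n x / inner ℝ n x`, and areas become weighted distances. -/
theorem abs_cross_eq (n x y : Plane) (hx : 0 < inner ℝ n x) (hy : 0 < inner ℝ n y) :
    |cross x y| * inner ℝ n n = inner ℝ n x * inner ℝ n y *
      |cross n x / inner ℝ n x - cross n y / inner ℝ n y| := by
  have hn : (0 : ℝ) ≤ inner ℝ n n := real_inner_self_nonneg
  have h : cross n x / inner ℝ n x - cross n y / inner ℝ n y =
      -(cross x y * inner ℝ n n) / (inner ℝ n x * inner ℝ n y) := by
    rw [cross_mul_inner]; field_simp; ring
  rw [h, abs_div, abs_neg, abs_mul, abs_of_nonneg hn, abs_of_pos (mul_pos hx hy)]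
  field_simp

theorem inner_self_pos_of_inner_pos {n x : Plane} (hx : 0 < inner ℝ n x) :
    (0 : ℝ) < inner ℝ n n := by
  rw [real_inner_self_pos]
  rintro rfl
  simp at hx

/-- For vectors in an open half plane with a linear dependency, the quadratic form
`∑ σᵢ σⱼ |uᵢ × uⱼ|` is negative unless the dependency is trivial. -/
theorem sum_abs_cross_nonpos (hn : ∀ i ∈ s, 0 < inner ℝ n (u i)) (hs : ∑ i ∈ s, σ i • u i = 0) :
    ∑ i ∈ s, ∑ j ∈ s, σ i * σ j * |cross (u i) (u j)| ≤ 0 ∧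
    ((∀ i ∈ s, ∀ j ∈ s, i ≠ j → cross (u i) (u j) ≠ 0) →
      ∑ i ∈ s, ∑ j ∈ s, σ i * σ j * |cross (u i) (u j)| = 0 → ∀ i ∈ s, σ i = 0) := by
  rcases s.eq_empty_or_nonempty with rfl | ⟨i₀, hi₀⟩
  · simp
  have hnn := inner_self_pos_of_inner_pos (hn i₀ hi₀)
  set c : ι → ℝ := fun i => σ i * inner ℝ n (u i) with hc
  set x : ι → ℝ := fun i => cross n (u i) / inner ℝ n (u i) with hx
  have hsum : ∑ i ∈ s, c i = 0 := by
    have := congrArg (fun y => inner ℝ n y) hs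
    simp only [inner_sum, inner_smul_right, inner_zero_right] at this
    exact this
  have hQ : (∑ i ∈ s, ∑ j ∈ s, σ i * σ j * |cross (u i) (u j)|) * inner ℝ n n =
      ∑ i ∈ s, ∑ j ∈ s, c i * c j * |x i - x j| := by
    rw [Finset.sum_mul]
    refine Finset.sum_congr rfl fun i hi => ?_
    rw [Finset.sum_mul]
    refine Finset.sum_congr rfl fun j hj => ?_
    rw [mul_assoc, abs_cross_eq n _ _ (hn i hi) (hn j hj)]
    simp only [hc, hx]; ring
  obtain ⟨M, hM⟩ : ∃ M, ∀ i ∈ s, x i < M := by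
    obtain ⟨M, hM⟩ := (s.image x).exists_le
    exact ⟨M + 1, fun i hi => (hM _ (Finset.mem_image_of_mem x hi)).trans_lt (lt_add_one _)⟩
  have hle := sum_mul_abs_sub_le s x c M fun i hi => (hM i hi).le
  rw [hsum, mul_zero, zero_mul, ← hQ] at hle
  refine ⟨nonpos_of_mul_nonpos_left hle hnn, fun hne h0 i hi => ?_⟩
  have hinj : Set.InjOn x s := by
    intro i hi j hj hij
    by_contra hij'
    have := abs_cross_eq n _ _ (hn i hi) (hn j hj)
    have e : cross n (u i) / inner ℝ n (u i) = cross n (u j) / inner ℝ n (u j) := hij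
    rw [e, sub_self, abs_zero, mul_zero] at this
    rcases mul_eq_zero.1 this with h | h
    · exact hne i hi j hj hij' (abs_eq_zero.1 h)
    · exact hnn.ne' h
  have := eq_zero_of_sum_mul_abs_sub s x c M hM hinj (by
    rw [hsum, mul_zero, zero_mul, ← hQ, h0, zero_mul]) i hi
  exact (mul_eq_zero.1 this).resolve_right (hn i hi).ne'

/-- Here `a`, `b`, `k` stand for z × u, z × u' and u × u'. The cones ℝ₊u - ℝ₊u' and ℝ₊u' - ℝ₊u are
opposite, and z lies in one of them exactly when u and u' are on the same side of the line through
z. -/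
theorem cone_indicator_add {a b k : ℝ} (ha : a ≠ 0) (hb : b ≠ 0) (hk : k ≠ 0) :
    (if 0 < a * k ∧ 0 < b * k then (1 : ℝ) else 0) + (if 0 < b * -k ∧ 0 < a * -k then 1 else 0) =
      if 0 < a * b then 1 else 0 := by
  rcases lt_or_gt_of_ne ha with h1 | h1 <;> rcases lt_or_gt_of_ne hb with h2 | h2 <;>
    rcases lt_or_gt_of_ne hk with h3 | h3 <;>
    simp [mul_pos_iff, mul_neg_iff, h1, h2, h3, h1.not_gt, h2.not_gt, h3.not_gt]

/-- Two vectors are on the same side of a line, or they are separated by it in exactly one of the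
two orders. -/
theorem sign_indicator_add {a b : ℝ} (ha : a ≠ 0) (hb : b ≠ 0) :
    (if 0 < a * b then (1 : ℝ) else 0) + ((if 0 < a then if ¬ 0 < b then 1 else 0 else 0) +
      (if 0 < b then if ¬ 0 < a then 1 else 0 else 0)) = 1 := by
  rcases lt_or_gt_of_ne ha with h1 | h1 <;> rcases lt_or_gt_of_ne hb with h2 | h2 <;>
    simp [mul_pos_iff, h1, h2, h1.not_gt, h2.not_gt]

omit [DecidableEq ι] in
open Classical in
/-- The pairs of vectors `uᵢ, uⱼ` whose cone `ℝ₊uᵢ - ℝ₊uⱼ` contains `z` contribute half of the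
quadratic form. -/
theorem sum_abs_cross_cone (hn : ∀ i ∈ s, 0 < inner ℝ n (u i)) (hs : ∑ i ∈ s, σ i • u i = 0)
    (z : Plane) (hz : ∀ i ∈ s, cross z (u i) ≠ 0) :
    2 * ∑ i ∈ s, ∑ j ∈ s, σ i * σ j * |cross (u i) (u j)| *
      (if 0 < cross z (u i) * cross (u i) (u j) ∧ 0 < cross z (u j) * cross (u i) (u j)
        then 1 else 0) =
    ∑ i ∈ s, ∑ j ∈ s, σ i * σ j * |cross (u i) (u j)| := by
  set f : ι → ι → ℝ := fun i j => σ i * σ j * |cross (u i) (u j)| *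
      (if 0 < cross z (u i) * cross (u i) (u j) ∧ 0 < cross z (u j) * cross (u i) (u j)
        then 1 else 0) with hf
  -- Adding the two orders of a pair replaces the cone condition by the condition that both vectors
  -- are on the same side of `z`.
  have e1 : 2 * ∑ i ∈ s, ∑ j ∈ s, f i j = ∑ i ∈ s, ∑ j ∈ s, (f i j + f j i) := by
    simp_rw [Finset.sum_add_distrib]
    rw [Finset.sum_comm (f := fun i j => f j i)]; ring
  have e2 : ∀ i ∈ s, ∀ j ∈ s, f i j + f j i = σ i * σ j * |cross (u i) (u j)| *
      (if 0 < cross z (u i) * cross z (u j) then 1 else 0) := by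
    intro i hi j hj
    simp only [hf]
    rw [cross_swap (u j) (u i), abs_neg]
    rcases eq_or_ne (cross (u i) (u j)) 0 with h0 | h0
    · rw [h0]; simp
    · rw [← cone_indicator_add (hz i hi) (hz j hj) h0]; ring
  -- the mixed pairs cancel
  set I := s.filter fun i => 0 < cross z (u i) with hI
  set J := s.filter fun i => ¬ 0 < cross z (u i) with hJ
  have hsplit : ∑ i ∈ I, σ i • u i = -∑ i ∈ J, σ i • u i := by
    rw [eq_neg_iff_add_eq_zero, hI, hJ, Finset.sum_filter_add_sum_filter_not, hs]
  -- By the linear dependency the two partial sums are opposite vectors, so their cross product is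
  -- zero.
  have hmix : ∑ i ∈ I, ∑ j ∈ J, σ i * σ j * cross (u i) (u j) = 0 := by
    have : ∑ i ∈ I, ∑ j ∈ J, σ i * σ j * cross (u i) (u j) =
        cross (∑ i ∈ I, σ i • u i) (∑ j ∈ J, σ j • u j) := by
      rw [cross_sum_left]
      refine Finset.sum_congr rfl fun i _ => ?_
      rw [cross_swap, cross_sum_left, ← Finset.sum_neg_distrib]
      refine Finset.sum_congr rfl fun j _ => ?_
      simp only [cross, PiLp.smul_apply, smul_eq_mul]; ring
    rw [this, hsplit]
    simp only [cross, PiLp.neg_apply]; ring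
  -- On mixed pairs this identity forces uᵢ × uⱼ to have the sign opposite to that of ⟨n, z⟩. The
  -- absolute values can therefore be removed with one common sign; if ⟨n, z⟩ = 0 there are no mixed
  -- pairs.
  have hid : ∀ i j, cross (u i) (u j) * inner ℝ n z =
      inner ℝ n (u i) * cross z (u j) - inner ℝ n (u j) * cross z (u i) := by
    intro i j; simp only [inner_plane, cross]; ring
  have hmixabs : ∑ i ∈ I, ∑ j ∈ J, σ i * σ j * |cross (u i) (u j)| = 0 := by
    rcases lt_trichotomy 0 (inner ℝ n z) with hz0 | hz0 | hz0
    · have : ∀ i ∈ I, ∀ j ∈ J, σ i * σ j * |cross (u i) (u j)| =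
          -(σ i * σ j * cross (u i) (u j)) := by
        intro i hi j hj
        obtain ⟨hi1, hi2⟩ := Finset.mem_filter.1 hi
        obtain ⟨hj1, hj2⟩ := Finset.mem_filter.1 hj
        have h1 := mul_pos (hn j hj1) hi2
        have h2 := mul_nonpos_of_nonneg_of_nonpos (hn i hi1).le (not_lt.1 hj2)
        have : cross (u i) (u j) < 0 := neg_of_mul_neg_left (by rw [hid]; linarith) hz0.le
        rw [abs_of_neg this]; ring
      rw [Finset.sum_congr rfl fun i hi => Finset.sum_congr rfl (this i hi)]
      simp_rw [Finset.sum_neg_distrib]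
      rw [hmix, neg_zero]
    · refine Finset.sum_eq_zero fun i hi => Finset.sum_eq_zero fun j hj => ?_
      obtain ⟨hi1, hi2⟩ := Finset.mem_filter.1 hi
      obtain ⟨hj1, hj2⟩ := Finset.mem_filter.1 hj
      have h1 := mul_pos (hn j hj1) hi2
      have h2 := mul_nonpos_of_nonneg_of_nonpos (hn i hi1).le (not_lt.1 hj2)
      have := hid i j
      rw [← hz0, mul_zero] at this
      linarith
    · have : ∀ i ∈ I, ∀ j ∈ J, σ i * σ j * |cross (u i) (u j)| =
          σ i * σ j * cross (u i) (u j) := by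
        intro i hi j hj
        obtain ⟨hi1, hi2⟩ := Finset.mem_filter.1 hi
        obtain ⟨hj1, hj2⟩ := Finset.mem_filter.1 hj
        have h1 := mul_pos (hn j hj1) hi2
        have h2 := mul_nonpos_of_nonneg_of_nonpos (hn i hi1).le (not_lt.1 hj2)
        have : 0 < cross (u i) (u j) := by
          by_contra hc
          have := mul_nonneg_of_nonpos_of_nonpos (not_lt.1 hc) hz0.le
          rw [hid] at this; linarith
        rw [abs_of_pos this]
      rw [Finset.sum_congr rfl fun i hi => Finset.sum_congr rfl (this i hi)]
      exact hmix
  rw [e1, Finset.sum_congr rfl fun i hi => Finset.sum_congr rfl (e2 i hi)]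
  have e3 : ∀ i ∈ s, ∀ j ∈ s, σ i * σ j * |cross (u i) (u j)| =
      σ i * σ j * |cross (u i) (u j)| * (if 0 < cross z (u i) * cross z (u j) then 1 else 0) +
      (σ i * σ j * |cross (u i) (u j)| *
        (if 0 < cross z (u i) then if ¬ 0 < cross z (u j) then 1 else 0 else 0) +
       σ j * σ i * |cross (u j) (u i)| *
        (if 0 < cross z (u j) then if ¬ 0 < cross z (u i) then 1 else 0 else 0)) := by
    intro i hi j hj
    rw [cross_swap (u j) (u i), abs_neg]
    linear_combination -(σ i * σ j * |cross (u i) (u j)|) * sign_indicator_add (hz i hi) (hz j hj)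
  have e4 : ∑ i ∈ s, ∑ j ∈ s, σ i * σ j * |cross (u i) (u j)| *
      (if 0 < cross z (u i) then if ¬ 0 < cross z (u j) then 1 else 0 else 0) = 0 := by
    have : ∀ i ∈ s, ∑ j ∈ s, σ i * σ j * |cross (u i) (u j)| *
        (if 0 < cross z (u i) then if ¬ 0 < cross z (u j) then 1 else 0 else 0) =
        if 0 < cross z (u i) then ∑ j ∈ J, σ i * σ j * |cross (u i) (u j)| else 0 := by
      intro i _
      by_cases h : 0 < cross z (u i)
      · simp only [if_pos h, hJ, Finset.sum_filter, mul_ite, mul_one, mul_zero]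
      · simp only [if_neg h, mul_zero, Finset.sum_const_zero]
    rw [Finset.sum_congr rfl this, ← Finset.sum_filter, hmixabs]
  symm
  rw [Finset.sum_congr rfl fun i hi => Finset.sum_congr rfl (e3 i hi)]
  simp_rw [Finset.sum_add_distrib]
  rw [e4, zero_add]
  conv_lhs => rw [Finset.sum_comm (f := fun i j => σ j * σ i * |cross (u j) (u i)| *
        (if 0 < cross z (u j) then if ¬ 0 < cross z (u i) then 1 else 0 else 0))]
  rw [e4, add_zero]

end Quadratic

end PeriodicFramework
end

open scoped ContDiff
noncomputable section

namespace PeriodicFramework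

/-! ### Waves along segments and mixed discriminants. -/

section Fourier

open MeasureTheory

/-- The unit square. -/
def unitSquare : Set (ℝ × ℝ) := Set.Icc 0 1 ×ˢ Set.Icc 0 1

theorem isCompact_unitSquare : IsCompact unitSquare := isCompact_Icc.prod isCompact_Icc

theorem measurableSet_unitSquare : MeasurableSet unitSquare :=
  isCompact_unitSquare.isClosed.measurableSet

theorem volume_unitSquare : (volume : Measure (ℝ × ℝ)) unitSquare = 1 := by
  rw [unitSquare, Measure.volume_eq_prod, Measure.prod_prod]; simp

/-- The wave with frequency `ℓ`. -/
def wave (ℓ : Plane →L[ℝ] ℝ) (x : Plane) : ℂ := Complex.exp (2 * Real.pi * Complex.I * (ℓ x : ℝ))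

theorem wave_add (ℓ : Plane →L[ℝ] ℝ) (x y : Plane) : wave ℓ (x + y) = wave ℓ x * wave ℓ y := by
  simp [wave, ← Complex.exp_add, mul_add]

theorem wave_neg (ℓ : Plane →L[ℝ] ℝ) (x : Plane) : wave ℓ (-x) = wave (-ℓ) x := by
  simp [wave]

theorem continuous_wave (ℓ : Plane →L[ℝ] ℝ) : Continuous (wave ℓ) := by
  unfold wave; fun_prop

theorem wave_eq_one (ℓ : Plane →L[ℝ] ℝ) (x : Plane) (m : ℤ) (h : ℓ x = m) : wave ℓ x = 1 := by
  rw [wave, h, Complex.exp_eq_one_iff]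
  exact ⟨m, by push_cast; ring⟩

/-- The fundamental theorem of calculus along the segment; keeping the factor `ℓ w` on the left
includes the case `ℓ w = 0`. -/
theorem integral_wave_mul (ℓ : Plane →L[ℝ] ℝ) (x w : Plane) :
    (∫ t in Set.Icc (0 : ℝ) 1, wave ℓ (x + t • w)) * (ℓ w : ℝ) =
      (2 * Real.pi * Complex.I)⁻¹ * (wave ℓ (x + w) - wave ℓ x) := by
  have hd : ∀ t : ℝ, HasDerivAt (fun t : ℝ => wave ℓ (x + t • w))
      (wave ℓ (x + t • w) * (2 * Real.pi * Complex.I * (ℓ w : ℝ))) t := by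
    intro t
    have h1 : HasDerivAt (fun t : ℝ => 2 * Real.pi * Complex.I * ((ℓ x + t * ℓ w : ℝ) : ℂ))
        (2 * Real.pi * Complex.I * (ℓ w : ℝ)) t := by
      refine HasDerivAt.const_mul _ (HasDerivAt.ofReal_comp ?_)
      simpa using ((hasDerivAt_id t).mul_const (ℓ w)).const_add (ℓ x)
    convert h1.cexp using 1
    · funext t; simp [wave]
    · simp [wave]
  have h2 := intervalIntegral.integral_eq_sub_of_hasDerivAt (a := 0) (b := 1) (fun t _ => hd t)
    (by
      refine Continuous.intervalIntegrable ?_ _ _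
      exact ((continuous_wave ℓ).comp (by fun_prop)).mul continuous_const)
  rw [intervalIntegral.integral_mul_const, intervalIntegral.integral_of_le zero_le_one,
    ← integral_Icc_eq_integral_Ioc, one_smul, zero_smul, add_zero] at h2
  rw [← h2]
  have : (2 * Real.pi * Complex.I : ℂ) ≠ 0 := Complex.two_pi_I_ne_zero
  field_simp

theorem clm_plane_apply (ℓ : Plane →L[ℝ] ℝ) (w : Plane) :
    ℓ w = ℓ (EuclideanSpace.single 0 1) * w 0 + ℓ (EuclideanSpace.single 1 1) * w 1 := by
  have h : w = w 0 • EuclideanSpace.single 0 1 + w 1 • EuclideanSpace.single 1 1 := by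
    apply plane_ext <;> simp
  conv_lhs => rw [h]
  rw [map_add, map_smul, map_smul, smul_eq_mul, smul_eq_mul]; ring

/-- The square of the cross product is bilinear in the tensors `w d ⊗ w d` and `w e ⊗ w e`, so the
double sum is the mixed discriminant of the two moment tensors with weights `a` and `b`. -/
theorem sum_cross_sq {ι : Type*} (D : Finset ι) (w : ι → Plane) (a b : ι → ℂ) :
    ∑ d ∈ D, ∑ e ∈ D, a d * b e * ((cross (w d) (w e) ^ 2 : ℝ) : ℂ) =
      (∑ d ∈ D, a d * (w d 0 : ℂ) ^ 2) * (∑ d ∈ D, b d * (w d 1 : ℂ) ^ 2) +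
      (∑ d ∈ D, a d * (w d 1 : ℂ) ^ 2) * (∑ d ∈ D, b d * (w d 0 : ℂ) ^ 2) -
      2 * (∑ d ∈ D, a d * (w d 0 * w d 1 : ℂ)) * (∑ d ∈ D, b d * (w d 0 * w d 1 : ℂ)) := by
  rw [mul_assoc, Finset.sum_mul_sum, Finset.sum_mul_sum, Finset.sum_mul_sum]
  simp_rw [Finset.mul_sum]
  simp_rw [← Finset.sum_add_distrib, ← Finset.sum_sub_distrib]
  refine Finset.sum_congr rfl fun d _ => Finset.sum_congr rfl fun e _ => ?_
  simp only [cross]; push_cast; ring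

/-- The hypotheses say that both moment tensors annihilate `ℓ`. In the plane they are then multiples
of one and the same rank-one tensor, whose mixed discriminant with itself is zero. -/
theorem sum_cross_sq_eq_zero {ι : Type*} (D : Finset ι) (w : ι → Plane) (a b : ι → ℂ)
    (ℓ : Plane →L[ℝ] ℝ) (hℓ : ℓ ≠ 0)
    (ha : ∀ i, ∑ d ∈ D, a d * (ℓ (w d) : ℝ) * (w d i : ℝ) = 0)
    (hb : ∀ i, ∑ d ∈ D, b d * (ℓ (w d) : ℝ) * (w d i : ℝ) = 0) :
    ∑ d ∈ D, ∑ e ∈ D, a d * b e * ((cross (w d) (w e) ^ 2 : ℝ) : ℂ) = 0 := by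
  rw [sum_cross_sq]
  set k0 := ℓ (EuclideanSpace.single 0 1) with hk0
  set k1 := ℓ (EuclideanSpace.single 1 1) with hk1
  have key : ∀ a : ι → ℂ, (∀ i, ∑ d ∈ D, a d * (ℓ (w d) : ℝ) * (w d i : ℝ) = 0) →
      (k0 : ℂ) * (∑ d ∈ D, a d * (w d 0 : ℂ) ^ 2) + k1 * (∑ d ∈ D, a d * (w d 0 * w d 1 : ℂ)) = 0 ∧
      (k0 : ℂ) * (∑ d ∈ D, a d * (w d 0 * w d 1 : ℂ)) + k1 * (∑ d ∈ D, a d * (w d 1 : ℂ) ^ 2) =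
        0 := by
    intro a ha
    constructor
    · rw [← ha 0, Finset.mul_sum, Finset.mul_sum, ← Finset.sum_add_distrib]
      refine Finset.sum_congr rfl fun d _ => ?_
      rw [clm_plane_apply ℓ]; push_cast; ring
    · rw [← ha 1, Finset.mul_sum, Finset.mul_sum, ← Finset.sum_add_distrib]
      refine Finset.sum_congr rfl fun d _ => ?_
      rw [clm_plane_apply ℓ]; push_cast; ring
  obtain ⟨a1, a2⟩ := key a ha
  obtain ⟨b1, b2⟩ := key b hb
  generalize (∑ d ∈ D, a d * (w d 0 : ℂ) ^ 2) = A at *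
  generalize (∑ d ∈ D, a d * (w d 0 * w d 1 : ℂ)) = B at *
  generalize (∑ d ∈ D, a d * (w d 1 : ℂ) ^ 2) = C at *
  generalize (∑ d ∈ D, b d * (w d 0 : ℂ) ^ 2) = A' at *
  generalize (∑ d ∈ D, b d * (w d 0 * w d 1 : ℂ)) = B' at *
  generalize (∑ d ∈ D, b d * (w d 1 : ℂ) ^ 2) = C' at *
  by_cases h0 : (k0 : ℂ) = 0
  · have h1 : (k1 : ℂ) ≠ 0 := by
      intro h1
      apply hℓ
      ext w
      rw [clm_plane_apply ℓ, ← hk0, ← hk1, Complex.ofReal_eq_zero.1 h0, Complex.ofReal_eq_zero.1 h1]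
      simp
    simp only [h0, zero_mul, zero_add, mul_eq_zero, h1, false_or] at a1 a2 b1 b2
    rw [a1, a2, b2]; ring
  · have : (k0 : ℂ) ^ 2 * (A * C' + C * A' - 2 * B * B') = 0 := by
      linear_combination (k0 * C') * a1 + (k0 * C) * b1 - (k1 * C') * a2 - (k1 * C) * b2
        - (2 * B' * k0 - 0) * a2 + (2 * k1 * C) * b2
    exact (mul_eq_zero.1 this).resolve_left (pow_ne_zero 2 h0)

/-- Integration over the unit square along a continuous map to the torus. -/
def squareFunctional (h : ℝ × ℝ → UnitAddTorus (Fin 2)) (hh : Continuous h) :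
    C(UnitAddTorus (Fin 2), ℂ) →L[ℂ] ℂ :=
  LinearMap.mkContinuous
    { toFun := fun F => ∫ t in unitSquare, F (h t)
      map_add' := fun F F' => by
        simp only [ContinuousMap.add_apply]
        exact integral_add
          ((F.continuous.comp hh).continuousOn.integrableOn_compact isCompact_unitSquare)
          ((F'.continuous.comp hh).continuousOn.integrableOn_compact isCompact_unitSquare)
      map_smul' := fun c F => by
        simp only [ContinuousMap.smul_apply, RingHom.id_apply]
        exact integral_smul c _ } 1 fun F => by
    have := norm_setIntegral_le_of_norm_le_const (μ := volume) (s := unitSquare)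
      (f := fun t => F (h t)) (C := ‖F‖) (by rw [volume_unitSquare]; exact ENNReal.one_lt_top)
      (fun t _ => F.norm_coe_le_norm _)
    rw [measureReal_def, volume_unitSquare] at this
    simpa using this

theorem squareFunctional_apply (h : ℝ × ℝ → UnitAddTorus (Fin 2)) (hh : Continuous h)
    (F : C(UnitAddTorus (Fin 2), ℂ)) : squareFunctional h hh F = ∫ t in unitSquare, F (h t) := rfl

end Fourier

/-! ### Autocorrelation of a stress on the torus of periods. -/

section Stress

open MeasureTheory

variable {V : Type*} {G : SimpleGraph V} {Γ : Subgroup (G ≃g G)} {q : Configuration G Γ}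

/-- The projection of the plane to the torus of the lattice of periods. -/
def toTorus (hG : IsPeriodicGraph G Γ) (hq : IsPeriodicPlacement G Γ q) (x : Plane) :
    UnitAddTorus (Fin 2) := fun j => ((latticeCoord hG hq x j : ℝ) : UnitAddCircle)

theorem continuous_toTorus (hG : IsPeriodicGraph G Γ) (hq : IsPeriodicPlacement G Γ q) :
    Continuous (toTorus hG hq) := by
  refine continuous_pi fun j => (AddCircle.continuous_mk' 1).comp ?_
  exact (continuous_apply j).comp (latticeCoord hG hq).continuous

/-- The frequency of a character of the torus. -/
def frequency (hG : IsPeriodicGraph G Γ) (hq : IsPeriodicPlacement G Γ q) (n : Fin 2 → ℤ) :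
    Plane →L[ℝ] ℝ :=
  ∑ j, (n j : ℝ) • (ContinuousLinearMap.proj j ∘L (latticeCoord hG hq : Plane →L[ℝ] (Fin 2 → ℝ)))

theorem frequency_apply (hG : IsPeriodicGraph G Γ) (hq : IsPeriodicPlacement G Γ q)
    (n : Fin 2 → ℤ) (x : Plane) :
    frequency hG hq n x = ∑ j, (n j : ℝ) * latticeCoord hG hq x j := by
  simp [frequency]

theorem frequency_period (hG : IsPeriodicGraph G Γ) (hq : IsPeriodicPlacement G Γ q)
    (n : Fin 2 → ℤ) (γ : Γ) :
    frequency hG hq n (q.2 γ) = ((∑ j, n j * hG.deg γ j : ℤ) : ℝ) := by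
  rw [frequency_apply, latticeCoord_period]; push_cast; rfl

theorem frequency_basis (hG : IsPeriodicGraph G Γ) (hq : IsPeriodicPlacement G Γ q)
    (n : Fin 2 → ℤ) (j : Fin 2) : frequency hG hq n (q.2 (hG.basis j)) = n j := by
  rw [frequency_period, hG.deg_basis]
  simp [Pi.single_apply]

theorem mFourier_toTorus (hG : IsPeriodicGraph G Γ) (hq : IsPeriodicPlacement G Γ q)
    (n : Fin 2 → ℤ) (x : Plane) :
    UnitAddTorus.mFourier n (toTorus hG hq x) = wave (frequency hG hq n) x := by
  simp only [UnitAddTorus.mFourier, ContinuousMap.coe_mk, toTorus, fourier_coe_apply, wave,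
    frequency_apply, Fin.prod_univ_two, Fin.sum_univ_two, ← Complex.exp_add]
  congr 1
  push_cast; ring

theorem wave_period (hG : IsPeriodicGraph G Γ) (hq : IsPeriodicPlacement G Γ q)
    (n : Fin 2 → ℤ) (γ : Γ) : wave (frequency hG hq n) (q.2 γ) = 1 :=
  wave_eq_one _ _ _ (frequency_period hG hq n γ)

/-- A `Γ`-invariant symmetric weight on the edges that is in equilibrium at each vertex. -/
structure IsStressWeight (hG : IsPeriodicGraph G Γ) (p : V → Plane) (σ : V → V → ℝ) : Prop where
  support : ∀ u v, ¬ G.Adj u v → σ u v = 0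
  symm : ∀ u v, σ u v = σ v u
  invariant : ∀ (γ : Γ) u v, σ (γ • u) (γ • v) = σ u v
  equilibrium : ∀ u, ∑ v ∈ hG.nbr u, σ u v • (p v - p u) = 0

/-- The vector of an oriented edge. -/
def dartVec (p : V → Plane) (d : V × V) : Plane := p d.2 - p d.1

variable (hG : IsPeriodicGraph G Γ) (hq : IsPeriodicPlacement G Γ q) {σ : V → V → ℝ}
  (hσ : IsStressWeight hG q.1 σ)
include hq hσ

-- Equilibrium at each representative, multiplied by a number depending only on the starting vertex.
omit hq in
theorem sum_darts_start (f : V → ℂ) (i : Fin 2) :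
    ∑ d ∈ hG.darts, (σ d.1 d.2 : ℂ) * f d.1 * (dartVec q.1 d i : ℝ) = 0 := by
  have := hG.finite_vertices
  have := Fintype.ofFinite (VertexOrbit G Γ)
  rw [hG.sum_darts]
  refine Finset.sum_eq_zero fun o _ => ?_
  have h := congrArg (fun x : Plane => ((x i : ℝ) : ℂ)) (hσ.equilibrium (hG.rep o))
  simp only [WithLp.ofLp_sum, Finset.sum_apply, PiLp.smul_apply, PiLp.zero_apply,
    Complex.ofReal_sum, Complex.ofReal_zero, smul_eq_mul, Complex.ofReal_mul] at h
  rw [← mul_zero (f (hG.rep o)), ← h, Finset.mul_sum]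
  refine Finset.sum_congr rfl fun v _ => ?_
  simp only [dartVec]; ring

/-- Reversing the darts moves the weight from the starting vertex to the end vertex, so both halves
of the difference vanish by equilibrium. -/
theorem sum_darts_difference (f : V → ℂ) (hf : ∀ (γ : Γ) v, f (γ • v) = f v) (i : Fin 2) :
    ∑ d ∈ hG.darts, (σ d.1 d.2 : ℂ) * (f d.2 - f d.1) * (dartVec q.1 d i : ℝ) = 0 := by
  have h1 := sum_darts_start hG hσ f i
  have h2 : ∑ d ∈ hG.darts, (σ d.1 d.2 : ℂ) * f d.2 * (dartVec q.1 d i : ℝ) = 0 := by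
    rw [hG.sum_darts_swap (fun d => (σ d.1 d.2 : ℂ) * f d.2 * (dartVec q.1 d i : ℝ))]
    · rw [← neg_zero, ← h1, ← Finset.sum_neg_distrib]
      refine Finset.sum_congr rfl fun d _ => ?_
      simp only [Prod.fst_swap, Prod.snd_swap, dartVec, PiLp.sub_apply, hσ.symm d.2 d.1]
      push_cast; ring
    · intro γ u v
      simp only [hσ.invariant, hf, dartVec, hq.sub_smul]
  have h3 := congrArg₂ (· - ·) h2 h1
  simp only [sub_zero, ← Finset.sum_sub_distrib] at h3
  rw [← h3]
  exact Finset.sum_congr rfl fun d _ => by ring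

/-- The stress tensor spread along the edges is divergence-free: its Fourier coefficient applied to
`ℓ` telescopes on each edge to the difference of the wave at the endpoints. -/
theorem sum_darts_integral_wave (ℓ : Plane →L[ℝ] ℝ) (hℓ : ∀ γ : Γ, wave ℓ (q.2 γ) = 1)
    (i : Fin 2) :
    ∑ d ∈ hG.darts, ((σ d.1 d.2 : ℂ) *
      ∫ t in Set.Icc (0 : ℝ) 1, wave ℓ (q.1 d.1 + t • dartVec q.1 d)) *
      (ℓ (dartVec q.1 d) : ℝ) * (dartVec q.1 d i : ℝ) = 0 := by
  have h := sum_darts_difference hG hq hσ (fun v => wave ℓ (q.1 v))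
    (fun γ v => by simp only [hq.equivariant, wave_add, hℓ, mul_one]) i
  rw [← mul_zero (2 * Real.pi * Complex.I : ℂ)⁻¹, ← h, Finset.mul_sum]
  refine Finset.sum_congr rfl fun d _ => ?_
  rw [mul_assoc (σ d.1 d.2 : ℂ), integral_wave_mul]
  have : q.1 d.1 + dartVec q.1 d = q.1 d.2 := by simp [dartVec]
  rw [this]; ring

omit hσ in
/-- The difference of points on two edges, as a map from the unit square to the torus. -/
theorem continuous_difference (d e : V × V) : Continuous fun t : ℝ × ℝ =>
    toTorus hG hq (q.1 d.1 + t.1 • dartVec q.1 d - (q.1 e.1 + t.2 • dartVec q.1 e)) :=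
  (continuous_toTorus hG hq).comp (by fun_prop)

omit hσ in
theorem continuous_cell : Continuous fun t : ℝ × ℝ =>
    toTorus hG hq (t.1 • q.2 (hG.basis 0) + t.2 • q.2 (hG.basis 1)) :=
  (continuous_toTorus hG hq).comp (by fun_prop)

/-- The correlation of the stress with itself is constant on the torus. -/
theorem stress_correlation (F : C(UnitAddTorus (Fin 2), ℂ)) :
    ∑ d ∈ hG.darts, ∑ e ∈ hG.darts, ((σ d.1 d.2 * σ e.1 e.2 *
      cross (dartVec q.1 d) (dartVec q.1 e) ^ 2 : ℝ) : ℂ) *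
      squareFunctional _ (continuous_difference hG hq d e) F =
    ((∑ d ∈ hG.darts, ∑ e ∈ hG.darts, σ d.1 d.2 * σ e.1 e.2 *
      cross (dartVec q.1 d) (dartVec q.1 e) ^ 2 : ℝ) : ℂ) *
      squareFunctional _ (continuous_cell hG hq) F := by
  set B1 : C(UnitAddTorus (Fin 2), ℂ) →L[ℂ] ℂ := ∑ d ∈ hG.darts, ∑ e ∈ hG.darts,
    ((σ d.1 d.2 * σ e.1 e.2 * cross (dartVec q.1 d) (dartVec q.1 e) ^ 2 : ℝ) : ℂ) •
      squareFunctional _ (continuous_difference hG hq d e) with hB1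
  set B2 : C(UnitAddTorus (Fin 2), ℂ) →L[ℂ] ℂ :=
    ((∑ d ∈ hG.darts, ∑ e ∈ hG.darts, σ d.1 d.2 * σ e.1 e.2 *
      cross (dartVec q.1 d) (dartVec q.1 e) ^ 2 : ℝ) : ℂ) •
      squareFunctional _ (continuous_cell hG hq) with hB2
  -- Trigonometric polynomials are dense, so Fourier coefficients suffice: for `n = 0` both sides
  -- are the total weight, for `n ≠ 0` both vanish.
  have key : B1 = B2 := by
    refine ContinuousLinearMap.ext_on (s := Set.range UnitAddTorus.mFourier)
      (Submodule.dense_iff_topologicalClosure_eq_top.2 UnitAddTorus.span_mFourier_closure_eq_top) ?_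
    rintro _ ⟨n, rfl⟩
    simp only [hB1, hB2, sum_apply, smul_apply,
      squareFunctional_apply, mFourier_toTorus, smul_eq_mul]
    by_cases hn : n = 0
    · have hw : ∀ x, wave (frequency hG hq n) x = 1 := fun x =>
        wave_eq_one _ _ 0 (by rw [frequency_apply, hn]; simp)
      simp only [hw]
      rw [setIntegral_const, measureReal_def, volume_unitSquare]
      push_cast
      simp
    · have hℓ : frequency hG hq n ≠ 0 := by
        intro h
        apply hn
        ext j
        have := frequency_basis hG hq n j
        rw [h] at this
        have h' : (0 : ℝ) = n j := this
        rw [Pi.zero_apply]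
        exact_mod_cast h'.symm
      set ℓ := frequency hG hq n with hℓdef
      have h1 : ∀ d e : V × V, ∫ t in unitSquare,
          wave ℓ (q.1 d.1 + t.1 • dartVec q.1 d - (q.1 e.1 + t.2 • dartVec q.1 e)) =
          (∫ t in Set.Icc (0 : ℝ) 1, wave ℓ (q.1 d.1 + t • dartVec q.1 d)) *
          ∫ t in Set.Icc (0 : ℝ) 1, wave (-ℓ) (q.1 e.1 + t • dartVec q.1 e) := by
        intro d e
        rw [unitSquare, Measure.volume_eq_prod, ← setIntegral_prod_mul]
        simp_rw [sub_eq_add_neg, wave_add ℓ (q.1 d.1 + _), wave_neg]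
      have h2 : ∫ t in unitSquare,
          wave ℓ (t.1 • q.2 (hG.basis 0) + t.2 • q.2 (hG.basis 1)) =
          (∫ t in Set.Icc (0 : ℝ) 1, wave ℓ (0 + t • q.2 (hG.basis 0))) *
          ∫ t in Set.Icc (0 : ℝ) 1, wave ℓ (0 + t • q.2 (hG.basis 1)) := by
        rw [unitSquare, Measure.volume_eq_prod, ← setIntegral_prod_mul]
        simp_rw [wave_add, wave_eq_one ℓ 0 0 (by simp), one_mul]
      -- Along the generator the wave makes `n j` full turns, so its mean is zero.
      have h3 : ∀ j, n j ≠ 0 →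
          ∫ t in Set.Icc (0 : ℝ) 1, wave ℓ (0 + t • q.2 (hG.basis j)) = 0 := by
        intro j hj
        have := integral_wave_mul ℓ 0 (q.2 (hG.basis j))
        rw [zero_add, wave_period, wave_eq_one ℓ 0 0 (by simp), sub_self, mul_zero] at this
        refine (mul_eq_zero.1 this).resolve_right ?_
        rw [hℓdef, frequency_basis]
        exact_mod_cast hj
      have h4 : ∫ t in unitSquare,
          wave ℓ (t.1 • q.2 (hG.basis 0) + t.2 • q.2 (hG.basis 1)) = 0 := by
        rw [h2]
        by_cases h0 : n 0 = 0
        · have h1 : n 1 ≠ 0 := fun h1 => hn (by ext j; fin_cases j <;> assumption)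
          rw [h3 1 h1, mul_zero]
        · rw [h3 0 h0, zero_mul]
      rw [h4, mul_zero]
      simp_rw [h1]
      -- The point on the second edge is subtracted, so that edge contributes its coefficient at the
      -- frequency `-ℓ`.
      have hneg : ∀ γ : Γ, wave (-ℓ) (q.2 γ) = 1 := fun γ => by
        rw [← wave_neg]
        have h := wave_add ℓ (q.2 γ) (-q.2 γ)
        rw [add_neg_cancel, wave_period, wave_eq_one ℓ 0 0 (by simp), one_mul] at h
        exact h.symm
      -- The relation at `-ℓ`, with the sign moved out so that both tensors annihilate the same
      -- functional `ℓ`.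
      have hb : ∀ i, ∑ d ∈ hG.darts, ((σ d.1 d.2 : ℂ) *
          ∫ t in Set.Icc (0 : ℝ) 1, wave (-ℓ) (q.1 d.1 + t • dartVec q.1 d)) *
          (ℓ (dartVec q.1 d) : ℝ) * (dartVec q.1 d i : ℝ) = 0 := by
        intro i
        have := sum_darts_integral_wave hG hq hσ (-ℓ) hneg i
        have h := congrArg Neg.neg this
        rw [neg_zero, ← Finset.sum_neg_distrib] at h
        refine Eq.trans (Finset.sum_congr rfl fun d _ => ?_) h
        have e : (((-ℓ) (dartVec q.1 d) : ℝ) : ℂ) = -(ℓ (dartVec q.1 d) : ℝ) := by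
          simp
        rw [e]; ring
      have h5 := sum_cross_sq_eq_zero hG.darts (dartVec q.1) _ _ ℓ hℓ
        (sum_darts_integral_wave hG hq hσ ℓ (wave_period hG hq n)) hb
      rw [← h5]
      refine Finset.sum_congr rfl fun d _ => Finset.sum_congr rfl fun e _ => ?_
      push_cast; ring
  have := DFunLike.congr_fun key F
  simp only [hB1, hB2, sum_apply, smul_apply, smul_eq_mul] at this
  exact this

/-- By `stress_correlation` the sum is the constant of `h0` times the integral of a nonnegative
function over a period cell. -/
theorem stress_correlation_nonneg (h0 : 0 ≤ ∑ d ∈ hG.darts, ∑ e ∈ hG.darts, σ d.1 d.2 * σ e.1 e.2 *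
      cross (dartVec q.1 d) (dartVec q.1 e) ^ 2) (f : C(UnitAddTorus (Fin 2), ℝ))
    (hf : ∀ x, 0 ≤ f x) :
    0 ≤ ∑ d ∈ hG.darts, ∑ e ∈ hG.darts, σ d.1 d.2 * σ e.1 e.2 *
      cross (dartVec q.1 d) (dartVec q.1 e) ^ 2 * ∫ t in unitSquare,
        f (toTorus hG hq (q.1 d.1 + t.1 • dartVec q.1 d - (q.1 e.1 + t.2 • dartVec q.1 e))) := by
  have h := stress_correlation hG hq hσ ⟨fun x => (f x : ℂ), by fun_prop⟩
  simp only [squareFunctional_apply, ContinuousMap.coe_mk] at h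
  have e1 : ∀ g : ℝ × ℝ → ℝ, ∫ t in unitSquare, (g t : ℂ) = ((∫ t in unitSquare, g t : ℝ) : ℂ) :=
    fun g => integral_ofReal
  simp_rw [e1] at h
  simp_rw [← Complex.ofReal_mul, ← Complex.ofReal_sum] at h
  rw [Complex.ofReal_inj] at h
  rw [h]
  exact mul_nonneg h0 (setIntegral_nonneg measurableSet_unitSquare fun t _ => hf _)

end Stress

end PeriodicFramework
end

open scoped ContDiff
noncomputable section

namespace PeriodicFramework

/-! ### Unfolding the torus correlation into pairs of edges in the plane. -/

section Unfolding

open MeasureTheory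

variable {V : Type*} {G : SimpleGraph V} {Γ : Subgroup (G ≃g G)} {q : Configuration G Γ}

/-- A sum over all oriented edges, in terms of the representatives. -/
theorem finsum_eq_sum_darts {A : Type*} [AddCommMonoid A] (hG : IsPeriodicGraph G Γ)
    (H : V × V → A) (hfin : (Function.support H).Finite)
    (hadj : ∀ e, ¬ G.Adj e.1 e.2 → H e = 0) :
    ∑ᶠ e, H e = ∑ e ∈ hG.darts, ∑ᶠ γ : Γ, H (γ • e.1, γ • e.2) := by
  let Φ : hG.darts × Γ → V × V := fun a => (a.2 • a.1.1.1, a.2 • a.1.1.2)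
  have hΦ : Function.Injective Φ := by
    rintro ⟨⟨⟨u, v⟩, hd⟩, γ⟩ ⟨⟨⟨u', v'⟩, hd'⟩, γ'⟩ h
    obtain ⟨h1, h2⟩ := Prod.mk.inj h
    obtain ⟨o, rfl⟩ := (hG.mem_darts.1 hd).1
    obtain ⟨o', ho'⟩ := (hG.mem_darts.1 hd').1
    simp only at h1 h2 ho'
    subst ho'
    have ho : o = o' := by
      rw [← hG.mk_rep o, ← hG.mk_rep o', ← mk_smul γ (hG.rep o), h1, mk_smul]
    subst ho
    obtain rfl := hG.free_vertices.eq_of_smul_eq h1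
    obtain rfl := smul_left_cancel _ h2
    rfl
  have hrange : ∀ e ∈ Function.support H, e ∈ Set.univ ↔ e ∈ Set.range Φ := by
    intro e he
    simp only [Set.mem_univ, true_iff]
    have : G.Adj e.1 e.2 := by by_contra h; exact he (hadj e h)
    obtain ⟨γ, d, hd, h1, h2⟩ := hG.exists_smul_dart this
    exact ⟨(⟨d, hd⟩, γ), Prod.ext h1 h2⟩
  rw [← finsum_mem_univ, finsum_mem_inter_support_eq' H _ _ hrange, finsum_mem_range hΦ,
    finsum_curry (fun a => H (Φ a)) (hfin.preimage hΦ.injOn), finsum_eq_sum_of_fintype]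
  exact Finset.sum_coe_sort hG.darts fun e => ∑ᶠ γ : Γ, H (γ • e.1, γ • e.2)

open Classical in
theorem finsum_fst_eq {A : Type*} [AddCommMonoid A] (hG : IsPeriodicGraph G Γ)
    (H : V × V → A) (hadj : ∀ e, ¬ G.Adj e.1 e.2 → H e = 0) (u : V) :
    ∑ᶠ e, (if e.1 = u then H e else 0) = ∑ b ∈ hG.nbr u, H (u, b) := by
  rw [finsum_eq_sum_of_support_subset (s := (hG.nbr u).image fun b => (u, b)), Finset.sum_image]
  · simp
  · intro a _ b _ h; exact (Prod.mk.inj h).2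
  · rintro ⟨a, b⟩ h
    by_cases ha : a = u
    · subst ha
      simp only [Function.mem_support, if_true] at h
      have hab : G.Adj a b := by by_contra hab; exact h (hadj (a, b) hab)
      exact Finset.mem_coe.2 (Finset.mem_image.2 ⟨b, hG.mem_nbr.2 hab, rfl⟩)
    · exact absurd (if_neg ha) h

open Classical in
theorem finsum_snd_eq {A : Type*} [AddCommMonoid A] (hG : IsPeriodicGraph G Γ)
    (H : V × V → A) (hadj : ∀ e, ¬ G.Adj e.1 e.2 → H e = 0) (u : V) :
    ∑ᶠ e, (if e.2 = u then H e else 0) = ∑ b ∈ hG.nbr u, H (b, u) := by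
  rw [← finsum_comp_equiv (Equiv.prodComm V V)]
  exact finsum_fst_eq hG (fun e => H e.swap) (fun e h => hadj _ fun h' => h h'.symm) u

/-- A function of pairs of edges that vanishes unless the two edges have exactly one common vertex,
summed over all pairs modulo translations. -/
theorem sum_pairs_eq_sum_vertices (hG : IsPeriodicGraph G Γ) (K : V × V → V × V → ℝ)
    (hK1 : ∀ d e, K d.swap e = K d e) (hK2 : ∀ d e, K d e.swap = K d e)
    (hadj : ∀ d e, ¬ G.Adj e.1 e.2 → K d e = 0)
    (hfin : ∀ d ∈ hG.darts, (Function.support (K d)).Finite)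
    (hinv : ∀ (γ : Γ) (d e : V × V), K (γ • d.1, γ • d.2) (γ • e.1, γ • e.2) = K d e)
    (hshare : ∀ d ∈ hG.darts, ∀ e, K d e ≠ 0 → s(d.1, d.2) ≠ s(e.1, e.2) ∧
      (d.1 = e.1 ∨ d.1 = e.2 ∨ d.2 = e.1 ∨ d.2 = e.2)) :
    ∑ d ∈ hG.darts, ∑ e ∈ hG.darts, ∑ᶠ γ : Γ, K d (γ • e.1, γ • e.2) =
      4 * ∑ d ∈ hG.darts, ∑ b ∈ hG.nbr d.1, K d (d.1, b) := by
  classical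
  have h1 : ∀ d ∈ hG.darts, ∑ e ∈ hG.darts, ∑ᶠ γ : Γ, K d (γ • e.1, γ • e.2) =
      2 * ∑ b ∈ hG.nbr d.1, K d (d.1, b) + 2 * ∑ b ∈ hG.nbr d.2, K d (d.2, b) := by
    intro d hd
    have hdd := (hG.mem_darts.1 hd).2
    rw [← finsum_eq_sum_darts hG (K d) (hfin d hd) (hadj d)]
    -- If the value is nonzero, exactly one of the four coincidences of endpoints holds: at least
    -- one by `hshare`, while two would give equal edges or a loop.
    have hsplit : ∀ e, K d e = ((if e.1 = d.1 then K d e else 0) + (if e.2 = d.1 then K d e else 0)) +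
        ((if e.1 = d.2 then K d e else 0) + (if e.2 = d.2 then K d e else 0)) := by
      rintro ⟨a, b⟩
      obtain ⟨u, v⟩ := d
      by_cases h0 : K (u, v) (a, b) = 0
      · simp [h0]
      · obtain ⟨hne, hsh⟩ := hshare _ hd _ h0
        have hab : G.Adj a b := by by_contra h; exact h0 (hadj _ _ h)
        simp only at hne hsh hdd ⊢
        have huv := hdd.ne
        have hab' := hab.ne
        have n1 : ¬ (a = u ∧ b = v) := fun h => hne (by rw [h.1, h.2])
        have n2 : ¬ (a = v ∧ b = u) := fun h => hne (by rw [h.1, h.2, Sym2.eq_swap])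
        by_cases c1 : a = u
        · have c2 : b ≠ u := fun h => hab' (c1.trans h.symm)
          have c3 : a ≠ v := fun h => huv (c1.symm.trans h)
          have c4 : b ≠ v := fun h => n1 ⟨c1, h⟩
          rw [if_pos c1, if_neg c2, if_neg c3, if_neg c4]; ring
        · by_cases c2 : b = u
          · have c3 : a ≠ v := fun h => n2 ⟨h, c2⟩
            have c4 : b ≠ v := fun h => huv (c2.symm.trans h)
            rw [if_neg c1, if_pos c2, if_neg c3, if_neg c4]; ring
          · by_cases c3 : a = v
            · have c4 : b ≠ v := fun h => hab' (c3.trans h.symm)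
              rw [if_neg c1, if_neg c2, if_pos c3, if_neg c4]; ring
            · have c4 : b = v := by
                rcases hsh with h | h | h | h
                · exact absurd h.symm c1
                · exact absurd h.symm c2
                · exact absurd h.symm c3
                · exact h.symm
              rw [if_neg c1, if_neg c2, if_neg c3, if_pos c4]; ring
    have hf : ∀ P : V × V → Prop, (Function.support fun e => if P e then K d e else 0).Finite :=
      fun P => (hfin d hd).subset fun e he h => he (by simp only [h, ite_self])
    rw [finsum_congr hsplit, finsum_add_distrib, finsum_add_distrib (hf _) (hf _),
      finsum_add_distrib (hf _) (hf _), finsum_fst_eq hG _ (hadj d), finsum_snd_eq hG _ (hadj d),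
      finsum_fst_eq hG _ (hadj d), finsum_snd_eq hG _ (hadj d)]
    · have e1 : ∀ u b, K d (b, u) = K d (u, b) := fun u b => hK2 d (u, b)
      simp_rw [e1]; ring
    · exact ((hf _).union (hf _)).subset (Function.support_add _ _)
    · exact ((hf _).union (hf _)).subset (Function.support_add _ _)
  -- The factor 4: the common vertex may be either end of `e`, and reversal of darts makes the
  -- contribution of the end of `d` equal to that of its start.
  rw [Finset.sum_congr rfl h1, Finset.sum_add_distrib, ← Finset.mul_sum, ← Finset.mul_sum,
    hG.sum_darts_swap (fun d => ∑ b ∈ hG.nbr d.2, K d (d.2, b))]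
  · simp only [Prod.snd_swap, hK1]; ring
  · intro γ u v
    symm
    refine Finset.sum_bij (fun b _ => γ • b) (fun b hb => (hG.smul_mem_nbr γ).2 hb)
      (fun a _ b _ h => smul_left_cancel γ h) (fun b hb => ⟨γ⁻¹ • b, ?_, smul_inv_smul γ b⟩)
      (fun b _ => (hinv γ (u, v) (v, b)).symm)
    rw [← hG.smul_mem_nbr γ, smul_inv_smul]
    exact hb

/-- A tent function on the torus. -/
def torusBump (ε : ℝ) : C(UnitAddTorus (Fin 2), ℝ) :=
  ⟨fun x => max 0 (ε - ‖x‖), by fun_prop⟩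

/-- The corresponding tent function around a lattice point. -/
def planeBump (hG : IsPeriodicGraph G Γ) (hq : IsPeriodicPlacement G Γ q) (ε : ℝ) (x : Plane) : ℝ :=
  max 0 (ε - ‖latticeCoord hG hq x‖)

theorem continuous_planeBump (hG : IsPeriodicGraph G Γ) (hq : IsPeriodicPlacement G Γ q) (ε : ℝ) :
    Continuous (planeBump hG hq ε) := by
  have := (latticeCoord hG hq).continuous
  unfold planeBump; fun_prop

theorem norm_lt_of_planeBump_ne_zero (hG : IsPeriodicGraph G Γ) (hq : IsPeriodicPlacement G Γ q)
    {ε : ℝ} {x : Plane} (h : planeBump hG hq ε x ≠ 0) : ‖latticeCoord hG hq x‖ < ε := by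
  by_contra hc
  exact h (max_eq_left (by linarith))

/-- In lattice coordinates the tent has sup-radius at most 1/2, so only the translate to the nearest
lattice point can be nonzero at `x`; where the nearest point is ambiguous, all terms are zero. -/
theorem torusBump_toTorus (hG : IsPeriodicGraph G Γ) (hq : IsPeriodicPlacement G Γ q) {ε : ℝ}
    (hε : ε ≤ 1 / 2) (x : Plane) :
    torusBump ε (toTorus hG hq x) = ∑ᶠ γ : Γ, planeBump hG hq ε (x - q.2 γ) := by
  set y := latticeCoord hG hq x with hy
  rw [finsum_eq_single _ (hG.ofDeg fun j => round (y j))]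
  · have h : ‖toTorus hG hq x‖ = ‖y - fun j => ((round (y j) : ℤ) : ℝ)‖ := by
      apply le_antisymm
      · refine (pi_norm_le_iff_of_nonneg (norm_nonneg _)).2 fun j => ?_
        change ‖((y j : ℝ) : UnitAddCircle)‖ ≤ _
        rw [UnitAddCircle.norm_eq]
        exact norm_le_pi_norm (y - fun j => ((round (y j) : ℤ) : ℝ)) j
      · refine (pi_norm_le_iff_of_nonneg (norm_nonneg _)).2 fun j => ?_
        refine le_trans (le_of_eq ?_) (norm_le_pi_norm (toTorus hG hq x) j)
        change _ = ‖((y j : ℝ) : UnitAddCircle)‖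
        rw [UnitAddCircle.norm_eq]; rfl
    simp only [torusBump, planeBump, ContinuousMap.coe_mk, map_sub, latticeCoord_period,
      hG.deg_ofDeg, h, ← hy]
  · intro γ hγ
    by_contra h
    have h1 := norm_lt_of_planeBump_ne_zero hG hq h
    apply hγ
    apply hG.deg_injective
    rw [hG.deg_ofDeg]
    ext j
    have h2 := (norm_le_pi_norm _ j).trans_lt h1
    rw [map_sub, latticeCoord_period, ← hy, Pi.sub_apply, Real.norm_eq_abs] at h2
    symm
    rw [round_eq, Int.floor_eq_iff]
    rw [abs_lt] at h2
    constructor <;> linarith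

theorem setIntegral_unitSquare {f : ℝ × ℝ → ℝ} (hf : Continuous f) :
    ∫ t in unitSquare, f t = ∫ x in (0 : ℝ)..1, ∫ y in (0 : ℝ)..1, f (x, y) := by
  rw [unitSquare, Measure.volume_eq_prod, setIntegral_prod,
    intervalIntegral.integral_of_le zero_le_one, integral_Icc_eq_integral_Ioc]
  · congr 1
    ext x
    rw [intervalIntegral.integral_of_le zero_le_one, integral_Icc_eq_integral_Ioc]
  · exact hf.continuousOn.integrableOn_compact (isCompact_Icc.prod isCompact_Icc)

/-- The correlation of two edges at scale `ε`. -/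
def edgeCorrelation (hG : IsPeriodicGraph G Γ) (hq : IsPeriodicPlacement G Γ q) (ε : ℝ)
    (d e : V × V) : ℝ :=
  ∫ t in unitSquare, planeBump hG hq ε
    (q.1 d.1 + t.1 • dartVec q.1 d - (q.1 e.1 + t.2 • dartVec q.1 e))

theorem continuous_correlation (hG : IsPeriodicGraph G Γ) (hq : IsPeriodicPlacement G Γ q) (ε : ℝ)
    (d e : V × V) : Continuous fun t : ℝ × ℝ => planeBump hG hq ε
    (q.1 d.1 + t.1 • dartVec q.1 d - (q.1 e.1 + t.2 • dartVec q.1 e)) :=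
  (continuous_planeBump hG hq ε).comp (by fun_prop)

theorem edgeCorrelation_swap_left (hG : IsPeriodicGraph G Γ) (hq : IsPeriodicPlacement G Γ q)
    (ε : ℝ) (d e : V × V) :
    edgeCorrelation hG hq ε d.swap e = edgeCorrelation hG hq ε d e := by
  rw [edgeCorrelation, edgeCorrelation, setIntegral_unitSquare (continuous_correlation hG hq ε _ _),
    setIntegral_unitSquare (continuous_correlation hG hq ε _ _)]
  have := intervalIntegral.integral_comp_sub_left (a := 0) (b := 1) (fun x : ℝ =>
    ∫ y in (0 : ℝ)..1, planeBump hG hq ε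
      (q.1 d.1 + x • dartVec q.1 d - (q.1 e.1 + y • dartVec q.1 e))) 1
  rw [sub_self, sub_zero] at this
  rw [← this]
  refine intervalIntegral.integral_congr fun x _ => intervalIntegral.integral_congr fun y _ => ?_
  simp only [dartVec, Prod.fst_swap, Prod.snd_swap]
  congr 1; module

theorem edgeCorrelation_swap_right (hG : IsPeriodicGraph G Γ) (hq : IsPeriodicPlacement G Γ q)
    (ε : ℝ) (d e : V × V) :
    edgeCorrelation hG hq ε d e.swap = edgeCorrelation hG hq ε d e := by
  rw [edgeCorrelation, edgeCorrelation, setIntegral_unitSquare (continuous_correlation hG hq ε _ _),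
    setIntegral_unitSquare (continuous_correlation hG hq ε _ _)]
  refine intervalIntegral.integral_congr fun x _ => ?_
  have := intervalIntegral.integral_comp_sub_left (a := 0) (b := 1) (fun y : ℝ =>
    planeBump hG hq ε (q.1 d.1 + x • dartVec q.1 d - (q.1 e.1 + y • dartVec q.1 e))) 1
  rw [sub_self, sub_zero] at this
  simp only
  rw [← this]
  refine intervalIntegral.integral_congr fun y _ => ?_
  simp only [dartVec, Prod.fst_swap, Prod.snd_swap]
  congr 1; module

theorem edgeCorrelation_smul (hG : IsPeriodicGraph G Γ) (hq : IsPeriodicPlacement G Γ q)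
    (ε : ℝ) (γ : Γ) (d e : V × V) :
    edgeCorrelation hG hq ε (γ • d.1, γ • d.2) (γ • e.1, γ • e.2) = edgeCorrelation hG hq ε d e := by
  simp only [edgeCorrelation, dartVec, hq.sub_smul]
  congr 1
  ext t
  rw [hq.equivariant, hq.equivariant]
  congr 1; abel

theorem add_smul_dartVec_mem (p : V → Plane) (d : V × V) {t : ℝ} (ht : t ∈ Set.Icc (0 : ℝ) 1) :
    p d.1 + t • dartVec p d ∈ segment ℝ (p d.1) (p d.2) := by
  rw [segment_eq_image']; exact ⟨t, ht, rfl⟩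

theorem exists_of_edgeCorrelation_ne_zero (hG : IsPeriodicGraph G Γ)
    (hq : IsPeriodicPlacement G Γ q) {ε : ℝ} {d e : V × V}
    (h : edgeCorrelation hG hq ε d e ≠ 0) :
    ∃ x ∈ segment ℝ (q.1 d.1) (q.1 d.2), ∃ y ∈ segment ℝ (q.1 e.1) (q.1 e.2),
      ‖latticeCoord hG hq (x - y)‖ < ε := by
  by_contra hc
  push Not at hc
  apply h
  rw [edgeCorrelation]
  refine setIntegral_eq_zero_of_forall_eq_zero fun t ht => ?_
  by_contra h2
  exact absurd (norm_lt_of_planeBump_ne_zero hG hq h2)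
    (not_lt.2 (hc _ (add_smul_dartVec_mem q.1 d ht.1) _ (add_smul_dartVec_mem q.1 e ht.2)))

theorem exists_norm_le_latticeCoord (hG : IsPeriodicGraph G Γ) (hq : IsPeriodicPlacement G Γ q) :
    ∃ C > 0, ∀ x, ‖x‖ ≤ C * ‖latticeCoord hG hq x‖ := by
  refine ⟨‖((latticeCoord hG hq).symm : (Fin 2 → ℝ) →L[ℝ] Plane)‖ + 1, by positivity, fun x => ?_⟩
  have := ((latticeCoord hG hq).symm : (Fin 2 → ℝ) →L[ℝ] Plane).le_opNorm (latticeCoord hG hq x)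
  rw [ContinuousLinearEquiv.coe_coe, ContinuousLinearEquiv.symm_apply_apply] at this
  nlinarith [norm_nonneg (latticeCoord hG hq x)]

/-- Given an edge, only finitely many others come near it. -/
theorem finite_near_dart (hG : IsPeriodicGraph G Γ) (hq : IsPeriodicPlacement G Γ q) (d : V × V)
    (ε : ℝ) : {e : V × V | G.Adj e.1 e.2 ∧ ∃ x ∈ segment ℝ (q.1 d.1) (q.1 d.2),
      ∃ y ∈ segment ℝ (q.1 e.1) (q.1 e.2), ‖latticeCoord hG hq (x - y)‖ < ε}.Finite := by
  obtain ⟨C, hC, hC'⟩ := exists_norm_le_latticeCoord hG hq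
  obtain ⟨R, hR⟩ := (isCompact_segment' (q.1 d.1) (q.1 d.2)).isBounded.exists_norm_le
  refine (finite_edges_meeting_ball hG hq (R + C * ε)).subset ?_
  rintro e ⟨he, x, hx, y, hy, hxy⟩
  refine ⟨he, y, hy, ?_⟩
  rw [Metric.mem_closedBall, dist_zero_right]
  have h1 := (hC' (x - y)).trans (mul_le_mul_of_nonneg_left hxy.le hC.le)
  have h2 := hR x hx
  have h3 : ‖y‖ ≤ ‖x‖ + ‖x - y‖ := by
    have := norm_sub_le x (x - y)
    rwa [sub_sub_cancel] at this
  linarith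

/-- The bump on the torus is the periodization of the bump in the plane, and subtracting a period
amounts to translating the second edge. Only finitely many translates come within `ε` of the first
edge, so sum and integral commute. -/
theorem torus_integral_eq_finsum (hG : IsPeriodicGraph G Γ) (hq : IsPeriodicPlacement G Γ q) {ε : ℝ}
    (hε : ε ≤ 1 / 2) (d e : V × V) (he : G.Adj e.1 e.2) :
    ∫ t in unitSquare, torusBump ε (toTorus hG hq
      (q.1 d.1 + t.1 • dartVec q.1 d - (q.1 e.1 + t.2 • dartVec q.1 e))) =
    ∑ᶠ γ : Γ, edgeCorrelation hG hq ε d (γ • e.1, γ • e.2) := by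
  have hfin : {γ : Γ | ∃ x ∈ segment ℝ (q.1 d.1) (q.1 d.2),
      ∃ y ∈ segment ℝ (q.1 (γ • e.1)) (q.1 (γ • e.2)),
      ‖latticeCoord hG hq (x - y)‖ < ε}.Finite := by
    refine ((finite_near_dart hG hq d ε).preimage (f := fun γ : Γ => (γ • e.1, γ • e.2)) ?_).subset ?_
    · intro γ _ γ' _ h
      exact hG.free_vertices.eq_of_smul_eq (Prod.mk.inj h).1
    · intro γ hγ
      exact ⟨(adj_smul_iff γ).2 he, hγ⟩
  have hpt : ∀ (γ : Γ) (t : ℝ × ℝ), q.1 d.1 + t.1 • dartVec q.1 d -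
      (q.1 e.1 + t.2 • dartVec q.1 e) - q.2 γ = q.1 d.1 + t.1 • dartVec q.1 d -
      (q.1 (γ • e.1) + t.2 • dartVec q.1 (γ • e.1, γ • e.2)) := by
    intro γ t
    simp only [dartVec, hq.sub_smul]
    rw [hq.equivariant]; abel
  have hpoint : Set.EqOn (fun t : ℝ × ℝ => torusBump ε (toTorus hG hq
      (q.1 d.1 + t.1 • dartVec q.1 d - (q.1 e.1 + t.2 • dartVec q.1 e))))
      (fun t => ∑ γ ∈ hfin.toFinset, planeBump hG hq ε (q.1 d.1 + t.1 • dartVec q.1 d -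
      (q.1 (γ • e.1) + t.2 • dartVec q.1 (γ • e.1, γ • e.2)))) unitSquare := by
    intro t ht
    change torusBump ε (toTorus hG hq _) = _
    rw [torusBump_toTorus hG hq hε, finsum_eq_sum_of_support_subset (s := hfin.toFinset)]
    · exact Finset.sum_congr rfl fun γ _ => by rw [hpt]
    · intro γ hγ
      rw [Function.mem_support, hpt] at hγ
      have := norm_lt_of_planeBump_ne_zero hG hq hγ
      rw [Set.Finite.coe_toFinset]
      exact ⟨_, add_smul_dartVec_mem q.1 d ht.1, _,
        add_smul_dartVec_mem q.1 (γ • e.1, γ • e.2) ht.2, this⟩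
  rw [setIntegral_congr_fun measurableSet_unitSquare hpoint, integral_finsetSum,
    finsum_eq_sum_of_support_subset (s := hfin.toFinset)]
  · rfl
  · intro γ hγ
    rw [Set.Finite.coe_toFinset]
    exact exists_of_edgeCorrelation_ne_zero hG hq hγ
  · intro γ _
    exact (continuous_correlation hG hq ε d (γ • e.1, γ • e.2)).continuousOn.integrableOn_compact
      isCompact_unitSquare

end Unfolding

end PeriodicFramework
end

open scoped ContDiff
noncomputable section

namespace PeriodicFramework

/-! ### Localization at the vertices and vanishing of stresses. -/

section Core

open MeasureTheory Filter Topology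

theorem abs_cross_le (z w : Plane) : |cross z w| ≤ 2 * ‖z‖ * ‖w‖ := by
  have h : ∀ (x : Plane) i, |x i| ≤ ‖x‖ := fun x i => PiLp.norm_apply_le x i
  calc |cross z w| ≤ |z 0 * w 1| + |z 1 * w 0| := abs_sub _ _
    _ = |z 0| * |w 1| + |z 1| * |w 0| := by rw [abs_mul, abs_mul]
    _ ≤ ‖z‖ * ‖w‖ + ‖z‖ * ‖w‖ := by gcongr <;> apply h
    _ = _ := by ring

theorem eventually_mul_lt (A : ℝ) {c : ℝ} (hc : 0 < c) : ∀ᶠ ε in 𝓝[>] (0 : ℝ), A * ε < c := by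
  have h : Tendsto (fun ε : ℝ => A * ε) (𝓝[>] 0) (𝓝 (A * 0)) :=
    ((continuous_const.mul continuous_id).tendsto 0).mono_left nhdsWithin_le_nhds
  rw [mul_zero] at h
  exact h.eventually_lt_const hc

/-- The standard identification of pairs of real numbers with points of the plane. -/
def toPlane : ℝ × ℝ →L[ℝ] Plane :=
  (ContinuousLinearMap.fst ℝ ℝ ℝ).smulRight (EuclideanSpace.single 0 1) +
    (ContinuousLinearMap.snd ℝ ℝ ℝ).smulRight (EuclideanSpace.single 1 1)

theorem toPlane_zero (z : ℝ × ℝ) : toPlane z 0 = z.1 := by simp [toPlane]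

theorem toPlane_one (z : ℝ × ℝ) : toPlane z 1 = z.2 := by simp [toPlane]

theorem ae_cross_toPlane_ne_zero {w : Plane} (hw : w ≠ 0) :
    ∀ᵐ z : ℝ × ℝ, cross (toPlane z) w ≠ 0 := by
  let f : ℝ × ℝ →ₗ[ℝ] ℝ := (w 1) • LinearMap.fst ℝ ℝ ℝ - (w 0) • LinearMap.snd ℝ ℝ ℝ
  have hf : ∀ z, f z = cross (toPlane z) w := fun z => by
    simp only [f, cross, toPlane_zero, toPlane_one, LinearMap.sub_apply, LinearMap.smul_apply,
      LinearMap.fst_apply, LinearMap.snd_apply, smul_eq_mul]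
    ring
  have hne : LinearMap.ker f ≠ ⊤ := by
    intro h
    rw [LinearMap.ker_eq_top] at h
    apply hw
    have h1 := hf (1, 0)
    have h2 := hf (0, 1)
    rw [h] at h1 h2
    simp only [LinearMap.zero_apply, cross, toPlane_zero, toPlane_one] at h1 h2
    apply plane_ext
    · simp only [PiLp.zero_apply]; linarith
    · simp only [PiLp.zero_apply]; linarith
  have := Measure.addHaar_submodule volume (LinearMap.ker f) hne
  rw [ae_iff]
  convert this using 2
  ext z
  simp [← hf]

/-- The linear map `(s, t) ↦ s w - t w'`. -/
def differenceMap (w w' : Plane) : ℝ × ℝ →L[ℝ] ℝ × ℝ :=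
  LinearMap.toContinuousLinearMap
    (Matrix.toLin (Module.Basis.finTwoProd ℝ) (Module.Basis.finTwoProd ℝ)
      !![w 0, -w' 0; w 1, -w' 1])

theorem toPlane_differenceMap (w w' : Plane) (t : ℝ × ℝ) :
    toPlane (differenceMap w w' t) = t.1 • w - t.2 • w' := by
  apply plane_ext
  · rw [toPlane_zero, differenceMap, LinearMap.coe_toContinuousLinearMap', Matrix.toLin_finTwoProd]
    simp; ring
  · rw [toPlane_one, differenceMap, LinearMap.coe_toContinuousLinearMap', Matrix.toLin_finTwoProd]
    simp; ring

theorem det_differenceMap (w w' : Plane) : (differenceMap w w').det = -cross w w' := by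
  rw [ContinuousLinearMap.det, differenceMap, LinearMap.toContinuousLinearMap]
  simp [Matrix.det_fin_two, cross]
  ring

theorem toPlane_injective : Function.Injective toPlane := fun a b h => by
  apply Prod.ext
  · rw [← toPlane_zero, h, toPlane_zero]
  · rw [← toPlane_one, h, toPlane_one]

theorem cross_smul_eq (z w w' : Plane) :
    cross w w' • z = cross z w' • w - cross z w • w' := by
  apply plane_ext <;> simp only [PiLp.smul_apply, PiLp.sub_apply, smul_eq_mul, cross] <;> ring

variable {V : Type*} {G : SimpleGraph V} {Γ : Subgroup (G ≃g G)} {q : Configuration G Γ}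

open Classical in
/-- The correlation of two edges with a common endpoint measures the cone spanned by them. -/
theorem cross_mul_integral_planeBump (hG : IsPeriodicGraph G Γ) (hq : IsPeriodicPlacement G Γ q)
    {ε : ℝ} {w w' : Plane} (hc : cross w w' ≠ 0)
    (hsmall : ∀ z, ‖latticeCoord hG hq z‖ < ε → |cross z w| < |cross w w'| ∧
      |cross z w'| < |cross w w'|) :
    Integrable (fun z : ℝ × ℝ => planeBump hG hq ε (toPlane z) *
      (if 0 < cross (toPlane z) w * cross w w' ∧ 0 < cross (toPlane z) w' * cross w w'
        then 1 else 0)) ∧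
    |cross w w'| * ∫ t in unitSquare, planeBump hG hq ε (t.1 • w - t.2 • w') =
      ∫ z : ℝ × ℝ, planeBump hG hq ε (toPlane z) *
      (if 0 < cross (toPlane z) w * cross w w' ∧ 0 < cross (toPlane z) w' * cross w w'
        then 1 else 0) := by
  have hw : w ≠ 0 := by rintro rfl; simp [cross] at hc
  have hw' : w' ≠ 0 := by rintro rfl; simp [cross] at hc
  set A := differenceMap w w' with hA
  have hinj : Function.Injective A := by
    intro s t h
    have h1 : s.1 • w - s.2 • w' = t.1 • w - t.2 • w' := by
      rw [← toPlane_differenceMap, ← toPlane_differenceMap, ← hA, h]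
    have h2 : (s.1 - t.1) • w = (s.2 - t.2) • w' := by
      rw [sub_smul, sub_smul, sub_eq_sub_iff_add_eq_add, sub_eq_sub_iff_add_eq_add.1 h1]
      abel
    have e0 := congrArg (fun x : Plane => x 0) h2
    have e1 := congrArg (fun x : Plane => x 1) h2
    simp only [PiLp.smul_apply, smul_eq_mul] at e0 e1
    apply Prod.ext
    · have : (s.1 - t.1) * cross w w' = 0 := by
        simp only [cross]; linear_combination (w' 1) * e0 - (w' 0) * e1
      exact sub_eq_zero.1 ((mul_eq_zero.1 this).resolve_right hc)
    · have : (s.2 - t.2) * cross w w' = 0 := by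
        simp only [cross]; linear_combination (w 1) * e0 - (w 0) * e1
      exact sub_eq_zero.1 ((mul_eq_zero.1 this).resolve_right hc)
  have hcont : Continuous fun z : ℝ × ℝ => planeBump hG hq ε (toPlane z) :=
    (continuous_planeBump hG hq ε).comp toPlane.continuous
  have hcpt : IsCompact (A '' unitSquare) := isCompact_unitSquare.image A.continuous
  have hmeas : MeasurableSet (A '' unitSquare) := hcpt.isClosed.measurableSet
  -- Where the bump is nonzero, `hsmall` bounds both coordinates of `z` with respect to `w` and
  -- `-w'` by one in absolute value, so only their signs decide whether `z` lies in the
  -- parallelogram. The boundary lines of the cone are null sets.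
  have hae : (fun z : ℝ × ℝ => planeBump hG hq ε (toPlane z) *
      (if 0 < cross (toPlane z) w * cross w w' ∧ 0 < cross (toPlane z) w' * cross w w'
        then 1 else 0)) =ᵐ[volume] (A '' unitSquare).indicator
        (fun z => planeBump hG hq ε (toPlane z)) := by
    filter_upwards [ae_cross_toPlane_ne_zero hw, ae_cross_toPlane_ne_zero hw'] with z h1 h2
    by_cases h0 : planeBump hG hq ε (toPlane z) = 0
    · rw [h0, zero_mul]
      by_cases hz : z ∈ A '' unitSquare
      · rw [Set.indicator_of_mem hz, h0]
      · rw [Set.indicator_of_notMem hz]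
    · obtain ⟨h3, h4⟩ := hsmall _ (norm_lt_of_planeBump_ne_zero hG hq h0)
      have hiff : z ∈ A '' unitSquare ↔
          0 < cross (toPlane z) w * cross w w' ∧ 0 < cross (toPlane z) w' * cross w w' := by
        constructor
        · rintro ⟨t, ⟨⟨ht1, _⟩, ⟨ht2, _⟩⟩, rfl⟩
          rw [hA, toPlane_differenceMap] at h1 h2 ⊢
          have e1 : cross (t.1 • w - t.2 • w') w = t.2 * cross w w' := by
            simp only [cross, PiLp.smul_apply, PiLp.sub_apply, smul_eq_mul]; ring
          have e2 : cross (t.1 • w - t.2 • w') w' = t.1 * cross w w' := by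
            simp only [cross, PiLp.smul_apply, PiLp.sub_apply, smul_eq_mul]; ring
          rw [e1] at h1 ⊢
          rw [e2] at h2 ⊢
          have p1 : 0 < t.2 := lt_of_le_of_ne ht2 fun h => h1 (by rw [← h, zero_mul])
          have p2 : 0 < t.1 := lt_of_le_of_ne ht1 fun h => h2 (by rw [← h, zero_mul])
          have p3 := mul_self_pos.2 hc
          exact ⟨by nlinarith, by nlinarith⟩
        · rintro ⟨p1, p2⟩
          have hcc := mul_self_pos.2 hc
          have q : ∀ y, 0 < y * cross w w' → |y| < |cross w w'| → y / cross w w' ∈ Set.Icc (0:ℝ) 1 := by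
            intro y hy hy'
            have e : y / cross w w' = y * cross w w' / (cross w w' * cross w w') := by field_simp
            have hpos : 0 ≤ y / cross w w' := by rw [e]; positivity
            refine ⟨hpos, ?_⟩
            rw [← abs_of_nonneg hpos, abs_div]
            exact ((div_lt_one (abs_pos.2 hc)).2 hy').le
          refine ⟨(cross (toPlane z) w' / cross w w', cross (toPlane z) w / cross w w'),
            ⟨q _ p2 h4, q _ p1 h3⟩, toPlane_injective ?_⟩
          rw [hA, toPlane_differenceMap]
          have := cross_smul_eq (toPlane z) w w'
          have h5 : toPlane z = (cross w w')⁻¹ • (cross w w' • toPlane z) := by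
            rw [smul_smul, inv_mul_cancel₀ hc, one_smul]
          rw [this, smul_sub, smul_smul, smul_smul] at h5
          simp only [div_eq_inv_mul]
          exact h5.symm
      by_cases hz : z ∈ A '' unitSquare
      · rw [Set.indicator_of_mem hz, if_pos (hiff.1 hz), mul_one]
      · rw [Set.indicator_of_notMem hz, if_neg (fun h => hz (hiff.2 h)), mul_zero]
  constructor
  · refine Integrable.congr ?_ hae.symm
    rw [integrable_indicator_iff hmeas]
    exact hcont.continuousOn.integrableOn_compact hcpt
  · rw [integral_congr_ae hae, integral_indicator hmeas,
      integral_image_eq_integral_abs_det_fderiv_smul volume measurableSet_unitSquare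
        (fun x _ => A.hasFDerivAt.hasFDerivWithinAt) hinj.injOn, ← integral_const_mul]
    refine setIntegral_congr_fun measurableSet_unitSquare fun t _ => ?_
    change _ = |A.det| • planeBump hG hq ε (toPlane (A t))
    rw [hA, det_differenceMap, abs_neg, toPlane_differenceMap, smul_eq_mul]

theorem integral_planeBump_pos (hG : IsPeriodicGraph G Γ) (hq : IsPeriodicPlacement G Γ q)
    {ε : ℝ} (hε : 0 < ε) : 0 < ∫ z : ℝ × ℝ, planeBump hG hq ε (toPlane z) := by
  have hcont : Continuous fun z : ℝ × ℝ => planeBump hG hq ε (toPlane z) :=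
    (continuous_planeBump hG hq ε).comp toPlane.continuous
  obtain ⟨C, hC, hC'⟩ := exists_norm_le_latticeCoord hG hq
  refine hcont.integral_pos_of_hasCompactSupport_nonneg_nonzero (x := 0) ?_
    (fun z => le_max_left _ _) ?_
  · refine HasCompactSupport.intro (isCompact_closedBall (0 : ℝ × ℝ) (C * ε)) fun z hz => ?_
    by_contra h
    apply hz
    have h1 := norm_lt_of_planeBump_ne_zero hG hq h
    have h2 := (hC' (toPlane z)).trans (mul_le_mul_of_nonneg_left h1.le hC.le)
    rw [Metric.mem_closedBall, dist_zero_right, Prod.norm_def, max_le_iff]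
    constructor
    · rw [← toPlane_zero]; exact (PiLp.norm_apply_le _ _).trans h2
    · rw [← toPlane_one]; exact (PiLp.norm_apply_le _ _).trans h2
  · simp [planeBump, hε.ne', hε.le]

/-- A scale below which edges only interact near common endpoints. -/
theorem exists_small_scale (hG : IsPeriodicGraph G Γ) (hq : IsPeriodicPlacement G Γ q) :
    ∃ ε > 0, ε ≤ 1 / 2 ∧
      (∀ d ∈ hG.darts, ∀ e : V × V, G.Adj e.1 e.2 → (∃ x ∈ segment ℝ (q.1 d.1) (q.1 d.2),
        ∃ y ∈ segment ℝ (q.1 e.1) (q.1 e.2), ‖latticeCoord hG hq (x - y)‖ < ε) →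
        (segment ℝ (q.1 d.1) (q.1 d.2) ∩ segment ℝ (q.1 e.1) (q.1 e.2)).Nonempty) ∧
      (∀ d ∈ hG.darts, ∀ b ∈ hG.nbr d.1, cross (dartVec q.1 d) (dartVec q.1 (d.1, b)) ≠ 0 →
        ∀ z, ‖latticeCoord hG hq z‖ < ε →
        |cross z (dartVec q.1 d)| < |cross (dartVec q.1 d) (dartVec q.1 (d.1, b))| ∧
        |cross z (dartVec q.1 (d.1, b))| < |cross (dartVec q.1 d) (dartVec q.1 (d.1, b))|) := by
  obtain ⟨C, hC, hC'⟩ := exists_norm_le_latticeCoord hG hq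
  -- The bound 1 only serves to leave finitely many candidates `e`, so that one scale works for all;
  -- each disjoint pair of segments has positive distance.
  have h1 : ∀ᶠ ε in 𝓝[>] (0 : ℝ), ∀ d ∈ hG.darts, ∀ e ∈ {e : V × V | G.Adj e.1 e.2 ∧
      ∃ x ∈ segment ℝ (q.1 d.1) (q.1 d.2),
      ∃ y ∈ segment ℝ (q.1 e.1) (q.1 e.2), ‖latticeCoord hG hq (x - y)‖ < 1},
      (∃ x ∈ segment ℝ (q.1 d.1) (q.1 d.2),
        ∃ y ∈ segment ℝ (q.1 e.1) (q.1 e.2), ‖latticeCoord hG hq (x - y)‖ < ε) →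
        (segment ℝ (q.1 d.1) (q.1 d.2) ∩ segment ℝ (q.1 e.1) (q.1 e.2)).Nonempty := by
    rw [Filter.eventually_all_finset]
    intro d _
    rw [Filter.eventually_all_finite (finite_near_dart hG hq d 1)]
    intro e _
    by_cases hne : (segment ℝ (q.1 d.1) (q.1 d.2) ∩ segment ℝ (q.1 e.1) (q.1 e.2)).Nonempty
    · exact Eventually.of_forall fun _ _ => hne
    · obtain ⟨δ, hδ, hdis⟩ := (Set.disjoint_iff_inter_eq_empty.2
        (Set.not_nonempty_iff_eq_empty.1 hne)).exists_thickenings (isCompact_segment' _ _)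
        (isClosed_segment' _ _)
      filter_upwards [eventually_mul_lt C hδ] with ε hε
      rintro ⟨x, hx, y, hy, hxy⟩
      exfalso
      refine Set.disjoint_left.1 hdis ?_ (Metric.self_subset_thickening hδ _ hy)
      rw [Metric.mem_thickening_iff]
      refine ⟨x, hx, ?_⟩
      rw [dist_comm, dist_eq_norm]
      exact ((hC' _).trans (mul_le_mul_of_nonneg_left hxy.le hC.le)).trans_lt hε
  have h2 : ∀ᶠ ε in 𝓝[>] (0 : ℝ), ∀ d ∈ hG.darts, ∀ b ∈ hG.nbr d.1,
      cross (dartVec q.1 d) (dartVec q.1 (d.1, b)) ≠ 0 →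
        ∀ z, ‖latticeCoord hG hq z‖ < ε →
        |cross z (dartVec q.1 d)| < |cross (dartVec q.1 d) (dartVec q.1 (d.1, b))| ∧
        |cross z (dartVec q.1 (d.1, b))| < |cross (dartVec q.1 d) (dartVec q.1 (d.1, b))| := by
    rw [Filter.eventually_all_finset]
    intro d _
    rw [Filter.eventually_all_finset]
    intro b _
    by_cases hc : cross (dartVec q.1 d) (dartVec q.1 (d.1, b)) = 0
    · exact Eventually.of_forall fun _ h => absurd hc h
    · have aux : ∀ w : Plane, ∀ ε, 2 * C * ‖w‖ * ε <
          |cross (dartVec q.1 d) (dartVec q.1 (d.1, b))| → ∀ z, ‖latticeCoord hG hq z‖ < ε →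
          |cross z w| < |cross (dartVec q.1 d) (dartVec q.1 (d.1, b))| := by
        intro w ε hε z hz
        refine lt_of_le_of_lt ((abs_cross_le z w).trans ?_) hε
        have := (hC' z).trans (mul_le_mul_of_nonneg_left hz.le hC.le)
        nlinarith [norm_nonneg w]
      filter_upwards [eventually_mul_lt (2 * C * ‖dartVec q.1 d‖) (abs_pos.2 hc),
        eventually_mul_lt (2 * C * ‖dartVec q.1 (d.1, b)‖) (abs_pos.2 hc)] with ε e1 e2 _ z hz
      exact ⟨aux _ _ e1 z hz, aux _ _ e2 z hz⟩
  obtain ⟨ε, ⟨⟨⟨h1, h2⟩, h3⟩, h4⟩⟩ := (((h1.and h2).and (eventually_mul_lt 2 one_pos)).and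
    self_mem_nhdsWithin).exists
  refine ⟨ε, h4, by linarith, fun d hd e he h => h1 d hd e ⟨he, ?_⟩ h, h2⟩
  obtain ⟨x, hx, y, hy, hxy⟩ := h
  exact ⟨x, hx, y, hy, hxy.trans (by linarith)⟩

/-- In a pointed non-crossing periodic framework, an equilibrium stress whose stress tensor has
non-negative determinant vanishes. -/
theorem stress_eq_zero (hG : IsPeriodicGraph G Γ) (hq : IsPeriodicPlacement G Γ q)
    (hnc : IsNonCrossing G q.1) (hpt : ∀ u, IsPointedAt G q.1 u) {σ : V → V → ℝ}
    (hσ : IsStressWeight hG q.1 σ)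
    (h0 : 0 ≤ ∑ d ∈ hG.darts, ∑ e ∈ hG.darts, σ d.1 d.2 * σ e.1 e.2 *
      cross (dartVec q.1 d) (dartVec q.1 e) ^ 2) (u v : V) : σ u v = 0 := by
  classical
  have := hG.finite_vertices
  have := Fintype.ofFinite (VertexOrbit G Γ)
  obtain ⟨ε, hε, hε2, hsep, hsmall⟩ := exists_small_scale hG hq
  set K : V × V → V × V → ℝ := fun d e => σ d.1 d.2 * σ e.1 e.2 *
    cross (dartVec q.1 d) (dartVec q.1 e) ^ 2 * edgeCorrelation hG hq ε d e with hK
  have hswap : ∀ d : V × V, dartVec q.1 d.swap = -dartVec q.1 d := fun d => by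
    simp [dartVec]
  have hKne : ∀ d e, K d e ≠ 0 → G.Adj d.1 d.2 ∧ G.Adj e.1 e.2 ∧
      cross (dartVec q.1 d) (dartVec q.1 e) ≠ 0 ∧ edgeCorrelation hG hq ε d e ≠ 0 := by
    intro d e h
    refine ⟨?_, ?_, ?_, ?_⟩
    · by_contra h'; exact h (by simp only [hK, hσ.support _ _ h', zero_mul])
    · by_contra h'; exact h (by simp only [hK, hσ.support _ _ h', mul_zero, zero_mul])
    · intro h'; exact h (by simp only [hK, h']; ring)
    · intro h'; exact h (by simp only [hK, h', mul_zero])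
  have hpairs := sum_pairs_eq_sum_vertices hG K
    (fun d e => by
      simp only [hK, hswap, edgeCorrelation_swap_left, Prod.fst_swap, Prod.snd_swap,
        hσ.symm d.2 d.1, cross, PiLp.neg_apply]
      ring)
    (fun d e => by
      simp only [hK, hswap, edgeCorrelation_swap_right, Prod.fst_swap, Prod.snd_swap,
        hσ.symm e.2 e.1, cross, PiLp.neg_apply]
      ring)
    (fun d e h => by by_contra h'; exact h (hKne d e h').2.1)
    (fun d _ => (finite_near_dart hG hq d ε).subset fun e he =>
      ⟨(hKne d e he).2.1, exists_of_edgeCorrelation_ne_zero hG hq (hKne d e he).2.2.2⟩)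
    (fun γ d e => by
      simp only [hK, hσ.invariant, edgeCorrelation_smul, dartVec, hq.sub_smul])
    -- Edges with nonzero interaction are not parallel, hence different; they are close, hence meet
    -- by the choice of the scale; and where they meet they share an endpoint.
    (fun d hd e h => by
      obtain ⟨a1, a2, a3, a4⟩ := hKne d e h
      have hne : s(d.1, d.2) ≠ s(e.1, e.2) := by
        intro h
        apply a3
        rcases Sym2.eq_iff.1 h with ⟨b1, b2⟩ | ⟨b1, b2⟩
        · rw [dartVec, dartVec, b1, b2, cross_self]
        · simp only [dartVec, b1, b2, cross, PiLp.sub_apply]; ring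
      refine ⟨hne, ?_⟩
      obtain ⟨x, hx⟩ := hsep d hd e a2 (exists_of_edgeCorrelation_ne_zero hG hq a4)
      obtain ⟨y, ⟨hy1, hy2⟩, _⟩ := hnc _ _ _ _ a1 a2 hne hx
      rcases hy1 with rfl | hy1 <;> rcases hy2 with hy2 | hy2
      · exact Or.inl hy2
      · exact Or.inr (Or.inl hy2)
      · exact Or.inr (Or.inr (Or.inl (hy1.symm.trans hy2)))
      · exact Or.inr (Or.inr (Or.inr (hy1.symm.trans hy2))))
  have htorus := stress_correlation_nonneg hG hq hσ h0 (torusBump ε) (fun x => le_max_left _ _)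
  have e1 : ∀ d ∈ hG.darts, ∀ e ∈ hG.darts, σ d.1 d.2 * σ e.1 e.2 *
      cross (dartVec q.1 d) (dartVec q.1 e) ^ 2 * ∫ t in unitSquare,
        torusBump ε (toTorus hG hq (q.1 d.1 + t.1 • dartVec q.1 d -
          (q.1 e.1 + t.2 • dartVec q.1 e))) = ∑ᶠ γ : Γ, K d (γ • e.1, γ • e.2) := by
    intro d _ e he
    rw [torus_integral_eq_finsum hG hq hε2 d e (hG.mem_darts.1 he).2, ← smul_eq_mul, smul_finsum]
    refine finsum_congr fun γ => ?_
    simp only [hK, hσ.invariant, smul_eq_mul, dartVec, hq.sub_smul]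
  rw [Finset.sum_congr rfl fun d hd => Finset.sum_congr rfl (e1 d hd), hpairs] at htorus
  set I := ∫ z : ℝ × ℝ, planeBump hG hq ε (toPlane z) with hI
  have hIpos : 0 < I := integral_planeBump_pos hG hq hε
  set Q : VertexOrbit G Γ → ℝ := fun o => ∑ i ∈ hG.nbr (hG.rep o), ∑ j ∈ hG.nbr (hG.rep o),
    σ (hG.rep o) i * σ (hG.rep o) j *
      |cross (q.1 i - q.1 (hG.rep o)) (q.1 j - q.1 (hG.rep o))| with hQ
  -- In the squared cross product one factor is absorbed by the Jacobian and the other stays in the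
  -- quadratic form. For almost every `z` the cones containing `z` pick out exactly half of that
  -- form, so the integral over `z` factors.
  have hlocal : ∀ o, ∑ v ∈ hG.nbr (hG.rep o), ∑ b ∈ hG.nbr (hG.rep o),
      K (hG.rep o, v) (hG.rep o, b) = Q o / 2 * I := by
    intro o
    set x := hG.rep o with hx
    obtain ⟨n, hn⟩ := hpt x
    set ind : V → V → ℝ × ℝ → ℝ := fun v b z =>
      if 0 < cross (toPlane z) (q.1 v - q.1 x) * cross (q.1 v - q.1 x) (q.1 b - q.1 x) ∧
        0 < cross (toPlane z) (q.1 b - q.1 x) * cross (q.1 v - q.1 x) (q.1 b - q.1 x)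
      then 1 else 0 with hind
    have hterm : ∀ v ∈ hG.nbr x, ∀ b ∈ hG.nbr x,
        Integrable (fun z => planeBump hG hq ε (toPlane z) * (σ x v * σ x b *
          |cross (q.1 v - q.1 x) (q.1 b - q.1 x)| * ind v b z)) ∧
        K (x, v) (x, b) = ∫ z, planeBump hG hq ε (toPlane z) * (σ x v * σ x b *
          |cross (q.1 v - q.1 x) (q.1 b - q.1 x)| * ind v b z) := by
      intro v hv b hb
      by_cases hc : cross (q.1 v - q.1 x) (q.1 b - q.1 x) = 0
      · simp [hK, dartVec, hc]
      · have hd : (x, v) ∈ hG.darts := hG.mem_darts.2 ⟨⟨o, rfl⟩, hG.mem_nbr.1 hv⟩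
        obtain ⟨i1, i2⟩ := cross_mul_integral_planeBump hG hq hc (hsmall _ hd b hb hc)
        have i3 := i1.const_mul (σ x v * σ x b * |cross (q.1 v - q.1 x) (q.1 b - q.1 x)|)
        have e : (fun z => planeBump hG hq ε (toPlane z) * (σ x v * σ x b *
          |cross (q.1 v - q.1 x) (q.1 b - q.1 x)| * ind v b z)) =
          fun z => σ x v * σ x b * |cross (q.1 v - q.1 x) (q.1 b - q.1 x)| *
            (planeBump hG hq ε (toPlane z) * ind v b z) := by
          funext z; ring
        rw [e]
        refine ⟨i3, ?_⟩
        rw [integral_const_mul, ← i2, hK]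
        simp only [edgeCorrelation, dartVec]
        have e2 : ∀ t : ℝ × ℝ, q.1 x + t.1 • (q.1 v - q.1 x) - (q.1 x + t.2 • (q.1 b - q.1 x)) =
            t.1 • (q.1 v - q.1 x) - t.2 • (q.1 b - q.1 x) := fun t => by abel
        simp_rw [e2]
        rw [← sq_abs]; ring
    rw [Finset.sum_congr rfl fun v hv => Finset.sum_congr rfl fun b hb => (hterm v hv b hb).2]
    have hint : ∀ v ∈ hG.nbr x, ∑ b ∈ hG.nbr x, ∫ z, planeBump hG hq ε (toPlane z) *
        (σ x v * σ x b * |cross (q.1 v - q.1 x) (q.1 b - q.1 x)| * ind v b z) =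
        ∫ z, ∑ b ∈ hG.nbr x, planeBump hG hq ε (toPlane z) *
        (σ x v * σ x b * |cross (q.1 v - q.1 x) (q.1 b - q.1 x)| * ind v b z) := fun v hv =>
      (integral_finsetSum _ fun b hb => (hterm v hv b hb).1).symm
    rw [Finset.sum_congr rfl hint, ← integral_finsetSum _ fun v hv =>
      integrable_finsetSum _ fun b hb => (hterm v hv b hb).1, hI, ← integral_const_mul]
    refine integral_congr_ae ?_
    have hgen : ∀ᵐ z : ℝ × ℝ, ∀ v ∈ hG.nbr x, cross (toPlane z) (q.1 v - q.1 x) ≠ 0 := by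
      rw [Filter.eventually_all_finset]
      intro v hv
      exact ae_cross_toPlane_ne_zero (sub_ne_zero.2
        (hq.ne_of_adj _ _ (hG.mem_nbr.1 hv)).symm)
    filter_upwards [hgen] with z hz
    have := sum_abs_cross_cone (hG.nbr x) (fun v => q.1 v - q.1 x) (fun v => σ x v) n
      (fun v hv => hn v (hG.mem_nbr.1 hv)) (hσ.equilibrium x) (toPlane z) hz
    simp_rw [← Finset.mul_sum]
    rw [hQ]
    simp only
    rw [← hx, ← this]
    simp only [hind]
    ring
  have hsum : ∑ d ∈ hG.darts, ∑ b ∈ hG.nbr d.1, K d (d.1, b) = ∑ o, Q o / 2 * I := by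
    rw [hG.sum_darts]
    exact Finset.sum_congr rfl fun o _ => hlocal o
  rw [hsum, ← Finset.sum_mul, ← Finset.sum_div] at htorus
  have hQle : ∀ o, Q o ≤ 0 := by
    intro o
    obtain ⟨n, hn⟩ := hpt (hG.rep o)
    exact (sum_abs_cross_nonpos (hG.nbr (hG.rep o)) (fun v => q.1 v - q.1 (hG.rep o))
      (fun v => σ (hG.rep o) v) n (fun v hv => hn v (hG.mem_nbr.1 hv))
      (hσ.equilibrium _)).1
  -- Globally the correlation is nonnegative, locally each form is nonpositive.
  have hQsum : ∑ o, Q o = 0 := by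
    refine le_antisymm (Finset.sum_nonpos fun o _ => hQle o) ?_
    by_contra hneg
    have : (∑ o, Q o) * I < 0 := mul_neg_of_neg_of_pos (not_le.1 hneg) hIpos
    linarith
  have hrep : ∀ o v, σ (hG.rep o) v = 0 := by
    intro o v
    by_cases hadj : G.Adj (hG.rep o) v
    · obtain ⟨n, hn⟩ := hpt (hG.rep o)
      have hQo : Q o = 0 := by
        have := (Finset.sum_eq_zero_iff_of_nonpos fun o _ => hQle o).1 hQsum
        exact this o (Finset.mem_univ o)
      exact (sum_abs_cross_nonpos (hG.nbr (hG.rep o)) (fun v => q.1 v - q.1 (hG.rep o))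
        (fun v => σ (hG.rep o) v) n (fun v hv => hn v (hG.mem_nbr.1 hv))
        (hσ.equilibrium _)).2 (fun i hi j hj hij =>
          cross_ne_zero_of_nbr hG hq hnc hn (hG.mem_nbr.1 hi) (hG.mem_nbr.1 hj) hij) hQo v
          (hG.mem_nbr.2 hadj)
    · exact hσ.support _ _ hadj
  have h := hσ.invariant (hG.shift u)⁻¹ u v
  rw [← h]
  have : (hG.shift u)⁻¹ • u = hG.rep (Quotient.mk'' u) := by
    rw [inv_smul_eq_iff]; exact (hG.shift_smul_rep u).symm
  rw [this]
  exact hrep _ _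

end Core

end PeriodicFramework
end

open scoped ContDiff
noncomputable section

namespace PeriodicFramework

/-! ### Faces and their incidence with edges. -/

section Faces

open Filter Topology

variable {V : Type*} {G : SimpleGraph V} {Γ : Subgroup (G ≃g G)} {q : Configuration G Γ}

theorem mem_drawing_iff (hG : IsPeriodicGraph G Γ) {p : V → Plane} {x : Plane} :
    x ∈ drawing G p ↔ ∃ u v, G.Adj u v ∧ x ∈ segment ℝ (p u) (p v) := by
  constructor
  · rintro (⟨v, rfl⟩ | h)
    · obtain ⟨w, hw⟩ := hG.exists_adj v
      exact ⟨v, w, hw, left_mem_segment ℝ _ _⟩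
    · exact h
  · exact fun h => Or.inr h

theorem isOpen_compl_drawing (hG : IsPeriodicGraph G Γ) (hq : IsPeriodicPlacement G Γ q) :
    IsOpen (drawing G q.1)ᶜ := by
  rw [Metric.isOpen_iff]
  intro x hx
  obtain ⟨r, hr, h⟩ := exists_ball_edges hG hq x
  refine ⟨r, hr, fun y hy hyd => hx ?_⟩
  obtain ⟨u, v, huv, hs⟩ := (mem_drawing_iff hG).1 hyd
  exact (mem_drawing_iff hG).2 ⟨u, v, huv, h u v huv y hy hs⟩

theorem IsFace.isOpen (hG : IsPeriodicGraph G Γ) (hq : IsPeriodicPlacement G Γ q) {U : Set Plane}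
    (hU : IsFace G q.1 U) : IsOpen U := by
  obtain ⟨x, _, rfl⟩ := hU
  exact (isOpen_compl_drawing hG hq).connectedComponentIn

theorem IsFace.subset {p : V → Plane} {U : Set Plane} (hU : IsFace G p U) :
    U ⊆ (drawing G p)ᶜ := by
  obtain ⟨x, _, rfl⟩ := hU
  exact connectedComponentIn_subset _ _

theorem IsFace.nonempty {p : V → Plane} {U : Set Plane} (hU : IsFace G p U) : U.Nonempty := by
  obtain ⟨x, hx, rfl⟩ := hU
  exact ⟨x, mem_connectedComponentIn hx⟩

theorem IsFace.eq_of_mem {p : V → Plane} {U U' : Set Plane} (hU : IsFace G p U)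
    (hU' : IsFace G p U') {x : Plane} (h : x ∈ U) (h' : x ∈ U') : U = U' := by
  obtain ⟨y, hy, rfl⟩ := hU
  obtain ⟨y', hy', rfl⟩ := hU'
  rw [connectedComponentIn_eq h, connectedComponentIn_eq h']

theorem exists_face_of_isPreconnected {p : V → Plane} {S : Set Plane}
    (hS : IsPreconnected S) (hS' : S ⊆ (drawing G p)ᶜ) (h : S.Nonempty) :
    ∃ U, IsFace G p U ∧ S ⊆ U := by
  obtain ⟨x, hx⟩ := h
  exact ⟨_, ⟨x, hS' hx, rfl⟩, hS.subset_connectedComponentIn hx hS'⟩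

theorem IsFace.mem_frontier (hG : IsPeriodicGraph G Γ) (hq : IsPeriodicPlacement G Γ q)
    {U : Set Plane} (hU : IsFace G q.1 U) {x : Plane} (hx : x ∈ closure U)
    (hx' : x ∈ drawing G q.1) : x ∈ frontier U := by
  rw [(hU.isOpen hG hq).frontier_eq]
  exact ⟨hx, fun h => hU.subset h hx'⟩

theorem ne_left_of_mem_openSegment {a b x : Plane} (hab : a ≠ b) (h : x ∈ openSegment ℝ a b) :
    x ≠ a := by
  rintro rfl; exact hab (left_mem_openSegment_iff.1 h)

theorem ne_right_of_mem_openSegment {a b x : Plane} (hab : a ≠ b) (h : x ∈ openSegment ℝ a b) :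
    x ≠ b := by
  rintro rfl; exact hab (right_mem_openSegment_iff.1 h)

/-- An interior point of an edge lies on no other edge. -/
theorem edge_eq_of_mem_openSegment (hq : IsPeriodicPlacement G Γ q) (hnc : IsNonCrossing G q.1)
    {a b c d : V} (hab : G.Adj a b) (hcd : G.Adj c d) {x : Plane}
    (hx : x ∈ openSegment ℝ (q.1 a) (q.1 b)) (hx' : x ∈ segment ℝ (q.1 c) (q.1 d)) :
    s(a, b) = s(c, d) := by
  by_contra hne
  obtain ⟨v, ⟨hv, _⟩, hvx⟩ := hnc a b c d hab hcd hne ⟨openSegment_subset_segment ℝ _ _ hx, hx'⟩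
  rcases hv with rfl | hv
  · exact ne_left_of_mem_openSegment (hq.ne_of_adj _ _ hab) hx hvx.symm
  · rw [Set.mem_singleton_iff] at hv
    subst hv
    exact ne_right_of_mem_openSegment (hq.ne_of_adj _ _ hab) hx hvx.symm

/-- A point of the drawing in the closure of a face is on its frontier, hence on a side of the
boundary polygon; through an interior point of an edge there is no other edge, so that side is the
edge itself. -/
theorem mem_edge_of_closure_face (hG : IsPeriodicGraph G Γ) (hq : IsPeriodicPlacement G Γ q)
    (hnc : IsNonCrossing G q.1) {U : Set Plane} (hU : IsFace G q.1 U) {k : ℕ} {c : ZMod k → V}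
    (hadj : ∀ i, G.Adj (c i) (c (i + 1)))
    (hfr : frontier U = ⋃ i, segment ℝ (q.1 (c i)) (q.1 (c (i + 1)))) {a b : V} (hab : G.Adj a b)
    {x : Plane} (hx : x ∈ openSegment ℝ (q.1 a) (q.1 b)) (hxU : x ∈ closure U) :
    ∃ i, s(c i, c (i + 1)) = s(a, b) := by
  have h1 := hU.mem_frontier hG hq hxU ((mem_drawing_iff hG).2
    ⟨a, b, hab, openSegment_subset_segment ℝ _ _ hx⟩)
  rw [hfr, Set.mem_iUnion] at h1
  obtain ⟨i, hi⟩ := h1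
  exact ⟨i, (edge_eq_of_mem_openSegment hq hnc hab (hadj i) hx hi).symm⟩

theorem segment_subset_closure_of_mem {U : Set Plane} {p : V → Plane} {k : ℕ} {c : ZMod k → V}
    (hfr : frontier U = ⋃ i, segment ℝ (p (c i)) (p (c (i + 1)))) {a b : V} {i : ZMod k}
    (hi : s(c i, c (i + 1)) = s(a, b)) : segment ℝ (p a) (p b) ⊆ closure U := by
  refine subset_trans ?_ frontier_subset_closure
  rw [hfr]
  refine subset_trans ?_ (Set.subset_iUnion _ i)
  rcases Sym2.eq_iff.1 hi with ⟨h1, h2⟩ | ⟨h1, h2⟩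
  · rw [h1, h2]
  · rw [h1, h2, segment_symm]

/-- The faces along an edge are those at any of its interior points. -/
theorem midpoint_mem_closure (hG : IsPeriodicGraph G Γ) (hq : IsPeriodicPlacement G Γ q)
    (hT : IsPseudoTriangulation G q.1) {U : Set Plane} (hU : IsFace G q.1 U) {a b : V}
    (hab : G.Adj a b) {x : Plane} (hx : x ∈ openSegment ℝ (q.1 a) (q.1 b)) (hxU : x ∈ closure U) :
    midpoint ℝ (q.1 a) (q.1 b) ∈ closure U := by
  obtain ⟨_, k, c, _, _, hadj, hfr, _⟩ := hT.faces U hU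
  obtain ⟨i, hi⟩ := mem_edge_of_closure_face hG hq hT.nonCrossing hU hadj hfr hab hx hxU
  exact segment_subset_closure_of_mem hfr hi
    (openSegment_subset_segment ℝ _ _ (midpoint_mem_openSegment _ _))

theorem convex_halfDisc (x w : Plane) (r : ℝ) :
    Convex ℝ {y | y ∈ Metric.ball x r ∧ 0 < cross w (y - x)} := by
  have h : {y : Plane | 0 < cross w (y - x)} = {y | cross w x < cross w y} := by
    ext y
    simp only [Set.mem_ofPred_eq, cross, PiLp.sub_apply]
    constructor <;> intro h <;> linarith
  have hl : IsLinearMap ℝ (fun y : Plane => cross w y) :=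
    ⟨fun a b => by simp only [cross, PiLp.add_apply]; ring,
      fun a b => by simp only [cross, PiLp.smul_apply, smul_eq_mul]; ring⟩
  have h2 : Convex ℝ {y : Plane | 0 < cross w (y - x)} := by
    rw [h]; exact convex_halfSpace_gt hl _
  exact (convex_ball x r).inter h2

/-- Rotation by a right angle. -/
def rot (w : Plane) : Plane := WithLp.toLp 2 ![-w 1, w 0]

theorem rot_zero (w : Plane) : rot w 0 = -w 1 := rfl

theorem rot_one (w : Plane) : rot w 1 = w 0 := rfl

theorem cross_rot (w : Plane) : cross w (rot w) = inner ℝ w w := by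
  simp only [cross, rot_zero, rot_one, inner_plane]; ring

theorem eq_smul_of_cross_eq_zero {w y : Plane} (hw : w ≠ 0) (h : cross w y = 0) :
    y = (inner ℝ w y / inner ℝ w w) • w := by
  have hne : (inner ℝ w w : ℝ) ≠ 0 := inner_self_ne_zero.2 hw
  rw [inner_plane] at hne
  simp only [cross] at h
  apply plane_ext
  · simp only [PiLp.smul_apply, smul_eq_mul, inner_plane]
    rw [div_mul_eq_mul_div, eq_div_iff hne]
    linear_combination (-w 1) * h
  · simp only [PiLp.smul_apply, smul_eq_mul, inner_plane]
    rw [div_mul_eq_mul_div, eq_div_iff hne]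
    linear_combination (w 0) * h


/-- Near an interior point of an edge there are at most two faces. -/
theorem exists_two_faces (hG : IsPeriodicGraph G Γ) (hq : IsPeriodicPlacement G Γ q)
    (hnc : IsNonCrossing G q.1) {a b : V} (hab : G.Adj a b) {x : Plane}
    (hx : x ∈ openSegment ℝ (q.1 a) (q.1 b)) :
    ∃ U₁ U₂, IsFace G q.1 U₁ ∧ IsFace G q.1 U₂ ∧ x ∈ closure U₁ ∧ x ∈ closure U₂ ∧
      ∃ N ∈ 𝓝 x, ∀ U, IsFace G q.1 U → (U ∩ N).Nonempty → U = U₁ ∨ U = U₂ := by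
  have hne := hq.ne_of_adj _ _ hab
  obtain ⟨r₀, hr₀, hball⟩ := exists_ball_edges hG hq x
  set w := q.1 b - q.1 a with hw
  have hw0 : w ≠ 0 := sub_ne_zero.2 hne.symm
  have hww : 0 < inner ℝ w w := real_inner_self_pos.2 hw0
  have hda : 0 < dist x (q.1 a) := dist_pos.2 (ne_left_of_mem_openSegment hne hx)
  have hdb : 0 < dist x (q.1 b) := dist_pos.2 (ne_right_of_mem_openSegment hne hx)
  -- Within this radius of `x` there is no edge avoiding `x`, and neither endpoint of the edge `ab`.
  set r := min r₀ (min (dist x (q.1 a)) (dist x (q.1 b))) with hr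
  have hrpos : 0 < r := lt_min hr₀ (lt_min hda hdb)
  obtain ⟨θ, ⟨hθ0, hθ1⟩, hθ⟩ : ∃ θ ∈ Set.Ioo (0 : ℝ) 1, q.1 a + θ • w = x := by
    rw [openSegment_eq_image'] at hx; exact hx
  -- points of the drawing near `x` lie on the line of the edge
  have hline : ∀ y ∈ Metric.ball x r, (y ∈ drawing G q.1 ↔ cross w (y - x) = 0) := by
    intro y hy
    have hy1 : dist y x < r₀ := lt_of_lt_of_le hy (min_le_left _ _)
    have hy2 : dist y x < dist x (q.1 a) :=
      lt_of_lt_of_le hy ((min_le_right _ _).trans (min_le_left _ _))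
    have hy3 : dist y x < dist x (q.1 b) :=
      lt_of_lt_of_le hy ((min_le_right _ _).trans (min_le_right _ _))
    constructor
    · intro hyd
      obtain ⟨u, v, huv, hs⟩ := (mem_drawing_iff hG).1 hyd
      have hxs := hball u v huv y hy1 hs
      have he := edge_eq_of_mem_openSegment hq hnc hab huv hx hxs
      have hys : y ∈ segment ℝ (q.1 a) (q.1 b) := by
        rcases Sym2.eq_iff.1 he with ⟨h1, h2⟩ | ⟨h1, h2⟩
        · rw [h1, h2]; exact hs
        · rw [h1, h2, segment_symm]; exact hs
      rw [segment_eq_image'] at hys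
      obtain ⟨t, _, ht⟩ := hys
      have : y - x = (t - θ) • w := by
        rw [← ht, ← hθ]; simp only [← hw]; module
      rw [this]
      simp only [cross, PiLp.smul_apply, smul_eq_mul]; ring
    · intro hc
      set t := inner ℝ w (y - x) / inner ℝ w w with ht
      have hyx : y - x = t • w := eq_smul_of_cross_eq_zero hw0 hc
      have hnw : 0 < ‖w‖ := norm_pos_iff.2 hw0
      have hd : dist y x = |t| * ‖w‖ := by
        rw [dist_eq_norm, hyx, norm_smul, Real.norm_eq_abs]
      have hd1 : dist x (q.1 a) = θ * ‖w‖ := by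
        rw [dist_eq_norm, ← hθ, add_sub_cancel_left, norm_smul, Real.norm_eq_abs, abs_of_pos hθ0]
      have hd2 : dist x (q.1 b) = (1 - θ) * ‖w‖ := by
        have : x - q.1 b = (θ - 1) • w := by rw [← hθ, sub_smul, one_smul]; rw [hw]; abel
        rw [dist_eq_norm, this, norm_smul, Real.norm_eq_abs, abs_of_neg (by linarith)]; ring
      rw [hd, hd1] at hy2
      rw [hd, hd2] at hy3
      have h1 := lt_of_mul_lt_mul_right hy2 hnw.le
      have h2 := lt_of_mul_lt_mul_right hy3 hnw.le
      refine (mem_drawing_iff hG).2 ⟨a, b, hab, ?_⟩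
      rw [segment_eq_image']
      refine ⟨θ + t, ⟨?_, ?_⟩, ?_⟩
      · linarith [neg_abs_le t]
      · linarith [le_abs_self t]
      · change q.1 a + (θ + t) • w = y
        rw [add_smul, ← add_assoc, hθ, ← hyx]; abel
  -- Each open half disc beside the edge is convex and avoids the drawing, so it lies in a single
  -- face. The two faces may coincide.
  have side : ∀ w' : Plane, w' = w ∨ w' = -w → ∃ U, IsFace G q.1 U ∧ x ∈ closure U ∧
      {y | y ∈ Metric.ball x r ∧ 0 < cross w' (y - x)} ⊆ U := by
    intro w' hw'
    have hpos : 0 < inner ℝ w' w' := by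
      rcases hw' with rfl | rfl
      · exact hww
      · rw [inner_neg_neg]; exact hww
    have hpt : ∀ t : ℝ, 0 < t → t * ‖rot w'‖ < r →
        x + t • rot w' ∈ {y | y ∈ Metric.ball x r ∧ 0 < cross w' (y - x)} := by
      intro t ht htr
      refine ⟨?_, ?_⟩
      · rw [Metric.mem_ball, dist_eq_norm, add_sub_cancel_left, norm_smul, Real.norm_eq_abs,
          abs_of_pos ht]
        exact htr
      · have : cross w' (x + t • rot w' - x) = t * cross w' (rot w') := by
          rw [add_sub_cancel_left]
          simp only [cross, PiLp.smul_apply, smul_eq_mul]; ring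
        rw [this, cross_rot]
        exact mul_pos ht hpos
    have hev : ∀ᶠ t in 𝓝[>] (0 : ℝ),
        x + t • rot w' ∈ {y | y ∈ Metric.ball x r ∧ 0 < cross w' (y - x)} := by
      filter_upwards [eventually_mul_lt ‖rot w'‖ hrpos, self_mem_nhdsWithin] with t ht ht0
      exact hpt t ht0 (by rwa [mul_comm])
    obtain ⟨U, hU, hsub⟩ := exists_face_of_isPreconnected (G := G) (p := q.1)
      (convex_halfDisc x w' r).isPreconnected (by
        rintro y ⟨hy1, hy2⟩ hyd
        have h0 := (hline y hy1).1 hyd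
        rcases hw' with rfl | rfl
        · exact hy2.ne' h0
        · have : cross (-w) (y - x) = -cross w (y - x) := by
            simp only [cross, PiLp.neg_apply]; ring
          rw [this, h0, neg_zero] at hy2
          exact hy2.false) ⟨_, hev.exists.choose_spec⟩
    refine ⟨U, hU, ?_, hsub⟩
    refine mem_closure_of_tendsto (f := fun t : ℝ => x + t • rot w') (b := 𝓝[>] (0 : ℝ)) ?_
      (hev.mono fun t ht => hsub ht)
    have : Tendsto (fun t : ℝ => x + t • rot w') (𝓝[>] 0) (𝓝 (x + (0 : ℝ) • rot w')) :=
      (Continuous.tendsto (by fun_prop) 0).mono_left nhdsWithin_le_nhds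
    simpa using this
  obtain ⟨U₁, hU₁, hx₁, hs₁⟩ := side w (Or.inl rfl)
  obtain ⟨U₂, hU₂, hx₂, hs₂⟩ := side (-w) (Or.inr rfl)
  refine ⟨U₁, U₂, hU₁, hU₂, hx₁, hx₂, Metric.ball x r, Metric.ball_mem_nhds x hrpos, ?_⟩
  rintro U hU ⟨y, hyU, hyb⟩
  have h0 : cross w (y - x) ≠ 0 := fun h => hU.subset hyU ((hline y hyb).2 h)
  rcases lt_or_gt_of_ne h0 with h | h
  · right
    refine hU.eq_of_mem hU₂ hyU (hs₂ ⟨hyb, ?_⟩)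
    have : cross (-w) (y - x) = -cross w (y - x) := by simp only [cross, PiLp.neg_apply]; ring
    rw [this]; linarith
  · left
    exact hU.eq_of_mem hU₁ hyU (hs₁ ⟨hyb, h⟩)

/-- A function on the faces that takes the same value on both sides of each edge is constant. -/
theorem face_function_const (hG : IsPeriodicGraph G Γ) (hq : IsPeriodicPlacement G Γ q)
    (hT : IsPseudoTriangulation G q.1) {α : Type*} (f : Set Plane → α)
    (hf : ∀ a b, G.Adj a b → ∀ U U', IsFace G q.1 U → IsFace G q.1 U' →
      midpoint ℝ (q.1 a) (q.1 b) ∈ closure U → midpoint ℝ (q.1 a) (q.1 b) ∈ closure U' →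
      f U = f U') {U U' : Set Plane} (hU : IsFace G q.1 U) (hU' : IsFace G q.1 U') :
    f U = f U' := by
  -- Vertices are removed because more than two faces may meet there; the plane minus a countable
  -- set is still connected, and there one passes between faces only across edges.
  have hcount : (Set.range q.1).Countable := by
    have := hG.countable_vertices
    exact Set.countable_range _
  have hconn : IsPreconnected (Set.range q.1)ᶜ :=
    (hcount.isPathConnected_compl_of_one_lt_rank (by
      rw [← Module.finrank_eq_rank, finrank_euclideanSpace_fin]; norm_num)).isConnected.isPreconnected
  -- The points near which only faces of value `κ` occur. These open sets cover the plane minus the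
  -- vertices, and two of them cannot meet there.
  let W : α → Set Plane := fun κ => {x | ∃ N, IsOpen N ∧ x ∈ N ∧
    ∀ U, IsFace G q.1 U → (U ∩ N).Nonempty → f U = κ}
  have hWopen : ∀ κ, IsOpen (W κ) := by
    intro κ
    rw [isOpen_iff_forall_mem_open]
    rintro x ⟨N, hN, hxN, h⟩
    exact ⟨N, fun y hy => ⟨N, hN, hy, h⟩, hN, hxN⟩
  have hcover : ∀ x ∈ (Set.range q.1)ᶜ, ∃ U, IsFace G q.1 U ∧ x ∈ closure U ∧ x ∈ W (f U) := by
    intro x hx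
    by_cases hxd : x ∈ drawing G q.1
    · obtain ⟨a, b, hab, hs⟩ := (mem_drawing_iff hG).1 hxd
      have hxo : x ∈ openSegment ℝ (q.1 a) (q.1 b) := by
        refine mem_openSegment_of_ne_left_right ?_ ?_ hs
        · rintro rfl; exact hx ⟨a, rfl⟩
        · rintro rfl; exact hx ⟨b, rfl⟩
      obtain ⟨U₁, U₂, h1, h2, hc1, hc2, N, hN, h⟩ := exists_two_faces hG hq hT.nonCrossing hab hxo
      have h12 : f U₂ = f U₁ := hf a b hab _ _ h2 h1
        (midpoint_mem_closure hG hq hT h2 hab hxo hc2)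
        (midpoint_mem_closure hG hq hT h1 hab hxo hc1)
      obtain ⟨N', hN', hopen, hxN'⟩ := mem_nhds_iff.1 hN
      refine ⟨U₁, h1, hc1, N', hopen, hxN', fun U hU hne => ?_⟩
      rcases h U hU (hne.mono (Set.inter_subset_inter_right _ hN')) with rfl | rfl
      · rfl
      · exact h12
    · refine ⟨connectedComponentIn (drawing G q.1)ᶜ x, ⟨x, hxd, rfl⟩,
        subset_closure (mem_connectedComponentIn hxd),
        connectedComponentIn (drawing G q.1)ᶜ x, (isOpen_compl_drawing hG hq).connectedComponentIn,
        mem_connectedComponentIn hxd, ?_⟩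
      rintro U hU ⟨y, hy1, hy2⟩
      rw [hU.eq_of_mem ⟨x, hxd, rfl⟩ hy1 hy2]
  by_contra hne
  obtain ⟨x, hx⟩ := hU.nonempty
  obtain ⟨x', hx'⟩ := hU'.nonempty
  have hxr : x ∈ (Set.range q.1)ᶜ := fun h => hU.subset hx (Or.inl h)
  have hxr' : x' ∈ (Set.range q.1)ᶜ := fun h => hU'.subset hx' (Or.inl h)
  have hmemW : ∀ {U x}, IsFace G q.1 U → x ∈ U → ∀ κ, x ∈ W κ → f U = κ := by
    rintro U x hU hx κ ⟨N, _, hxN, h⟩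
    exact h U hU ⟨x, hx, hxN⟩
  have h1 := hconn (W (f U)) (⋃ κ ∈ {κ | κ ≠ f U}, W κ) (hWopen _)
    (isOpen_biUnion fun κ _ => hWopen κ) (by
      intro y hy
      obtain ⟨U₀, h0, _, hW⟩ := hcover y hy
      by_cases he : f U₀ = f U
      · left; rw [← he]; exact hW
      · right; exact Set.mem_biUnion (x := f U₀) he hW) (by
      obtain ⟨U₀, h0, _, hW⟩ := hcover x hxr
      refine ⟨x, hxr, ?_⟩
      rw [hmemW hU hx _ hW]; exact hW) (by
      obtain ⟨U₀, h0, _, hW⟩ := hcover x' hxr'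
      refine ⟨x', hxr', Set.mem_biUnion (x := f U₀) ?_ hW⟩
      rw [← hmemW hU' hx' _ hW]; exact fun h => hne h.symm)
  obtain ⟨y, hy, ⟨N, hN, hyN, h⟩, hy2⟩ := h1
  rw [Set.mem_iUnion₂] at hy2
  obtain ⟨κ, hκ, N', hN', hyN', h'⟩ := hy2
  obtain ⟨U₀, h0, hyc, _⟩ := hcover y hy
  obtain ⟨z, hz1, hz2⟩ := mem_closure_iff.1 hyc (N ∩ N') (hN.inter hN') ⟨hyN, hyN'⟩
  exact hκ ((h' U₀ h0 ⟨z, hz2, hz1.2⟩).symm.trans (h U₀ h0 ⟨z, hz2, hz1.1⟩))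

end Faces

end PeriodicFramework
end

open scoped ContDiff
noncomputable section

namespace PeriodicFramework

/-! ### Convex corners of faces. -/

section Corners

open Filter Topology

variable {V : Type*} {G : SimpleGraph V} {Γ : Subgroup (G ≃g G)} {q : Configuration G Γ}

/-- The edges `va` and `vb` bound a convex sector of the face `U` at `v`, for some edge `vb` which
is next to `va` in counterclockwise order. -/
def IsCorner (G : SimpleGraph V) (p : V → Plane) (U : Set Plane) (v a : V) : Prop :=
  ∃ b, G.Adj v a ∧ G.Adj v b ∧ 0 < cross (p a - p v) (p b - p v) ∧
    (∀ᶠ t : ℝ in 𝓝[>] 0, p v + t • ((p a - p v) + (p b - p v)) ∈ U) ∧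
    midpoint ℝ (p v) (p a) ∈ closure U ∧ midpoint ℝ (p v) (p b) ∈ closure U

/-- Among the edges counterclockwise of `va`, there is a first one. -/
theorem exists_next_edge (hG : IsPeriodicGraph G Γ) {v a : V} (hpt : IsPointedAt G q.1 v)
    (h : ∃ b, G.Adj v b ∧ 0 < cross (q.1 a - q.1 v) (q.1 b - q.1 v)) :
    ∃ b, G.Adj v b ∧ 0 < cross (q.1 a - q.1 v) (q.1 b - q.1 v) ∧
      ∀ c, G.Adj v c → ¬ (0 < cross (q.1 a - q.1 v) (q.1 c - q.1 v) ∧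
        0 < cross (q.1 c - q.1 v) (q.1 b - q.1 v)) := by
  classical
  obtain ⟨n, hn⟩ := hpt
  let S := (hG.nbr v).filter fun b => 0 < cross (q.1 a - q.1 v) (q.1 b - q.1 v)
  have hS : S.Nonempty := by
    obtain ⟨b, hb, hab⟩ := h
    exact ⟨b, Finset.mem_filter.2 ⟨hG.mem_nbr.2 hb, hab⟩⟩
  -- The slope relative to `n` orders the edges in the half plane counterclockwise.
  obtain ⟨b, hbS, hb⟩ := S.exists_min_image
    (fun b => cross n (q.1 b - q.1 v) / inner ℝ n (q.1 b - q.1 v)) hS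
  obtain ⟨hbn, hab⟩ := Finset.mem_filter.1 hbS
  refine ⟨b, hG.mem_nbr.1 hbn, hab, fun c hc ⟨h1, h2⟩ => ?_⟩
  have h3 := hb c (Finset.mem_filter.2 ⟨hG.mem_nbr.2 hc, h1⟩)
  have hcp := hn c hc
  have hbp := hn b (hG.mem_nbr.1 hbn)
  rw [div_le_div_iff₀ hbp hcp] at h3
  have h4 := cross_mul_inner n (q.1 c - q.1 v) (q.1 b - q.1 v)
  have h5 := mul_pos h2 (inner_self_pos_of_inner_pos hcp)
  nlinarith

theorem cross_add_left (x y z : Plane) : cross (x + y) z = cross x z + cross y z := by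
  simp only [cross, PiLp.add_apply]; ring

theorem cross_add_right (x y z : Plane) : cross x (y + z) = cross x y + cross x z := by
  simp only [cross, PiLp.add_apply]; ring

theorem cross_smul_left (t : ℝ) (x y : Plane) : cross (t • x) y = t * cross x y := by
  simp only [cross, PiLp.smul_apply, smul_eq_mul]; ring

theorem cross_smul_right (t : ℝ) (x y : Plane) : cross x (t • y) = t * cross x y := by
  simp only [cross, PiLp.smul_apply, smul_eq_mul]; ring

theorem cross_neg_left (x y : Plane) : cross (-x) y = -cross x y := by
  simp only [cross, PiLp.neg_apply]; ring

/-- Consecutive edges at a pointed vertex bound a convex sector of some face. -/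
theorem exists_isCorner (hG : IsPeriodicGraph G Γ) (hq : IsPeriodicPlacement G Γ q)
    (hT : IsPseudoTriangulation G q.1) {v a : V} (ha : G.Adj v a)
    (h : ∃ b, G.Adj v b ∧ 0 < cross (q.1 a - q.1 v) (q.1 b - q.1 v)) :
    ∃ U, IsFace G q.1 U ∧ IsCorner G q.1 U v a := by
  obtain ⟨b, hb, hab, hcons⟩ := exists_next_edge hG (hT.pointed v) h
  obtain ⟨r, hr, hball⟩ := exists_ball_edges hG hq (q.1 v)
  set A := q.1 a - q.1 v with hA
  set B := q.1 b - q.1 v with hB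
  -- The part of a small disc strictly between the two edges: an intersection of two half discs,
  -- hence convex, and free of edges because `b` is the next edge after `a`.
  let S : Set Plane := {y | y ∈ Metric.ball (q.1 v) r ∧ 0 < cross A (y - q.1 v)} ∩
    {y | y ∈ Metric.ball (q.1 v) r ∧ 0 < cross (-B) (y - q.1 v)}
  have hmem : ∀ α β : ℝ, 0 < α → 0 < β → ‖α • A + β • B‖ < r → q.1 v + (α • A + β • B) ∈ S := by
    intro α β hα hβ hn
    have hd : q.1 v + (α • A + β • B) ∈ Metric.ball (q.1 v) r := by
      rw [Metric.mem_ball, dist_eq_norm, add_sub_cancel_left]; exact hn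
    refine ⟨⟨hd, ?_⟩, ⟨hd, ?_⟩⟩
    · rw [add_sub_cancel_left, cross_add_right, cross_smul_right, cross_smul_right, cross_self]
      have := mul_pos hβ hab
      linarith
    · rw [add_sub_cancel_left, cross_neg_left, cross_add_right, cross_smul_right, cross_smul_right,
        cross_self, cross_swap B A]
      have := mul_pos hα hab
      linarith
  have hdisj : S ⊆ (drawing G q.1)ᶜ := by
    rintro y ⟨⟨hy, h1⟩, -, h2⟩ hyd
    obtain ⟨u, w, huw, hs⟩ := (mem_drawing_iff hG).1 hyd
    have hv := eq_or_eq_of_mem_segment hG hq hT.nonCrossing huw (hball u w huw y hy hs)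
    have key : ∀ c, G.Adj v c → y ∉ segment ℝ (q.1 v) (q.1 c) := by
      intro c hc hyc
      rw [segment_eq_image'] at hyc
      obtain ⟨t, ⟨ht, -⟩, rfl⟩ := hyc
      simp only [add_sub_cancel_left] at h1 h2
      rw [cross_smul_right] at h1 h2
      rw [cross_neg_left, cross_swap, neg_neg] at h2
      exact hcons c hc ⟨pos_of_mul_pos_right h1 ht, pos_of_mul_pos_right h2 ht⟩
    rcases hv with rfl | rfl
    · exact key w huw hs
    · exact key u huw.symm (by rwa [segment_symm])
  have hsum : ∀ᶠ t : ℝ in 𝓝[>] 0, q.1 v + t • (A + B) ∈ S := by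
    filter_upwards [eventually_mul_lt ‖A + B‖ hr, self_mem_nhdsWithin] with t ht ht0
    rw [smul_add]
    refine hmem t t ht0 ht0 ?_
    rw [← smul_add, norm_smul, Real.norm_eq_abs, abs_of_pos ht0, mul_comm]
    exact ht
  obtain ⟨U, hU, hSU⟩ := exists_face_of_isPreconnected (G := G) (p := q.1)
    ((convex_halfDisc (q.1 v) A r).inter (convex_halfDisc (q.1 v) (-B) r)).isPreconnected hdisj
    ⟨_, hsum.exists.choose_spec⟩
  -- Points of a bounding edge close to `v` are limits of points of the sector; one interior point
  -- in the closure of the face brings in the midpoint by `midpoint_mem_closure`.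
  have hside : ∀ C D : Plane, (∀ α β : ℝ, 0 < α → 0 < β → ‖α • C + β • D‖ < r →
      q.1 v + (α • C + β • D) ∈ S) → ∀ c, G.Adj v c → C = q.1 c - q.1 v →
      midpoint ℝ (q.1 v) (q.1 c) ∈ closure U := by
    intro C D hCD c hc hC
    obtain ⟨α, ⟨h1, h2⟩, h0⟩ : ∃ α : ℝ, (α * ‖C‖ < r ∧ α < 1) ∧ 0 < α := by
      have h1 := eventually_mul_lt ‖C‖ hr
      have h2 := eventually_mul_lt 1 (one_pos (α := ℝ))
      obtain ⟨α, hα⟩ := (h1.and (h2.and self_mem_nhdsWithin)).exists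
      exact ⟨α, ⟨by rw [mul_comm]; exact hα.1, by simpa using hα.2.1⟩, hα.2.2⟩
    refine midpoint_mem_closure hG hq hT hU hc (x := q.1 v + α • C) ?_ ?_
    · rw [openSegment_eq_image']
      exact ⟨α, ⟨h0, h2⟩, by rw [hC]⟩
    · have hlim : Tendsto (fun β : ℝ => q.1 v + (α • C + β • D)) (𝓝[>] 0)
          (𝓝 (q.1 v + (α • C + (0 : ℝ) • D))) :=
        (Continuous.tendsto (by fun_prop) 0).mono_left nhdsWithin_le_nhds
      have hn : Tendsto (fun β : ℝ => ‖α • C + β • D‖) (𝓝[>] 0) (𝓝 ‖α • C + (0 : ℝ) • D‖) :=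
        (Continuous.tendsto (by fun_prop) 0).mono_left nhdsWithin_le_nhds
      rw [zero_smul, add_zero] at hlim hn
      refine mem_closure_of_tendsto hlim ?_
      have hlt : ‖α • C‖ < r := by
        rw [norm_smul, Real.norm_eq_abs, abs_of_pos h0]; exact h1
      filter_upwards [hn.eventually_lt_const hlt, self_mem_nhdsWithin] with β hβ hβ0
      exact hSU (hCD α β h0 hβ0 hβ)
  refine ⟨U, hU, b, ha, hb, hab, hsum.mono fun t ht => hSU ht, hside A B hmem a ha rfl,
    hside B A (fun α β hα hβ hn => ?_) b hb rfl⟩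
  rw [add_comm (α • B)] at hn ⊢
  exact hmem β α hβ hα hn

/-- A corner of a face is a vertex of its boundary polygon with internal angle less than `π`. -/
theorem IsCorner.exists_index (hG : IsPeriodicGraph G Γ) (hq : IsPeriodicPlacement G Γ q)
    (hnc : IsNonCrossing G q.1) {U : Set Plane} (hU : IsFace G q.1 U) {k : ℕ} {c : ZMod k → V}
    (hinj : Function.Injective c) (hadj : ∀ i, G.Adj (c i) (c (i + 1)))
    (hfr : frontier U = ⋃ i, segment ℝ (q.1 (c i)) (q.1 (c (i + 1)))) {v a : V}
    (h : IsCorner G q.1 U v a) :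
    ∃ i, c i = v ∧ internalAngle U (q.1 (c (i - 1))) (q.1 (c i)) (q.1 (c (i + 1))) < Real.pi ∧
      ((a = c (i - 1) ∧ 0 < cross (q.1 (c (i - 1)) - q.1 v) (q.1 (c (i + 1)) - q.1 v)) ∨
       (a = c (i + 1) ∧ 0 < cross (q.1 (c (i + 1)) - q.1 v) (q.1 (c (i - 1)) - q.1 v))) := by
  obtain ⟨b, ha, hb, hab, hev, hca, hcb⟩ := h
  have hne : a ≠ b := by rintro rfl; rw [cross_self] at hab; exact hab.false
  obtain ⟨i, hi⟩ := mem_edge_of_closure_face hG hq hnc hU hadj hfr ha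
    (midpoint_mem_openSegment _ _) hca
  obtain ⟨j, hj⟩ := mem_edge_of_closure_face hG hq hnc hU hadj hfr hb
    (midpoint_mem_openSegment _ _) hcb
  have hangle : EuclideanGeometry.angle (q.1 a) (q.1 v) (q.1 b) < Real.pi := by
    refine lt_of_le_of_ne (EuclideanGeometry.angle_le_pi _ _ _) fun h => ?_
    rw [EuclideanGeometry.angle, InnerProductGeometry.angle_eq_pi_iff] at h
    obtain ⟨_, t, _, ht⟩ := h
    rw [vsub_eq_sub, vsub_eq_sub] at ht
    rw [ht, cross_smul_right, cross_self, mul_zero] at hab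
    exact hab.false
  -- The edges `va` and `vb` are sides of the polygon. As `c` is injective, they are the side before
  -- and the side after `v`, in one order or the other; the remaining two cases would give `a = b`.
  rcases Sym2.eq_iff.1 hi with ⟨h1, h2⟩ | ⟨h1, h2⟩ <;>
    rcases Sym2.eq_iff.1 hj with ⟨h3, h4⟩ | ⟨h3, h4⟩
  · have : i = j := hinj (h1.trans h3.symm)
    rw [this] at h2
    exact absurd (h2.symm.trans h4) hne
  · have hij : i = j + 1 := hinj (h1.trans h4.symm)
    have hb' : c (i - 1) = b := by rw [hij, add_sub_cancel_right, h3]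
    refine ⟨i, h1, ?_, Or.inr ⟨h2.symm, ?_⟩⟩
    · rw [hb', h1, h2, internalAngle, if_pos, EuclideanGeometry.angle_comm]
      · exact hangle
      · filter_upwards [hev] with t ht
        rwa [add_comm (q.1 b - q.1 v)]
    · rw [hb', h2]; exact hab
  · have hij : j = i + 1 := hinj (h3.trans h2.symm)
    have ha' : c (j - 1) = a := by rw [hij, add_sub_cancel_right, h1]
    refine ⟨j, h3, ?_, Or.inl ⟨ha'.symm, ?_⟩⟩
    · rw [ha', h3, h4, internalAngle, if_pos hev]
      exact hangle
    · rw [ha', h4]; exact hab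
  · have hij : i + 1 = j + 1 := hinj (h2.trans h4.symm)
    rw [add_right_cancel hij] at h1
    exact absurd (h1.symm.trans h3) hne

/-- A pseudo-triangle has at most three corners. -/
theorem ncard_isCorner_le (hG : IsPeriodicGraph G Γ) (hq : IsPeriodicPlacement G Γ q)
    (hT : IsPseudoTriangulation G q.1) {U : Set Plane} (hU : IsFace G q.1 U) :
    {d : V × V | IsCorner G q.1 U d.1 d.2}.Finite ∧
      {d : V × V | IsCorner G q.1 U d.1 d.2}.ncard ≤ 3 := by
  obtain ⟨_, k, c, _, hinj, hadj, hfr, hcard⟩ := hT.faces U hU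
  have hfin := Set.finite_of_ncard_ne_zero (hcard.trans_ne three_ne_zero)
  have hsub : Prod.fst '' {d : V × V | IsCorner G q.1 U d.1 d.2} ⊆
      c '' {i | internalAngle U (q.1 (c (i - 1))) (q.1 (c i)) (q.1 (c (i + 1))) < Real.pi} := by
    rintro _ ⟨d, hd, rfl⟩
    obtain ⟨i, hi, hlt, -⟩ :=
      IsCorner.exists_index hG hq hT.nonCrossing hU hinj hadj hfr hd
    exact ⟨i, hlt, hi⟩
  -- One corner per polygon vertex: the sign of the cross product of the two sides tells which one
  -- is the clockwise side, and this is the edge recorded in the corner.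
  have hinjOn : Set.InjOn Prod.fst {d : V × V | IsCorner G q.1 U d.1 d.2} := by
    rintro ⟨v, a⟩ hd ⟨v', a'⟩ hd' (h : v = v')
    subst h
    obtain ⟨i, hi, -, h1⟩ := IsCorner.exists_index hG hq hT.nonCrossing hU hinj hadj hfr hd
    obtain ⟨j, hj, -, h2⟩ := IsCorner.exists_index hG hq hT.nonCrossing hU hinj hadj hfr hd'
    have hij : j = i := hinj (hj.trans hi.symm)
    subst hij
    simp only at h1 h2
    rw [cross_swap (q.1 (c (j + 1)) - q.1 v)] at h1 h2
    rcases h1 with ⟨h1, h3⟩ | ⟨h1, h3⟩ <;> rcases h2 with ⟨h2, h4⟩ | ⟨h2, h4⟩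
    · rw [h1, h2]
    · linarith
    · linarith
    · rw [h1, h2]
  have hf2 := (hfin.image c).subset hsub
  refine ⟨hf2.of_finite_image hinjOn, ?_⟩
  rw [← hinjOn.ncard_image]
  exact ((Set.ncard_le_ncard hsub (hfin.image c)).trans (Set.ncard_image_le hfin)).trans hcard.le

/-! ### The action on the faces -/

/-- The set of faces of a framework. -/
abbrev Face (G : SimpleGraph V) (p : V → Plane) : Type := {U : Set Plane // IsFace G p U}

theorem drawing_translate (hq : IsPeriodicPlacement G Γ q) (γ : Γ) {x : Plane}
    (h : x ∈ drawing G q.1) : x + q.2 γ ∈ drawing G q.1 := by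
  rcases h with ⟨v, rfl⟩ | ⟨u, v, huv, h⟩
  · exact Or.inl ⟨γ • v, hq.equivariant γ v⟩
  · refine Or.inr ⟨γ • u, γ • v, (adj_smul_iff γ).2 huv, ?_⟩
    rw [segment_smul hq]
    simpa using h

theorem IsPeriodicPlacement.map_inv (hq : IsPeriodicPlacement G Γ q) (γ : Γ) :
    q.2 γ⁻¹ = -q.2 γ := by
  have := hq.map_mul γ γ⁻¹
  rw [mul_inv_cancel, hq.map_one] at this
  exact eq_neg_of_add_eq_zero_right this.symm

theorem drawing_translate_iff (hq : IsPeriodicPlacement G Γ q) (γ : Γ) {x : Plane} :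
    x - q.2 γ ∈ drawing G q.1 ↔ x ∈ drawing G q.1 := by
  constructor
  · intro h; simpa using drawing_translate hq γ h
  · intro h; simpa [hq.map_inv, sub_eq_add_neg] using drawing_translate hq γ⁻¹ h

theorem IsFace.translate (hq : IsPeriodicPlacement G Γ q) (γ : Γ) {U : Set Plane}
    (hU : IsFace G q.1 U) : IsFace G q.1 ((fun x => x - q.2 γ) ⁻¹' U) := by
  obtain ⟨x, hx, rfl⟩ := hU
  refine ⟨x + q.2 γ, fun h => hx (by simpa using (drawing_translate_iff hq γ).2 h), ?_⟩
  have h1 := (Homeomorph.addRight (q.2 γ)).image_connectedComponentIn hx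
  have himg : ∀ S : Set Plane, (fun x => x - q.2 γ) ⁻¹' S = Homeomorph.addRight (q.2 γ) '' S := by
    intro S
    ext y
    constructor
    · intro h; exact ⟨_, h, by simp⟩
    · rintro ⟨z, hz, rfl⟩; simpa using hz
  rw [himg, h1, ← himg]
  congr 1
  ext y
  exact not_congr (drawing_translate_iff hq γ)

/-- The group of periods permutes the faces. -/
@[reducible] def faceAction (hq : IsPeriodicPlacement G Γ q) : MulAction Γ (Face G q.1) where
  smul γ U := ⟨(fun x => x - q.2 γ) ⁻¹' U.1, U.2.translate hq γ⟩
  one_smul U := Subtype.ext (by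
    change (fun x => x - q.2 1) ⁻¹' U.1 = U.1
    rw [hq.map_one]; simp)
  mul_smul γ δ U := Subtype.ext (by
    change (fun x => x - q.2 (γ * δ)) ⁻¹' U.1 = (fun x => x - q.2 γ) ⁻¹' ((fun x => x - q.2 δ) ⁻¹' U.1)
    rw [hq.map_mul]
    ext x
    simp only [Set.mem_preimage, sub_sub])

theorem mem_faceAction (hq : IsPeriodicPlacement G Γ q) (γ : Γ) (U : Face G q.1) (x : Plane) :
    letI := faceAction hq
    x ∈ (γ • U).1 ↔ x - q.2 γ ∈ U.1 := Iff.rfl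

/-- A face invariant under a nonzero translation contains an infinite arithmetic progression of
points, but the faces of a pseudo-triangulation are bounded. -/
theorem faceAction_actsFreely (hq : IsPeriodicPlacement G Γ q)
    (hT : IsPseudoTriangulation G q.1) :
    letI := faceAction hq
    ActsFreely Γ (Face G q.1) := by
  let _ := faceAction hq
  intro γ hγ U hU
  obtain ⟨x, hx⟩ := U.2.nonempty
  obtain ⟨C, hC⟩ := (hT.faces U.1 U.2).1.exists_norm_le
  have hpow : ∀ n : ℕ, x + (n : ℝ) • q.2 γ ∈ U.1 := by
    intro n
    induction n with
    | zero => simpa using hx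
    | succ n ih =>
      rw [← hU, mem_faceAction]
      convert ih using 1
      push_cast
      module
  have hne : q.2 γ ≠ 0 := fun h => hγ (hq.injective (h.trans hq.map_one.symm))
  have hpos := norm_pos_iff.2 hne
  obtain ⟨n, hn⟩ := exists_nat_gt ((C + ‖x‖) / ‖q.2 γ‖)
  rw [div_lt_iff₀ hpos] at hn
  have h1 := hC _ (hpow n)
  have h2 : ‖(n : ℝ) • q.2 γ‖ ≤ ‖x + (n : ℝ) • q.2 γ‖ + ‖x‖ := by
    simpa using norm_sub_le (x + (n : ℝ) • q.2 γ) x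
  rw [norm_smul, Real.norm_natCast] at h2
  linarith

theorem mem_closure_translate (q : Configuration G Γ) (γ : Γ) (U : Set Plane) (x : Plane) :
    x ∈ closure ((fun x => x - q.2 γ) ⁻¹' U) ↔ x - q.2 γ ∈ closure U := by
  have := (Homeomorph.subRight (q.2 γ)).preimage_closure U
  change x ∈ closure (Homeomorph.subRight (q.2 γ) ⁻¹' U) ↔ _
  rw [← this]
  rfl

theorem IsCorner.smul (hq : IsPeriodicPlacement G Γ q) (γ : Γ) {U : Set Plane} {v a : V}
    (h : IsCorner G q.1 U v a) :
    IsCorner G q.1 ((fun x => x - q.2 γ) ⁻¹' U) (γ • v) (γ • a) := by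
  obtain ⟨b, ha, hb, hab, hev, h1, h2⟩ := h
  have hmid : ∀ c, midpoint ℝ (q.1 (γ • v)) (q.1 (γ • c)) - q.2 γ = midpoint ℝ (q.1 v) (q.1 c) := by
    intro c
    rw [hq.equivariant, hq.equivariant, midpoint_eq_smul_add, midpoint_eq_smul_add, invOf_eq_inv]
    module
  refine ⟨γ • b, (adj_smul_iff γ).2 ha, (adj_smul_iff γ).2 hb, ?_, ?_, ?_, ?_⟩
  · rwa [hq.sub_smul, hq.sub_smul]
  · filter_upwards [hev] with t ht
    rw [hq.sub_smul, hq.sub_smul, Set.mem_preimage, hq.equivariant]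
    convert ht using 1
    abel
  · rwa [mem_closure_translate, hmid]
  · rwa [mem_closure_translate, hmid]

theorem isCorner_smul_iff (hq : IsPeriodicPlacement G Γ q) (γ : Γ) (U : Face G q.1) (v a : V) :
    letI := faceAction hq
    IsCorner G q.1 (γ • U).1 (γ • v) (γ • a) ↔ IsCorner G q.1 U.1 v a := by
  let _ := faceAction hq
  refine ⟨fun h => ?_, fun h => h.smul hq γ⟩
  have h1 : IsCorner G q.1 (γ⁻¹ • γ • U).1 (γ⁻¹ • γ • v) (γ⁻¹ • γ • a) := h.smul hq γ⁻¹
  simpa only [inv_smul_smul] using h1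

end Corners

end PeriodicFramework

end

open scoped ContDiff
noncomputable section

namespace PeriodicFramework

/-! ### Counting corners by vertices and by faces. -/

section Counting

open Filter Topology

variable {V : Type*} {G : SimpleGraph V} {Γ : Subgroup (G ≃g G)} {q : Configuration G Γ}

/-- The set of orbits of faces. -/
abbrev FaceOrbit (hq : IsPeriodicPlacement G Γ q) : Type _ :=
  @MulAction.orbitRel.Quotient Γ (Face G q.1) _ (faceAction hq)

theorem finite_faces_at_edge (hG : IsPeriodicGraph G Γ) (hq : IsPeriodicPlacement G Γ q)
    (hnc : IsNonCrossing G q.1) {a b : V} (hab : G.Adj a b) :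
    {U : Face G q.1 | midpoint ℝ (q.1 a) (q.1 b) ∈ closure U.1}.Finite := by
  obtain ⟨U₁, U₂, h1, h2, -, -, N, hN, h⟩ :=
    exists_two_faces hG hq hnc hab (midpoint_mem_openSegment (q.1 a) (q.1 b))
  refine (Set.toFinite {(⟨U₁, h1⟩ : Face G q.1), ⟨U₂, h2⟩}).subset fun U hU => ?_
  rw [Set.mem_ofPred_eq, mem_closure_iff_nhds] at hU
  have := h U.1 U.2 (by rw [Set.inter_comm]; exact hU N hN)
  rcases this with h | h
  · exact Or.inl (Subtype.ext h)
  · exact Or.inr (Subtype.ext h)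

theorem IsPseudoTriangulation.exists_edge (hT : IsPseudoTriangulation G q.1) (U : Face G q.1) :
    ∃ a b, G.Adj a b ∧ midpoint ℝ (q.1 a) (q.1 b) ∈ closure U.1 := by
  obtain ⟨_, k, c, _, _, hadj, hfr, _⟩ := hT.faces U.1 U.2
  exact ⟨c 0, c (0 + 1), hadj 0, segment_subset_closure_of_mem hfr (i := 0) rfl
    (midpoint_mem_segment _ _)⟩

theorem midpoint_smul (hq : IsPeriodicPlacement G Γ q) (γ : Γ) (a b : V) :
    midpoint ℝ (q.1 (γ • a)) (q.1 (γ • b)) - q.2 γ = midpoint ℝ (q.1 a) (q.1 b) := by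
  rw [hq.equivariant, hq.equivariant, midpoint_eq_smul_add, midpoint_eq_smul_add, invOf_eq_inv]
  module

/-- Every face has an edge on its boundary, which can be translated to one of finitely many
representatives, and finitely many faces lie along an edge. -/
theorem finite_faceOrbit (hG : IsPeriodicGraph G Γ) (hq : IsPeriodicPlacement G Γ q)
    (hT : IsPseudoTriangulation G q.1) : Finite (FaceOrbit hq) := by
  let _ := faceAction hq
  have hfin : (⋃ d ∈ hG.darts, {U : Face G q.1 | G.Adj d.1 d.2 ∧
      midpoint ℝ (q.1 d.1) (q.1 d.2) ∈ closure U.1}).Finite := by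
    refine Set.Finite.biUnion hG.darts.finite_toSet fun d hd => ?_
    exact (finite_faces_at_edge hG hq hT.nonCrossing (hG.mem_darts.1 hd).2).subset fun U hU => hU.2
  have hsurj : (fun U : Face G q.1 => (Quotient.mk'' U : FaceOrbit hq)) ''
      (⋃ d ∈ hG.darts, {U : Face G q.1 | G.Adj d.1 d.2 ∧
      midpoint ℝ (q.1 d.1) (q.1 d.2) ∈ closure U.1}) = Set.univ := by
    refine Set.eq_univ_of_forall fun o => ?_
    induction o using Quotient.inductionOn' with
    | h U =>
      obtain ⟨a, b, hab, hU⟩ := hT.exists_edge U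
      obtain ⟨γ, d, hd, rfl, rfl⟩ := hG.exists_smul_dart hab
      refine ⟨γ⁻¹ • U, ?_, mk_smul _ _⟩
      simp only [Set.mem_iUnion]
      refine ⟨d, hd, (hG.mem_darts.1 hd).2, ?_⟩
      change _ ∈ closure ((fun x => x - q.2 γ⁻¹) ⁻¹' U.1)
      rw [mem_closure_translate, hq.map_inv, ← midpoint_smul hq γ]
      simpa using hU
  exact Set.finite_univ_iff.1 (hsurj ▸ hfin.image _)

/-- A pointed vertex of degree `d` has `d - 1` convex sectors between consecutive edges. -/
theorem degree_le_sum_corners (hG : IsPeriodicGraph G Γ) (hq : IsPeriodicPlacement G Γ q)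
    (hT : IsPseudoTriangulation G q.1) (v : V)
    (hfin : (Function.support fun U : Face G q.1 => {a | IsCorner G q.1 U.1 v a}.ncard).Finite) :
    (hG.nbr v).card ≤ ∑ᶠ U : Face G q.1, {a | IsCorner G q.1 U.1 v a}.ncard + 1 := by
  classical
  -- The edges with some other edge counterclockwise of them in the half plane. At most one edge at
  -- `v` lacks this property, and each of the others starts a convex sector.
  let P : V → Prop := fun a => ∃ b, G.Adj v b ∧ 0 < cross (q.1 a - q.1 v) (q.1 b - q.1 v)
  rw [← Finset.card_filter_add_card_filter_not (s := hG.nbr v) P]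
  have h1 : ((hG.nbr v).filter fun a => ¬ P a).card ≤ 1 := by
    refine Finset.card_le_one.2 fun a ha b hb => ?_
    by_contra hne
    obtain ⟨ha, ha'⟩ := Finset.mem_filter.1 ha
    obtain ⟨hb, hb'⟩ := Finset.mem_filter.1 hb
    rw [hG.mem_nbr] at ha hb
    obtain ⟨n, hn⟩ := hT.pointed v
    rcases lt_or_gt_of_ne (cross_ne_zero_of_nbr hG hq hT.nonCrossing hn ha hb hne) with h | h
    · exact hb' ⟨a, ha, by rw [cross_swap]; linarith⟩
    · exact ha' ⟨b, hb, h⟩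
  refine Nat.add_le_add ?_ h1
  have hex : ∀ a : V, ∃ U : Face G q.1, a ∈ (hG.nbr v).filter P → IsCorner G q.1 U.1 v a := by
    intro a
    by_cases ha : a ∈ (hG.nbr v).filter P
    · obtain ⟨h1, h2⟩ := Finset.mem_filter.1 ha
      obtain ⟨U, hU, h⟩ := exists_isCorner hG hq hT (hG.mem_nbr.1 h1) h2
      exact ⟨⟨U, hU⟩, fun _ => h⟩
    · obtain ⟨U, _, hU, -⟩ := exists_two_faces hG hq hT.nonCrossing (hG.exists_adj v).choose_spec
        (midpoint_mem_openSegment _ _)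
      exact ⟨⟨U, hU⟩, fun h => absurd h ha⟩
  choose U hU using hex
  have hfina : ∀ W : Set Plane, {a | IsCorner G q.1 W v a}.Finite := fun W =>
    (hG.nbr v).finite_toSet.subset fun a ha => hG.mem_nbr.2 ha.choose_spec.1
  rw [finsum_eq_sum_of_support_subset _ (s := hfin.toFinset) (by simp),
    Finset.card_eq_sum_card_fiberwise (f := U) (t := hfin.toFinset)]
  · refine Finset.sum_le_sum fun W _ => ?_
    rw [← Set.ncard_coe_finset]
    refine Set.ncard_le_ncard (fun a ha => ?_) (hfina _)
    obtain ⟨h1, rfl⟩ := Finset.mem_filter.1 ha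
    exact hU a h1
  · intro a ha
    rw [Finset.mem_coe, Set.Finite.mem_toFinset, Function.mem_support]
    exact (Set.ncard_pos (hfina _)).2 ⟨a, hU a ha⟩ |>.ne'

theorem card_darts (hG : IsPeriodicGraph G Γ) :
    hG.darts.card = 2 * Nat.card (EdgeOrbit G Γ) := by
  have := hG.finite_edges
  have := Fintype.ofFinite (EdgeOrbit G Γ)
  obtain ⟨r, hr, hr'⟩ := hG.exists_edge_section
  have := hG.sum_darts_eq_sum_edges r hr hr' (fun _ => 1) (fun _ _ _ => rfl)
  simp only [Finset.sum_const, smul_eq_mul, mul_one, Finset.card_univ] at this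
  rw [this, Nat.card_eq_fintype_card, mul_comm]

/-- Each vertex orbit of degree `d` contributes `d - 1` corners, each face orbit has at most three
corners. -/
theorem two_mul_card_edgeOrbit_le (hG : IsPeriodicGraph G Γ) (hq : IsPeriodicPlacement G Γ q)
    (hT : IsPseudoTriangulation G q.1) :
    2 * Nat.card (EdgeOrbit G Γ) ≤ Nat.card (VertexOrbit G Γ) + 3 * Nat.card (FaceOrbit hq) := by
  classical
  let _ := faceAction hq
  have := hG.finite_vertices
  have := Fintype.ofFinite (VertexOrbit G Γ)
  have := finite_faceOrbit hG hq hT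
  have := Fintype.ofFinite (FaceOrbit hq)
  obtain ⟨r', hr'⟩ := exists_orbit_section Γ (Face G q.1)
  -- The number of corners of `U` at `v`; its sum over pairs modulo translations is evaluated by
  -- vertices and by faces.
  let F : V → Face G q.1 → ℕ := fun v U => {a | IsCorner G q.1 U.1 v a}.ncard
  have hfin2 : ∀ U : Face G q.1, {d : V × V | IsCorner G q.1 U.1 d.1 d.2}.Finite := fun U =>
    (ncard_isCorner_le hG hq hT U.2).1
  have h1 : ∀ v, (Function.support fun U => F v U).Finite := by
    intro v
    refine (Set.Finite.biUnion (hG.nbr v).finite_toSet fun a ha =>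
      finite_faces_at_edge hG hq hT.nonCrossing (hG.mem_nbr.1 ha)).subset fun U hU => ?_
    obtain ⟨a, ha⟩ := Set.nonempty_of_ncard_ne_zero hU
    obtain ⟨b, h1, _, _, _, h2, _⟩ := ha
    exact Set.mem_biUnion (Finset.mem_coe.2 (hG.mem_nbr.2 h1)) h2
  have hsupp : ∀ U : Face G q.1, (Function.support fun v => F v U) ⊆
      ((hfin2 U).toFinset.image Prod.fst : Finset V) := by
    intro U v hv
    obtain ⟨a, ha⟩ := Set.nonempty_of_ncard_ne_zero hv
    exact Finset.mem_coe.2 (Finset.mem_image.2 ⟨(v, a), (hfin2 U).mem_toFinset.2 ha, rfl⟩)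
  have h2 : ∀ U, (Function.support fun v => F v U).Finite := fun U =>
    (Finset.finite_toSet _).subset (hsupp U)
  have hF : ∀ (γ : Γ) v U, F (γ • v) (γ • U) = F v U := by
    intro γ v U
    have : {a | IsCorner G q.1 (γ • U).1 (γ • v) a} =
        (fun a => γ • a) '' {a | IsCorner G q.1 U.1 v a} := by
      ext a
      constructor
      · intro h
        refine ⟨γ⁻¹ • a, (isCorner_smul_iff hq γ U v _).1 ?_, smul_inv_smul _ _⟩
        rwa [smul_inv_smul]
      · rintro ⟨b, hb, rfl⟩
        exact (isCorner_smul_iff hq γ U v b).2 hb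
    change {a | IsCorner G q.1 (γ • U).1 (γ • v) a}.ncard = _
    rw [this, Set.ncard_image_of_injective _ (MulAction.injective γ)]
  have key := orbit_sum_comm hG.free_vertices (faceAction_actsFreely hq hT) hG.rep hG.mk_rep r' hr'
    F hF h1 h2
  have hright : ∀ U, ∑ᶠ v, F v U ≤ 3 := by
    intro U
    refine le_trans (le_of_eq ?_) (ncard_isCorner_le hG hq hT U.2).2
    rw [finsum_eq_sum_of_support_subset _ (hsupp U), Set.ncard_eq_toFinset_card _ (hfin2 U),
      Finset.card_eq_sum_card_fiberwise (f := Prod.fst) (t := (hfin2 U).toFinset.image Prod.fst)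
        (fun d hd => Finset.mem_coe.2 (Finset.mem_image_of_mem _ hd))]
    refine Finset.sum_congr rfl fun v _ => ?_
    rw [← Set.ncard_coe_finset]
    have : ((Finset.filter (fun d : V × V => d.1 = v) (hfin2 U).toFinset : Finset (V × V)) :
        Set (V × V)) = (fun a => (v, a)) '' {a | IsCorner G q.1 U.1 v a} := by
      ext ⟨w, a⟩
      simp only [Finset.coe_filter, Set.Finite.mem_toFinset, Set.mem_ofPred_eq, Set.mem_image,
        Prod.mk.injEq]
      constructor
      · rintro ⟨h, rfl⟩; exact ⟨a, h, rfl, rfl⟩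
      · rintro ⟨b, h, rfl, rfl⟩; exact ⟨h, rfl⟩
    rw [this, Set.ncard_image_of_injective _ (Prod.mk_right_injective v)]
  have hdeg := hG.sum_darts (fun _ => 1)
  simp only [Finset.sum_const, smul_eq_mul, mul_one] at hdeg
  rw [← card_darts hG, hdeg]
  have e1 : ∑ o, (hG.nbr (hG.rep o)).card ≤ ∑ o, (∑ᶠ U, F (hG.rep o) U + 1) :=
    Finset.sum_le_sum fun o _ => degree_le_sum_corners hG hq hT (hG.rep o) (h1 _)
  have e2 : ∑ o' : FaceOrbit hq, ∑ᶠ v, F v (r' o') ≤ ∑ o' : FaceOrbit hq, 3 :=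
    Finset.sum_le_sum fun o' _ => hright _
  rw [Finset.sum_add_distrib, key] at e1
  simp only [Finset.sum_const, smul_eq_mul, mul_one, Finset.card_univ] at e1 e2
  rw [Nat.card_eq_fintype_card, Nat.card_eq_fintype_card]
  exact e1.trans ((Nat.add_le_add_right e2 _).trans (le_of_eq (by ring)))

end Counting

end PeriodicFramework

end

open scoped ContDiff
noncomputable section

namespace PeriodicFramework

/-! ### Euler inequality by duality modulo two. -/

section ModTwo

open Filter Topology

/-- Only the nondegeneracy of the dot product enters, so isotropic vectors do no harm and the bound
is available over `ZMod 2`. -/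
theorem finrank_add_finrank_le_of_dotProduct_eq_zero {K ι : Type*} [Field K] [Fintype ι]
    (W W' : Submodule K (ι → K)) (h : ∀ w ∈ W, ∀ w' ∈ W', w' ⬝ᵥ w = 0) :
    Module.finrank K W + Module.finrank K W' ≤ Fintype.card ι := by
  classical
  rw [← Module.finrank_fintype_fun_eq_card K, ← Subspace.finrank_add_finrank_dualAnnihilator_eq W,
    ← LinearEquiv.finrank_map_eq (dotProductEquiv K ι) W']
  refine Nat.add_le_add_left (Submodule.finrank_mono ?_) _
  rintro _ ⟨w', hw', rfl⟩
  rw [Submodule.mem_dualAnnihilator]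
  exact fun w hw => h w hw w' hw'

variable {V : Type*} {G : SimpleGraph V} {Γ : Subgroup (G ≃g G)} {q : Configuration G Γ}

/-- The midpoint of an edge. -/
def edgeMid (p : V → Plane) (e : G.edgeSet) : Plane :=
  Sym2.lift ⟨fun a b => midpoint ℝ (p a) (p b), fun _ _ => midpoint_comm _ _⟩ e.1

/-- The coboundary modulo two. -/
def coboundary (X : V → ZMod 2) (e : G.edgeSet) : ZMod 2 :=
  Sym2.lift ⟨fun a b => X a + X b, fun _ _ => add_comm _ _⟩ e.1

theorem edge_induction {P : G.edgeSet → Prop} (h : ∀ a b (hab : G.Adj a b), P ⟨s(a, b), hab⟩)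
    (e : G.edgeSet) : P e := by
  obtain ⟨⟨a, b⟩, hab⟩ := e
  exact h a b hab

/-- Around the closed boundary polygon every vertex is counted twice, which is zero modulo two.
Working modulo two avoids orienting edges and faces. -/
theorem finsum_incident_coboundary (hG : IsPeriodicGraph G Γ) (hq : IsPeriodicPlacement G Γ q)
    (hT : IsPseudoTriangulation G q.1) (U : Face G q.1) (X : V → ZMod 2) (y : ZMod 2) :
    (Function.support fun e : G.edgeSet => open Classical in
      if edgeMid q.1 e ∈ closure U.1 then y * coboundary X e else 0).Finite ∧
    ∑ᶠ e : G.edgeSet, (open Classical in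
      if edgeMid q.1 e ∈ closure U.1 then y * coboundary X e else 0) = 0 := by
  classical
  obtain ⟨_, k, c, hk, hinj, hadj, hfr, _⟩ := hT.faces U.1 U.2
  have : NeZero k := ⟨by omega⟩
  let g : ZMod k → G.edgeSet := fun i => ⟨s(c i, c (i + 1)), hadj i⟩
  have hg : Function.Injective g := by
    intro i j hij
    rcases Sym2.eq_iff.1 (congrArg Subtype.val hij) with ⟨h1, -⟩ | ⟨h1, h2⟩
    · exact hinj h1
    -- A side that recurs backwards would force `2 = 0` in `ZMod k`, which `k ≥ 3` excludes.
    · have h3 := hinj h1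
      have h4 := hinj h2
      rw [h3, add_assoc] at h4
      have h5 : ((2 : ℕ) : ZMod k) = 0 := by
        push_cast
        rw [← one_add_one_eq_two]
        exact left_eq_add.1 h4.symm
      rw [ZMod.natCast_eq_zero_iff] at h5
      have := Nat.le_of_dvd two_pos h5
      omega
  have hrange : ∀ e : G.edgeSet, edgeMid q.1 e ∈ closure U.1 ↔ e ∈ Set.range g := by
    refine edge_induction fun a b hab => ⟨fun h => ?_, ?_⟩
    · obtain ⟨i, hi⟩ := mem_edge_of_closure_face hG hq hT.nonCrossing U.2 hadj hfr hab
        (midpoint_mem_openSegment _ _) h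
      exact ⟨i, Subtype.ext hi⟩
    · rintro ⟨i, hi⟩
      exact segment_subset_closure_of_mem hfr (congrArg Subtype.val hi) (midpoint_mem_segment _ _)
  constructor
  · refine (Set.finite_range g).subset fun e he => (hrange e).1 ?_
    by_contra h
    exact he (if_neg h)
  · have e1 : ∀ e : G.edgeSet, (if edgeMid q.1 e ∈ closure U.1 then y * coboundary X e else 0) =
        ∑ᶠ (_ : e ∈ Set.range g), y * coboundary X e := by
      intro e
      rw [finsum_eq_if]
      simp only [hrange]
    rw [finsum_congr e1, finsum_mem_range hg, finsum_eq_sum_of_fintype, ← Finset.mul_sum]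
    have e2 : ∀ i, coboundary X (g i) = X (c i) + X (c (i + 1)) := fun i => rfl
    simp only [e2]
    have e3 : ∑ i, X (c (i + 1)) = ∑ i, X (c i) :=
      Equiv.sum_comp (Equiv.addRight (1 : ZMod k)) (fun i => X (c i))
    rw [Finset.sum_add_distrib, e3, CharTwo.add_self_eq_zero, mul_zero]

theorem edgeMid_smul (hq : IsPeriodicPlacement G Γ q) (γ : Γ) (e : G.edgeSet) :
    edgeMid q.1 (γ • e) - q.2 γ = edgeMid q.1 e := by
  induction e using edge_induction with
  | h a b hab => exact midpoint_smul hq γ a b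

/-- The coboundary modulo two on periodic cochains. -/
def coboundaryMap (hG : IsPeriodicGraph G Γ) (r : EdgeOrbit G Γ → G.edgeSet) :
    ((VertexOrbit G Γ → ZMod 2) × (Fin 2 → ZMod 2)) →ₗ[ZMod 2] (EdgeOrbit G Γ → ZMod 2) :=
  AddMonoidHom.toZModLinearMap 2
    { toFun := fun z β => coboundary (hG.extend z).1 (r β)
      map_zero' := by
        funext β
        induction r β using edge_induction with
        | h a b hab => simp [coboundary, IsPeriodicGraph.extend]
      map_add' := fun z w => by
        funext β
        simp only [Pi.add_apply]
        induction r β using edge_induction with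
        | h a b hab =>
          simp only [coboundary, IsPeriodicGraph.extend, Sym2.lift_mk, Prod.fst_add, Prod.snd_add,
            Pi.add_apply, smul_add, Finset.sum_add_distrib]
          ring }

/-- The sum of a function on face orbits over the two sides of each edge. -/
def sidesMap (hG : IsPeriodicGraph G Γ) (hq : IsPeriodicPlacement G Γ q)
    (hT : IsPseudoTriangulation G q.1) (r : EdgeOrbit G Γ → G.edgeSet) :
    (FaceOrbit hq → ZMod 2) →ₗ[ZMod 2] (EdgeOrbit G Γ → ZMod 2) :=
  letI := faceAction hq
  AddMonoidHom.toZModLinearMap 2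
    { toFun := fun c β => ∑ᶠ U : Face G q.1, open Classical in
        if edgeMid q.1 (r β) ∈ closure U.1 then c (Quotient.mk'' U) else 0
      map_zero' := by funext β; simp
      map_add' := fun c d => by
        classical
        funext β
        have hfin : ∀ c : FaceOrbit hq → ZMod 2, (Function.support fun U : Face G q.1 =>
            if edgeMid q.1 (r β) ∈ closure U.1 then c (Quotient.mk'' U) else 0).Finite := by
          intro c
          have : {U : Face G q.1 | edgeMid q.1 (r β) ∈ closure U.1}.Finite := by
            induction r β using edge_induction with
            | h a b hab => exact finite_faces_at_edge hG hq hT.nonCrossing hab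
          refine this.subset fun U hU => ?_
          by_contra h
          exact hU (if_neg h)
        rw [Pi.add_apply, ← finsum_add_distrib (hfin c) (hfin d)]
        refine finsum_congr fun U => ?_
        by_cases h : edgeMid q.1 (r β) ∈ closure U.1
        · simp only [if_pos h]; rfl
        · simp only [if_neg h, add_zero] }

/-- Double counting of incident edges and faces: a coboundary sums to zero around each face. The
potential may change by a period under `Γ`, which adds the two classes of the torus; its coboundary
is still invariant, since a period enters at both ends of an edge. -/
theorem sidesMap_dotProduct_coboundaryMap (hG : IsPeriodicGraph G Γ)
    (hq : IsPeriodicPlacement G Γ q) (hT : IsPseudoTriangulation G q.1)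
    [Fintype (EdgeOrbit G Γ)] (r : EdgeOrbit G Γ → G.edgeSet)
    (hr : ∀ β, (Quotient.mk'' (r β) : EdgeOrbit G Γ) = β) (c : FaceOrbit hq → ZMod 2)
    (z : (VertexOrbit G Γ → ZMod 2) × (Fin 2 → ZMod 2)) :
    sidesMap hG hq hT r c ⬝ᵥ coboundaryMap hG r z = 0 := by
  classical
  let _ := faceAction hq
  have := finite_faceOrbit hG hq hT
  have := Fintype.ofFinite (FaceOrbit hq)
  obtain ⟨r', hr'⟩ := exists_orbit_section Γ (Face G q.1)
  let F : G.edgeSet → Face G q.1 → ZMod 2 := fun e U =>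
    if edgeMid q.1 e ∈ closure U.1 then c (Quotient.mk'' U) * coboundary (hG.extend z).1 e else 0
  have hF : ∀ (γ : Γ) e U, F (γ • e) (γ • U) = F e U := by
    intro γ e U
    have h1 : edgeMid q.1 (γ • e) ∈ closure (γ • U).1 ↔ edgeMid q.1 e ∈ closure U.1 := by
      rw [← edgeMid_smul hq γ e]
      exact mem_closure_translate q γ U.1 _
    have h2 : coboundary (hG.extend z).1 (γ • e) = coboundary (hG.extend z).1 e := by
      induction e using edge_induction with
      | h a b hab =>
        change (hG.extend z).1 (γ • a) + (hG.extend z).1 (γ • b) =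
          (hG.extend z).1 a + (hG.extend z).1 b
        rw [hG.extend_smul, hG.extend_smul, add_add_add_comm, CharTwo.add_self_eq_zero, add_zero]
    have h3 : (Quotient.mk'' (γ • U) : FaceOrbit hq) = Quotient.mk'' U := mk_smul γ U
    simp only [F, h1, h2, h3]
  have hs1 : ∀ e, (Function.support fun U => F e U).Finite := by
    intro e
    have : {U : Face G q.1 | edgeMid q.1 e ∈ closure U.1}.Finite := by
      induction e using edge_induction with
      | h a b hab => exact finite_faces_at_edge hG hq hT.nonCrossing hab
    refine this.subset fun U hU => ?_
    by_contra h
    exact hU (if_neg h)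
  have key := orbit_sum_comm hG.free_edges (faceAction_actsFreely hq hT) r hr r' hr' F hF hs1
    (fun U => (finsum_incident_coboundary hG hq hT U (hG.extend z).1 _).1)
  rw [Finset.sum_eq_zero (f := fun o' => ∑ᶠ e, F e (r' o')) fun U _ =>
    (finsum_incident_coboundary hG hq hT (r' U) (hG.extend z).1 _).2] at key
  rw [← key]
  refine Finset.sum_congr rfl fun β _ => ?_
  change (∑ᶠ U : Face G q.1, if edgeMid q.1 (r β) ∈ closure U.1 then c (Quotient.mk'' U) else 0) *
    coboundary (hG.extend z).1 (r β) = _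
  rw [finsum_mul']
  · refine finsum_congr fun U => ?_
    simp only [F, ite_mul, zero_mul]
  · have : {U : Face G q.1 | edgeMid q.1 (r β) ∈ closure U.1}.Finite := by
      induction r β using edge_induction with
      | h a b hab => exact finite_faces_at_edge hG hq hT.nonCrossing hab
    refine this.subset fun U hU => ?_
    by_contra h
    exact hU (if_neg h)

theorem const_of_adj_eq {α : Type*} (hG : G.Connected) {X : V → α}
    (h : ∀ a b, G.Adj a b → X a = X b) (u v : V) : X u = X v := by
  obtain ⟨w⟩ := hG.preconnected u v
  induction w with
  | nil => rfl
  | cons hab _ ih => exact (h _ _ hab).trans ih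

/-- A potential with zero coboundary is constant because the graph is connected, and a constant has
zero periods. -/
theorem finrank_ker_coboundaryMap_le (hG : IsPeriodicGraph G Γ) (r : EdgeOrbit G Γ → G.edgeSet)
    (hr : ∀ β, (Quotient.mk'' (r β) : EdgeOrbit G Γ) = β) :
    Module.finrank (ZMod 2) (LinearMap.ker (coboundaryMap hG r)) ≤ 1 := by
  have hle : LinearMap.ker (coboundaryMap hG r) ≤
      Submodule.span (ZMod 2) {((fun _ => 1, 0) :
        (VertexOrbit G Γ → ZMod 2) × (Fin 2 → ZMod 2))} := by
    intro z hz
    rw [LinearMap.mem_ker] at hz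
    set X := (hG.extend z).1 with hX
    have hadj : ∀ a b, G.Adj a b → X a = X b := by
      intro a b hab
      have h1 := congrFun hz (Quotient.mk'' ⟨s(a, b), hab⟩)
      change coboundary X (r (Quotient.mk'' ⟨s(a, b), hab⟩)) = 0 at h1
      obtain ⟨γ, hγ⟩ := exists_smul_of_mk_eq (Γ := Γ) (hr (Quotient.mk'' ⟨s(a, b), hab⟩))
      rw [← hγ] at h1
      change (hG.extend z).1 (γ • a) + (hG.extend z).1 (γ • b) = 0 at h1
      rw [hG.extend_smul, hG.extend_smul, add_add_add_comm, CharTwo.add_self_eq_zero, add_zero] at h1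
      exact CharTwo.add_eq_zero.1 h1
    have hconst := const_of_adj_eq hG.connected hadj
    obtain ⟨v₀⟩ := hG.connected.nonempty
    have h2 : ∀ γ, (hG.extend z).2 γ = 0 := by
      intro γ
      have h := hG.extend_smul z γ v₀
      rw [← hX, hconst (γ • v₀) v₀] at h
      exact left_eq_add.1 h
    have h3 := hG.restrict_extend z
    refine Submodule.mem_span_singleton.2 ⟨X v₀, ?_⟩
    rw [← h3]
    refine Prod.ext (funext fun o => ?_) (funext fun j => ?_)
    · simp only [Prod.smul_fst, Pi.smul_apply, smul_eq_mul, mul_one]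
      exact hconst _ _
    · simp only [Prod.smul_snd, Pi.smul_apply, Pi.zero_apply, smul_zero]
      exact (h2 _).symm
  refine (Submodule.finrank_mono hle).trans ?_
  exact finrank_span_le_card _ |>.trans (by simp)

/-- In a kernel element the values on two different faces along an edge sum to zero modulo two, so
they agree; by `face_function_const` the function is constant. -/
theorem finrank_ker_sidesMap_le (hG : IsPeriodicGraph G Γ) (hq : IsPeriodicPlacement G Γ q)
    (hT : IsPseudoTriangulation G q.1) (r : EdgeOrbit G Γ → G.edgeSet)
    (hr : ∀ β, (Quotient.mk'' (r β) : EdgeOrbit G Γ) = β) :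
    Module.finrank (ZMod 2) (LinearMap.ker (sidesMap hG hq hT r)) ≤ 1 := by
  classical
  let _ := faceAction hq
  have := finite_faceOrbit hG hq hT
  have := Fintype.ofFinite (FaceOrbit hq)
  have hle : LinearMap.ker (sidesMap hG hq hT r) ≤
      Submodule.span (ZMod 2) {(fun _ => 1 : FaceOrbit hq → ZMod 2)} := by
    intro c hc
    rw [LinearMap.mem_ker] at hc
    have hsides : ∀ e : G.edgeSet, ∑ᶠ U : Face G q.1,
        (if edgeMid q.1 e ∈ closure U.1 then c (Quotient.mk'' U) else 0) = 0 := by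
      intro e
      have h1 := congrFun hc (Quotient.mk'' e)
      change ∑ᶠ U : Face G q.1, (if edgeMid q.1 (r (Quotient.mk'' e)) ∈ closure U.1
        then c (Quotient.mk'' U) else 0) = 0 at h1
      obtain ⟨γ, hγ⟩ := exists_smul_of_mk_eq (Γ := Γ) (hr (Quotient.mk'' e)).symm
      refine Eq.trans ?_ h1
      rw [← finsum_comp_equiv (MulAction.toPerm γ)]
      refine finsum_congr fun U => ?_
      have h2 : edgeMid q.1 e ∈ closure (γ • U).1 ↔
          edgeMid q.1 (r (Quotient.mk'' e)) ∈ closure U.1 := by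
        conv_lhs => rw [← hγ]
        rw [← edgeMid_smul hq γ (r (Quotient.mk'' e))]
        exact mem_closure_translate q γ U.1 _
      have h3 : (Quotient.mk'' (γ • U) : FaceOrbit hq) = Quotient.mk'' U := mk_smul γ U
      simp only [MulAction.toPerm_apply, h2, h3]
    let f : Set Plane → ZMod 2 := fun S =>
      if h : IsFace G q.1 S then c (Quotient.mk'' ⟨S, h⟩) else 0
    have hfU : ∀ U : Face G q.1, f U.1 = c (Quotient.mk'' U) := fun U => dif_pos U.2
    have hf : ∀ a b, G.Adj a b → ∀ U U', IsFace G q.1 U → IsFace G q.1 U' →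
        midpoint ℝ (q.1 a) (q.1 b) ∈ closure U → midpoint ℝ (q.1 a) (q.1 b) ∈ closure U' →
        f U = f U' := by
      intro a b hab U U' hU hU' hm hm'
      by_cases heq : U = U'
      · rw [heq]
      obtain ⟨U₁, U₂, h1, h2, -, -, N, hN, h⟩ :=
        exists_two_faces hG hq hT.nonCrossing hab (midpoint_mem_openSegment (q.1 a) (q.1 b))
      have hcl : ∀ W, IsFace G q.1 W → midpoint ℝ (q.1 a) (q.1 b) ∈ closure W →
          W = U₁ ∨ W = U₂ := fun W hW hm => h W hW (by
        rw [mem_closure_iff_nhds] at hm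
        rw [Set.inter_comm]; exact hm N hN)
      have hcl' : ∀ W, IsFace G q.1 W → midpoint ℝ (q.1 a) (q.1 b) ∈ closure W →
          W = U ∨ W = U' := by
        intro W hW hWm
        have a1 := hcl U hU hm
        have a2 := hcl U' hU' hm'
        have a3 := hcl W hW hWm
        grind
      have hs := hsides ⟨s(a, b), hab⟩
      change ∑ᶠ W : Face G q.1, (if midpoint ℝ (q.1 a) (q.1 b) ∈ closure W.1
        then c (Quotient.mk'' W) else 0) = 0 at hs
      rw [finsum_eq_sum_of_support_subset (s := {⟨U, hU⟩, ⟨U', hU'⟩})] at hs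
      · rw [Finset.sum_pair (fun e => heq (congrArg Subtype.val e)), if_pos hm, if_pos hm',
          CharTwo.add_eq_zero] at hs
        rw [hfU ⟨U, hU⟩, hfU ⟨U', hU'⟩]
        exact hs
      · intro W hW
        have hWm : midpoint ℝ (q.1 a) (q.1 b) ∈ closure W.1 := by
          by_contra h
          exact hW (if_neg h)
        rw [Finset.mem_coe, Finset.mem_insert, Finset.mem_singleton]
        rcases hcl' W.1 W.2 hWm with h | h
        · exact Or.inl (Subtype.ext h)
        · exact Or.inr (Subtype.ext h)
    rw [Submodule.mem_span_singleton]
    by_cases hne : Nonempty (Face G q.1)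
    · obtain ⟨U₀⟩ := hne
      refine ⟨f U₀.1, ?_⟩
      funext o
      induction o using Quotient.inductionOn' with
      | h U =>
        rw [← hfU U, face_function_const hG hq hT f hf U.2 U₀.2]
        simp
    · refine ⟨0, ?_⟩
      funext o
      induction o using Quotient.inductionOn' with
      | h U => exact absurd ⟨U⟩ hne
  refine (Submodule.finrank_mono hle).trans ?_
  exact finrank_span_le_card _ |>.trans (by simp)

/-- The inequality half of Euler's formula on the quotient torus. -/
theorem card_faceOrbit_add_le (hG : IsPeriodicGraph G Γ) (hq : IsPeriodicPlacement G Γ q)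
    (hT : IsPseudoTriangulation G q.1) :
    Nat.card (FaceOrbit hq) + Nat.card (VertexOrbit G Γ) ≤ Nat.card (EdgeOrbit G Γ) := by
  classical
  have := hG.finite_vertices
  have := Fintype.ofFinite (VertexOrbit G Γ)
  have := hG.finite_edges
  have := Fintype.ofFinite (EdgeOrbit G Γ)
  have := finite_faceOrbit hG hq hT
  have := Fintype.ofFinite (FaceOrbit hq)
  obtain ⟨r, hr⟩ := exists_orbit_section Γ G.edgeSet
  have h1 := (sidesMap hG hq hT r).finrank_range_add_finrank_ker
  have h2 := (coboundaryMap hG r).finrank_range_add_finrank_ker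
  have h3 := finrank_ker_sidesMap_le hG hq hT r hr
  have h4 := finrank_ker_coboundaryMap_le hG r hr
  have h5 := finrank_add_finrank_le_of_dotProduct_eq_zero (LinearMap.range (coboundaryMap hG r))
    (LinearMap.range (sidesMap hG hq hT r)) (by
      rintro _ ⟨z, rfl⟩ _ ⟨c, rfl⟩
      exact sidesMap_dotProduct_coboundaryMap hG hq hT r hr c z)
  rw [Module.finrank_fintype_fun_eq_card] at h1
  rw [Module.finrank_prod, Module.finrank_fintype_fun_eq_card,
    Module.finrank_fintype_fun_eq_card, Fintype.card_fin] at h2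
  rw [Nat.card_eq_fintype_card, Nat.card_eq_fintype_card, Nat.card_eq_fintype_card]
  -- The two orthogonal ranges have ranks at least `f - 1` and `(v + 2) - 1`, together at most `e`.
  omega

/-- A pointed periodic pseudo-triangulation has at least twice as many edge orbits as vertex
orbits. -/
theorem two_mul_card_vertexOrbit_le (hG : IsPeriodicGraph G Γ) (hq : IsPeriodicPlacement G Γ q)
    (hT : IsPseudoTriangulation G q.1) :
    2 * Nat.card (VertexOrbit G Γ) ≤ Nat.card (EdgeOrbit G Γ) := by
  have h1 := card_faceOrbit_add_le hG hq hT
  have h2 := two_mul_card_edgeOrbit_le hG hq hT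
  -- Eliminate `f`: `2e ≤ v + 3f ≤ v + 3(e - v)`.
  omega

end ModTwo

end PeriodicFramework

end

open scoped ContDiff
noncomputable section

namespace PeriodicFramework

/-! ### Independence of edge lengths and period area. -/

section Rigidity

variable {V : Type*} {G : SimpleGraph V} {Γ : Subgroup (G ≃g G)} {q : Configuration G Γ}

/-- Configurations in terms of representatives and generators. -/
abbrev Coordinates (G : SimpleGraph V) (Γ : Subgroup (G ≃g G)) : Type _ :=
  (VertexOrbit G Γ → Plane) × (Fin 2 → Plane)

/-- The equivariant extension as a real linear map. -/
def extendLinear (hG : IsPeriodicGraph G Γ) : Coordinates G Γ →ₗ[ℝ] Configuration G Γ where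
  toFun := hG.extend
  map_add' z w := by
    refine Prod.ext (funext fun v => ?_) (funext fun γ => ?_)
    · simp only [IsPeriodicGraph.extend, Prod.fst_add, Prod.snd_add, Pi.add_apply, smul_add,
        Finset.sum_add_distrib]
      abel
    · simp only [IsPeriodicGraph.extend, Prod.snd_add, Pi.add_apply, smul_add,
        Finset.sum_add_distrib]
  map_smul' a z := by
    refine Prod.ext (funext fun v => ?_) (funext fun γ => ?_)
    · simp only [IsPeriodicGraph.extend, Prod.smul_fst, Prod.smul_snd, Pi.smul_apply, smul_add,
        Finset.smul_sum, RingHom.id_apply, smul_comm a]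
    · simp only [IsPeriodicGraph.extend, Prod.smul_snd, Pi.smul_apply,
        Finset.smul_sum, RingHom.id_apply, smul_comm a]

theorem extendLinear_injective (hG : IsPeriodicGraph G Γ) :
    Function.Injective (extendLinear hG) := fun z w h => by
  rw [← hG.restrict_extend z, ← hG.restrict_extend w]
  exact congrArg hG.restrict h

/-- First-order changes of (half) the squared lengths of the representative edges. -/
def rigidityMap (hG : IsPeriodicGraph G Γ) (q : Configuration G Γ) (r : EdgeOrbit G Γ → V × V) :
    Coordinates G Γ →ₗ[ℝ] (EdgeOrbit G Γ → ℝ) where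
  toFun z β := inner ℝ (dartVec q.1 (r β)) (dartVec (extendLinear hG z).1 (r β))
  map_add' z w := by
    funext β
    rw [Pi.add_apply, ← inner_add_right, map_add]
    congr 1
    simp only [dartVec, Prod.fst_add, Pi.add_apply]
    abel
  map_smul' a z := by
    funext β
    rw [Pi.smul_apply, smul_eq_mul, RingHom.id_apply, ← real_inner_smul_right, map_smul]
    congr 1
    simp only [dartVec, Prod.smul_fst, Pi.smul_apply, smul_sub]

theorem rigidityMap_apply (hG : IsPeriodicGraph G Γ) (r : EdgeOrbit G Γ → V × V)
    (z : Coordinates G Γ) (β : EdgeOrbit G Γ) :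
    rigidityMap hG q r z β = inner ℝ (dartVec q.1 (r β)) (dartVec (hG.extend z).1 (r β)) := rfl

/-- The trace of the linear map that a motion induces on the periods. -/
def periodTrace (hG : IsPeriodicGraph G Γ) (hq : IsPeriodicPlacement G Γ q) :
    Coordinates G Γ →ₗ[ℝ] ℝ :=
  LinearMap.trace ℝ Plane ∘ₗ ((periodBasis hG hq).constr ℝ).toLinearMap ∘ₗ LinearMap.snd ℝ _ _

/-- The motion induced by a linear map of the plane. -/
def linearMotion (hG : IsPeriodicGraph G Γ) (q : Configuration G Γ) (A : Plane →ₗ[ℝ] Plane) :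
    Coordinates G Γ :=
  hG.restrict (fun v => A (q.1 v), fun γ => A (q.2 γ))

theorem extend_linearMotion (hG : IsPeriodicGraph G Γ) (hq : IsPeriodicPlacement G Γ q)
    (A : Plane →ₗ[ℝ] Plane) :
    hG.extend (linearMotion hG q A) = (fun v => A (q.1 v), fun γ => A (q.2 γ)) :=
  hG.extend_restrict _ (fun γ δ => by simp only [hq.map_mul, map_add])
    (fun γ v => by simp only [hq.equivariant, map_add])

theorem periodTrace_linearMotion (hG : IsPeriodicGraph G Γ) (hq : IsPeriodicPlacement G Γ q)
    (A : Plane →ₗ[ℝ] Plane) :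
    periodTrace hG hq (linearMotion hG q A) = LinearMap.trace ℝ Plane A := by
  change LinearMap.trace ℝ Plane ((periodBasis hG hq).constr ℝ fun j => A (q.2 (hG.basis j))) = _
  congr 1
  refine (periodBasis hG hq).ext fun j => ?_
  rw [Module.Basis.constr_basis, periodBasis_apply]

theorem dartVec_swap (p : V → Plane) (d : V × V) : dartVec p d.swap = -dartVec p d := by
  simp [dartVec]

theorem IsPeriodicPlacement.dartVec_smul (hq : IsPeriodicPlacement G Γ q) (γ : Γ) (u v : V) :
    dartVec q.1 (γ • u, γ • v) = dartVec q.1 (u, v) := hq.sub_smul γ u v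

theorem dartVec_extend_smul (hG : IsPeriodicGraph G Γ) (z : Coordinates G Γ) (γ : Γ) (u v : V) :
    dartVec (hG.extend z).1 (γ • u, γ • v) = dartVec (hG.extend z).1 (u, v) := by
  simp only [dartVec, hG.extend_smul, add_sub_add_right_eq_sub]

/-- Virtual work of an edge weight along an invariant displacement. -/
theorem sum_darts_work (hG : IsPeriodicGraph G Γ) (hq : IsPeriodicPlacement G Γ q)
    [Fintype (VertexOrbit G Γ)] {σ : V → V → ℝ} (hs : ∀ u v, σ u v = σ v u)
    (hi : ∀ (γ : Γ) u v, σ (γ • u) (γ • v) = σ u v) (Z : V → Plane)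
    (hZ : ∀ (γ : Γ) v, Z (γ • v) = Z v) :
    ∑ d ∈ hG.darts, σ d.1 d.2 * inner ℝ (dartVec q.1 d) (dartVec Z d) =
      -2 * ∑ o, inner ℝ (∑ v ∈ hG.nbr (hG.rep o), σ (hG.rep o) v • (q.1 v - q.1 (hG.rep o)))
        (Z (hG.rep o)) := by
  have h1 : ∑ d ∈ hG.darts, σ d.1 d.2 * inner ℝ (dartVec q.1 d) (Z d.2) =
      -∑ d ∈ hG.darts, σ d.1 d.2 * inner ℝ (dartVec q.1 d) (Z d.1) := by
    rw [hG.sum_darts_swap (fun d => σ d.1 d.2 * inner ℝ (dartVec q.1 d) (Z d.2)) (fun γ u v => by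
      simp only [hi, hZ, hq.dartVec_smul]), ← Finset.sum_neg_distrib]
    refine Finset.sum_congr rfl fun d _ => ?_
    rw [dartVec_swap, inner_neg_left, Prod.fst_swap, Prod.snd_swap, hs d.2, mul_neg]
  have h2 : ∑ d ∈ hG.darts, σ d.1 d.2 * inner ℝ (dartVec q.1 d) (dartVec Z d) =
      ∑ d ∈ hG.darts, σ d.1 d.2 * inner ℝ (dartVec q.1 d) (Z d.2) -
      ∑ d ∈ hG.darts, σ d.1 d.2 * inner ℝ (dartVec q.1 d) (Z d.1) := by
    rw [← Finset.sum_sub_distrib]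
    refine Finset.sum_congr rfl fun d _ => ?_
    rw [dartVec, dartVec, inner_sub_right, mul_sub]
  rw [h2, h1, hG.sum_darts]
  have h3 : ∀ o, ∑ v ∈ hG.nbr (hG.rep o), σ (hG.rep o) v *
      inner ℝ (dartVec q.1 (hG.rep o, v)) (Z (hG.rep o)) =
      inner ℝ (∑ v ∈ hG.nbr (hG.rep o), σ (hG.rep o) v • (q.1 v - q.1 (hG.rep o)))
        (Z (hG.rep o)) := by
    intro o
    rw [sum_inner]
    refine Finset.sum_congr rfl fun v _ => ?_
    rw [real_inner_smul_left]; rfl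
  simp only [h3]
  ring

/-- The double sum is twice the determinant of the stress tensor; this connects the hypothesis of
`stress_eq_zero` with the moments of the stress. -/
theorem sum_sum_cross_sq {ι : Type*} (s : Finset ι) (σ : ι → ℝ) (u : ι → Plane) :
    ∑ d ∈ s, ∑ e ∈ s, σ d * σ e * cross (u d) (u e) ^ 2 =
      2 * (∑ d ∈ s, σ d * (u d 0 * u d 0)) * (∑ d ∈ s, σ d * (u d 1 * u d 1)) -
        2 * (∑ d ∈ s, σ d * (u d 0 * u d 1)) ^ 2 := by
  have e : ∀ d e, σ d * σ e * cross (u d) (u e) ^ 2 =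
      (σ d * (u d 0 * u d 0)) * (σ e * (u e 1 * u e 1)) +
      (σ d * (u d 1 * u d 1)) * (σ e * (u e 0 * u e 0)) -
      2 * ((σ d * (u d 0 * u d 1)) * (σ e * (u e 0 * u e 1))) := by
    intro d e
    simp only [cross]; ring
  simp only [e, Finset.sum_sub_distrib, Finset.sum_add_distrib, ← Finset.mul_sum,
    ← Finset.sum_mul]
  ring

/-- The weight on oriented edges given by a function on edge orbits. -/
def orbitWeight (s : EdgeOrbit G Γ → ℝ) (u v : V) : ℝ := open Classical in
  if h : G.Adj u v then s (Quotient.mk'' ⟨s(u, v), h⟩) else 0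

theorem orbitWeight_symm (s : EdgeOrbit G Γ → ℝ) (u v : V) :
    orbitWeight s u v = orbitWeight s v u := by
  unfold orbitWeight
  by_cases h : G.Adj u v
  · rw [dif_pos h, dif_pos h.symm]
    congr 2
    exact Subtype.ext Sym2.eq_swap
  · rw [dif_neg h, dif_neg fun h' => h h'.symm]

theorem orbitWeight_smul (s : EdgeOrbit G Γ → ℝ) (γ : Γ) (u v : V) :
    orbitWeight s (γ • u) (γ • v) = orbitWeight s u v := by
  unfold orbitWeight
  by_cases h : G.Adj u v
  · rw [dif_pos h, dif_pos ((adj_smul_iff γ).2 h)]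
    congr 1
    exact mk_smul γ (⟨s(u, v), h⟩ : G.edgeSet)
  · rw [dif_neg h, dif_neg fun h' => h ((adj_smul_iff γ).1 h')]

theorem orbitWeight_edge (s : EdgeOrbit G Γ → ℝ) (r : EdgeOrbit G Γ → V × V)
    (hr : ∀ β, G.Adj (r β).1 (r β).2)
    (hr' : ∀ β, (Quotient.mk'' (⟨s((r β).1, (r β).2), hr β⟩ : G.edgeSet) : EdgeOrbit G Γ) = β)
    (β : EdgeOrbit G Γ) : orbitWeight s (r β).1 (r β).2 = s β := by
  rw [orbitWeight, dif_pos (hr β), hr']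

theorem sum_orbitWeight (hG : IsPeriodicGraph G Γ) [Fintype (EdgeOrbit G Γ)]
    (s : EdgeOrbit G Γ → ℝ) (r : EdgeOrbit G Γ → V × V)
    (hr : ∀ β, G.Adj (r β).1 (r β).2)
    (hr' : ∀ β, (Quotient.mk'' (⟨s((r β).1, (r β).2), hr β⟩ : G.edgeSet) : EdgeOrbit G Γ) = β)
    (H : V × V → ℝ) (hH : ∀ (γ : Γ) u v, H (γ • u, γ • v) = H (u, v))
    (hsw : ∀ d : V × V, H d.swap = H d) :
    ∑ d ∈ hG.darts, orbitWeight s d.1 d.2 * H d = 2 * ∑ β, s β * H (r β) := by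
  rw [hG.sum_darts_eq_sum_edges r hr hr' (fun d => orbitWeight s d.1 d.2 * H d) (fun γ u v => by
    simp only [orbitWeight_smul, hH]), Finset.mul_sum]
  refine Finset.sum_congr rfl fun β _ => ?_
  rw [Prod.fst_swap, Prod.snd_swap, hsw, orbitWeight_symm s (r β).2, orbitWeight_edge s r hr hr']
  ring

/-- The edge lengths and the area of a period parallelogram of a pseudo-triangulation are
independent to first order. -/
theorem rigidityMap_prod_surjective (hG : IsPeriodicGraph G Γ) (hq : IsPeriodicPlacement G Γ q)
    (hT : IsPseudoTriangulation G q.1) (r : EdgeOrbit G Γ → V × V)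
    (hr : ∀ β, G.Adj (r β).1 (r β).2)
    (hr' : ∀ β, (Quotient.mk'' (⟨s((r β).1, (r β).2), hr β⟩ : G.edgeSet) : EdgeOrbit G Γ) = β) :
    Function.Surjective ((rigidityMap hG q r).prod (periodTrace hG hq)) := by
  classical
  have := hG.finite_vertices
  have := Fintype.ofFinite (VertexOrbit G Γ)
  have := hG.finite_edges
  have := Fintype.ofFinite (EdgeOrbit G Γ)
  rw [← LinearMap.range_eq_top]
  by_contra hne
  -- A nonzero functional vanishing on the range: its coefficients are a candidate stress `s` on the
  -- edge orbits and a multiplier `l` of the trace.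
  obtain ⟨f, hf0, hf⟩ := Submodule.exists_le_ker_of_lt_top _ (lt_top_iff_ne_top.2 hne)
  set s : EdgeOrbit G Γ → ℝ := fun β => f (Pi.single β 1, 0) with hs
  set l : ℝ := f (0, 1) with hl
  have hfe : ∀ x t, f (x, t) = ∑ β, s β * x β + l * t := by
    intro x t
    have : (x, t) = ∑ β, x β • ((Pi.single β 1, 0) : (EdgeOrbit G Γ → ℝ) × ℝ) + t • (0, 1) := by
      refine Prod.ext (funext fun β => ?_) ?_
      · simp [Prod.fst_sum, Finset.sum_apply, Pi.single_apply]
      · simp [Prod.snd_sum]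
    rw [this, map_add, map_sum, map_smul, smul_eq_mul, mul_comm t]
    congr 1
    refine Finset.sum_congr rfl fun β _ => ?_
    rw [map_smul, smul_eq_mul, mul_comm]
  have hzero : ∀ z, ∑ β, s β * rigidityMap hG q r z β + l * periodTrace hG hq z = 0 := by
    intro z
    rw [← hfe]
    exact hf ⟨z, rfl⟩
  have hwork : ∀ z, ∑ d ∈ hG.darts, orbitWeight s d.1 d.2 *
      inner ℝ (dartVec q.1 d) (dartVec (hG.extend z).1 d) = -2 * (l * periodTrace hG hq z) := by
    intro z
    rw [sum_orbitWeight hG s r hr hr' _ (fun γ u v => by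
      rw [hq.dartVec_smul, dartVec_extend_smul]) (fun d => by
      rw [dartVec_swap, dartVec_swap, inner_neg_neg])]
    have h := hzero z
    simp only [rigidityMap_apply] at h
    linarith
  have heqr : ∀ o, ∑ v ∈ hG.nbr (hG.rep o),
      orbitWeight s (hG.rep o) v • (q.1 v - q.1 (hG.rep o)) = 0 := by
    intro o
    set x := ∑ v ∈ hG.nbr (hG.rep o), orbitWeight s (hG.rep o) v • (q.1 v - q.1 (hG.rep o)) with hx
    -- Displace the orbit `o` alone, with fixed periods, along its own residual force `x`: the work
    -- is a multiple of `⟨x, x⟩`.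
    have h1 := hwork (Pi.single o x, 0)
    have htr : periodTrace hG hq (Pi.single o x, 0) = 0 := by
      simp [periodTrace]
    rw [htr, sum_darts_work hG hq (orbitWeight_symm s) (orbitWeight_smul s) _ (fun γ v => by
      rw [hG.extend_smul]; simp [IsPeriodicGraph.extend])] at h1
    have h2 : ∀ o', (hG.extend (Pi.single o x, 0)).1 (hG.rep o') =
        (Pi.single o x : VertexOrbit G Γ → Plane) o' := fun o' =>
      congrFun (congrArg Prod.fst (hG.restrict_extend (Pi.single o x, (0 : Fin 2 → Plane)))) o'
    simp only [h2] at h1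
    rw [Finset.sum_eq_single o (fun o' _ ho => by
      rw [Pi.single_eq_of_ne ho, inner_zero_right]) (by simp), Pi.single_eq_same, ← hx] at h1
    have h3 : (inner ℝ x x : ℝ) = 0 := by linarith
    exact inner_self_eq_zero.1 h3
  have hσ : IsStressWeight hG q.1 (orbitWeight s) :=
    { support := fun u v h => dif_neg h
      symm := orbitWeight_symm s
      invariant := orbitWeight_smul s
      equilibrium := fun u => by
        obtain ⟨γ, hγ⟩ : ∃ γ : Γ, γ • hG.rep (Quotient.mk'' u) = u := ⟨_, hG.shift_smul_rep u⟩
        rw [← heqr (Quotient.mk'' u), ← hγ]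
        refine Finset.sum_bij (fun v _ => γ⁻¹ • v) ?_ ?_ ?_ ?_
        · intro v hv
          rw [← hG.smul_mem_nbr γ]
          rw [mk_smul, hG.mk_rep]
          simpa using hv
        · intro a _ b _ h
          exact MulAction.injective _ h
        · intro v hv
          refine ⟨γ • v, ?_, by simp⟩
          rw [hG.smul_mem_nbr]
          rwa [mk_smul, hG.mk_rep] at hv
        · intro v hv
          have e1 := orbitWeight_smul s γ (hG.rep (Quotient.mk'' u)) (γ⁻¹ • v)
          have e2 := hq.sub_smul γ (hG.rep (Quotient.mk'' u)) (γ⁻¹ • v)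
          rw [smul_inv_smul] at e1 e2
          rw [mk_smul, hG.mk_rep, e1, e2] }
  -- Testing with the motions induced by linear maps: the stress tensor paired with `A` is a
  -- multiple of the trace of `A`. So the tensor is `-2 * l` times the identity, and its determinant
  -- `4 * l ^ 2` is nonnegative whatever the sign of `l`.
  have hA : ∀ A : Plane →ₗ[ℝ] Plane, ∑ d ∈ hG.darts, orbitWeight s d.1 d.2 *
      inner ℝ (dartVec q.1 d) (A (dartVec q.1 d)) = -2 * (l * LinearMap.trace ℝ Plane A) := by
    intro A
    rw [← periodTrace_linearMotion hG hq, ← hwork, extend_linearMotion hG hq]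
    simp only [dartVec, map_sub]
  have hT2 : ∀ i j : Fin 2, ∑ d ∈ hG.darts, orbitWeight s d.1 d.2 *
      (dartVec q.1 d i * dartVec q.1 d j) = -2 * (l * if i = j then 1 else 0) := by
    intro i j
    have h := hA ((EuclideanSpace.proj i : Plane →L[ℝ] ℝ).toLinearMap.smulRight
      (EuclideanSpace.single j (1 : ℝ)))
    rw [LinearMap.trace_eq_sum_inner _ (EuclideanSpace.basisFun (Fin 2) ℝ)] at h
    convert h using 3
    · simp [real_inner_smul_right, EuclideanSpace.inner_single_right]
    · fin_cases i <;> fin_cases j <;> simp [Fin.sum_univ_two, EuclideanSpace.inner_single_right]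
  have hσ0 := stress_eq_zero hG hq hT.nonCrossing hT.pointed hσ (by
    rw [sum_sum_cross_sq hG.darts (fun d => orbitWeight s d.1 d.2) (dartVec q.1), hT2, hT2, hT2]
    simp only [if_true, zero_ne_one, if_false, mul_one, mul_zero]
    nlinarith [sq_nonneg l])
  have hs0 : ∀ β, s β = 0 := fun β => by
    rw [← orbitWeight_edge s r hr hr' β, hσ0]
  have hl0 : l = 0 := by
    have := hT2 0 0
    simpa [hσ0] using this
  refine hf0 (LinearMap.ext fun x => ?_)
  rw [← Prod.mk.eta (p := x), hfe]
  simp [hs0, hl0]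

end Rigidity

end PeriodicFramework

end

open scoped ContDiff
noncomputable section

namespace PeriodicFramework

/-! ### Dimension of the space of flexes. -/

section Flexes

variable {V : Type*} {G : SimpleGraph V} {Γ : Subgroup (G ≃g G)} {q : Configuration G Γ}

theorem dart_induction {r : EdgeOrbit G Γ → V × V} {hr : ∀ β, G.Adj (r β).1 (r β).2}
    (hr' : ∀ β, (Quotient.mk'' (⟨s((r β).1, (r β).2), hr β⟩ : G.edgeSet) : EdgeOrbit G Γ) = β)
    {P : V → V → Prop} (hsmul : ∀ (γ : Γ) u v, P u v → P (γ • u) (γ • v))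
    (hswap : ∀ u v, P u v → P v u) (h : ∀ β, P (r β).1 (r β).2) {a b : V} (hab : G.Adj a b) :
    P a b := by
  obtain ⟨γ, hγ⟩ := exists_smul_of_mk_eq (Γ := Γ) (hr' (Quotient.mk'' ⟨s(a, b), hab⟩)).symm
  have hγ' : s(γ • (r (Quotient.mk'' ⟨s(a, b), hab⟩)).1, γ • (r (Quotient.mk'' ⟨s(a, b), hab⟩)).2) =
    s(a, b) := congrArg Subtype.val hγ
  have h0 := hsmul γ _ _ (h (Quotient.mk'' ⟨s(a, b), hab⟩))
  generalize r (Quotient.mk'' ⟨s(a, b), hab⟩) = d at h0 hγ'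
  rcases Sym2.eq_iff.1 hγ' with ⟨h1, h2⟩ | ⟨h1, h2⟩
  · exact h1 ▸ h2 ▸ h0
  · exact hswap _ _ (h1 ▸ h2 ▸ h0)

theorem infinitesimalMotions_eq_map (hG : IsPeriodicGraph G Γ) (hq : IsPeriodicPlacement G Γ q)
    (r : EdgeOrbit G Γ → V × V) (hr : ∀ β, G.Adj (r β).1 (r β).2)
    (hr' : ∀ β, (Quotient.mk'' (⟨s((r β).1, (r β).2), hr β⟩ : G.edgeSet) : EdgeOrbit G Γ) = β) :
    infinitesimalMotions G Γ q = (LinearMap.ker (rigidityMap hG q r)).map (extendLinear hG) := by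
  ext w
  constructor
  · rintro ⟨h1, h2, h3⟩
    refine ⟨hG.restrict w, ?_, hG.extend_restrict w h1 h2⟩
    rw [SetLike.mem_coe, LinearMap.mem_ker]
    funext β
    rw [rigidityMap_apply, hG.extend_restrict w h1 h2]
    exact h3 _ _ (hr β)
  · rintro ⟨z, hz, rfl⟩
    refine ⟨hG.extend_mul z, hG.extend_smul z, fun u v huv => ?_⟩
    refine dart_induction (P := fun u v => inner ℝ (q.1 v - q.1 u)
      ((hG.extend z).1 v - (hG.extend z).1 u) = 0) hr' (fun γ u v h => ?_) (fun u v h => ?_)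
      (fun β => congrFun hz β) huv
    · rw [hq.sub_smul, hG.extend_smul, hG.extend_smul, add_sub_add_right_eq_sub]
      exact h
    · rw [← neg_sub, ← neg_sub ((hG.extend z).1 v), inner_neg_neg]
      exact h

theorem finrank_map_extendLinear (hG : IsPeriodicGraph G Γ) (K : Submodule ℝ (Coordinates G Γ)) :
    Module.finrank ℝ (K.map (extendLinear hG)) = Module.finrank ℝ K :=
  ((Submodule.equivMapOfInjective _ (extendLinear_injective hG) K).finrank_eq).symm

theorem rot_add (x y : Plane) : rot (x + y) = rot x + rot y := by
  apply plane_ext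
  · simp only [rot_zero, PiLp.add_apply]; ring
  · simp only [rot_one, PiLp.add_apply]

theorem rot_smul (a : ℝ) (x : Plane) : rot (a • x) = a • rot x := by
  apply plane_ext
  · simp only [rot_zero, PiLp.smul_apply, smul_eq_mul]; ring
  · simp only [rot_one, PiLp.smul_apply]

theorem inner_rot_self (x : Plane) : inner ℝ (rot x) x = 0 := by
  rw [inner_plane, rot_zero, rot_one]; ring

theorem rot_ne_zero {x : Plane} (hx : x ≠ 0) : rot x ≠ 0 := by
  intro h
  refine hx (plane_ext ?_ ?_)
  · rw [← rot_one, h]; rfl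
  · have := rot_zero x
    rw [h] at this
    simpa using this.symm

/-- The quarter turn. -/
def rotLinear : Plane →ₗ[ℝ] Plane where
  toFun := rot
  map_add' := rot_add
  map_smul' := rot_smul

theorem eq_smul_rot_of_skew (A : Plane →ₗ[ℝ] Plane) (hA : ∀ x, inner ℝ (A x) x = 0) (x : Plane) :
    A x = A (EuclideanSpace.single 0 1) 1 • rot x := by
  set e₀ : Plane := EuclideanSpace.single 0 1
  set e₁ : Plane := EuclideanSpace.single 1 1
  have h0 : A e₀ 0 = 0 := by simpa [inner_plane, e₀] using hA e₀
  have h1 : A e₁ 1 = 0 := by simpa [inner_plane, e₁] using hA e₁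
  have h2 : A e₁ 0 = -A e₀ 1 := by
    have := hA (e₀ + e₁)
    rw [map_add, inner_plane] at this
    simp [e₀, e₁] at this
    simp only [e₀, e₁] at h0 h1 ⊢
    linarith
  have hx : x = x 0 • e₀ + x 1 • e₁ := by
    apply plane_ext <;> simp [e₀, e₁]
  have hAx : A x = x 0 • A e₀ + x 1 • A e₁ := by
    conv_lhs => rw [hx]
    rw [map_add, map_smul, map_smul]
  rw [hAx]
  apply plane_ext
  · simp only [PiLp.add_apply, PiLp.smul_apply, smul_eq_mul, rot_zero, h0, h2]; ring
  · simp only [PiLp.add_apply, PiLp.smul_apply, smul_eq_mul, rot_one, h1]; ring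

/-- The trivial motion with angular velocity `a` and translation velocity `b`. -/
def trivialMap (q : Configuration G Γ) : ℝ × Plane →ₗ[ℝ] Configuration G Γ where
  toFun x := (fun v => x.1 • rot (q.1 v) + x.2, fun γ => x.1 • rot (q.2 γ))
  map_add' x y := by
    refine Prod.ext (funext fun v => ?_) (funext fun γ => ?_)
    · simp only [Prod.fst_add, Prod.snd_add, Pi.add_apply, add_smul]; abel
    · simp only [Prod.fst_add, Prod.snd_add, Pi.add_apply, add_smul]
  map_smul' a x := by
    refine Prod.ext (funext fun v => ?_) (funext fun γ => ?_)
    · simp only [Prod.smul_fst, Prod.smul_snd, Pi.smul_apply, smul_add, RingHom.id_apply,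
        smul_smul, smul_eq_mul]
    · simp only [Prod.smul_fst, Prod.smul_snd, Pi.smul_apply, RingHom.id_apply,
        smul_smul, smul_eq_mul]

theorem trivialMotions_eq_range (q : Configuration G Γ) :
    trivialMotions G Γ q = LinearMap.range (trivialMap q) := by
  ext w
  constructor
  · rintro ⟨A, b, hA, h1, h2⟩
    refine ⟨(A (EuclideanSpace.single 0 1) 1, b), Prod.ext (funext fun v => ?_) (funext fun γ => ?_)⟩
    · rw [h1, eq_smul_rot_of_skew A hA (q.1 v)]; rfl
    · rw [h2, eq_smul_rot_of_skew A hA (q.2 γ)]; rfl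
  · rintro ⟨⟨a, b⟩, rfl⟩
    refine ⟨a • rotLinear, b, fun x => ?_, fun v => rfl, fun γ => rfl⟩
    rw [LinearMap.smul_apply, real_inner_smul_left]
    exact mul_eq_zero_of_right _ (inner_rot_self x)

theorem period_basis_ne_zero (hG : IsPeriodicGraph G Γ) (hq : IsPeriodicPlacement G Γ q)
    (j : Fin 2) : q.2 (hG.basis j) ≠ 0 := by
  rw [← periodBasis_apply hG hq]
  exact (periodBasis hG hq).ne_zero j

theorem trivialMap_injective (hG : IsPeriodicGraph G Γ) (hq : IsPeriodicPlacement G Γ q) :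
    Function.Injective (trivialMap q) := by
  rw [← LinearMap.ker_eq_bot, LinearMap.ker_eq_bot']
  rintro ⟨a, b⟩ h
  have h1 : a • rot (q.2 (hG.basis 0)) = 0 := congrFun (congrArg Prod.snd h) _
  have ha : a = 0 := (smul_eq_zero.1 h1).resolve_right (rot_ne_zero (period_basis_ne_zero hG hq 0))
  obtain ⟨v⟩ := hG.connected.nonempty
  have h2 : a • rot (q.1 v) + b = 0 := congrFun (congrArg Prod.fst h) v
  rw [ha, zero_smul, zero_add] at h2
  rw [ha, h2]; rfl

theorem finrank_trivialMotions (hG : IsPeriodicGraph G Γ) (hq : IsPeriodicPlacement G Γ q) :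
    Module.finrank ℝ (trivialMotions G Γ q) = 3 := by
  rw [trivialMotions_eq_range, LinearMap.finrank_range_of_inj (trivialMap_injective hG hq)]
  simp

/-- A skew map has trace zero, so infinitesimal isometries preserve the period area as well as the
lengths. Hence the area functional costs one dimension beyond the three trivial ones, which yields
the sharp bound on the number of edge orbits. -/
theorem trivialMotions_le_map (hG : IsPeriodicGraph G Γ) (hq : IsPeriodicPlacement G Γ q)
    (r : EdgeOrbit G Γ → V × V) :
    trivialMotions G Γ q ≤ (LinearMap.ker ((rigidityMap hG q r).prod (periodTrace hG hq))).map
      (extendLinear hG) := by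
  rintro w ⟨A, b, hA, h1, h2⟩
  have hw : hG.extend (hG.restrict w) = w := by
    refine hG.extend_restrict w (fun γ δ => ?_) (fun γ v => ?_)
    · rw [h2, h2, h2, hq.map_mul, map_add]
    · rw [h1, h1, h2, hq.equivariant, map_add]; abel
  refine ⟨hG.restrict w, ?_, hw⟩
  rw [SetLike.mem_coe, LinearMap.mem_ker]
  refine Prod.ext (funext fun β => ?_) ?_
  · change rigidityMap hG q r (hG.restrict w) β = 0
    rw [rigidityMap_apply, hw]
    simp only [dartVec, h1, add_sub_add_right_eq_sub, ← map_sub]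
    rw [real_inner_comm, hA]
  · have : periodTrace hG hq (hG.restrict w) = periodTrace hG hq (linearMotion hG q A) := by
      change LinearMap.trace ℝ Plane ((periodBasis hG hq).constr ℝ fun j => w.2 (hG.basis j)) = _
      simp only [h2]
      rfl
    change periodTrace hG hq (hG.restrict w) = 0
    rw [this, periodTrace_linearMotion,
      LinearMap.trace_eq_sum_inner _ (EuclideanSpace.basisFun (Fin 2) ℝ)]
    refine Finset.sum_eq_zero fun i _ => ?_
    rw [real_inner_comm, hA]

theorem finrank_coordinates (hG : IsPeriodicGraph G Γ) :
    Module.Finite ℝ (Coordinates G Γ) ∧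
      Module.finrank ℝ (Coordinates G Γ) = 2 * Nat.card (VertexOrbit G Γ) + 4 := by
  have := hG.finite_vertices
  have := Fintype.ofFinite (VertexOrbit G Γ)
  refine ⟨inferInstance, ?_⟩
  rw [Module.finrank_prod, Module.finrank_pi_fintype, Module.finrank_pi_fintype]
  simp [mul_comm]

/-- In a pseudo-triangulation there are twice as many edge orbits as vertex orbits. -/
theorem card_edgeOrbit_eq (hG : IsPeriodicGraph G Γ) (hq : IsPeriodicPlacement G Γ q)
    (hT : IsPseudoTriangulation G q.1) :
    Nat.card (EdgeOrbit G Γ) = 2 * Nat.card (VertexOrbit G Γ) := by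
  refine le_antisymm ?_ (two_mul_card_vertexOrbit_le hG hq hT)
  have := hG.finite_edges
  have := Fintype.ofFinite (EdgeOrbit G Γ)
  obtain ⟨r, hr, hr'⟩ := hG.exists_edge_section
  obtain ⟨hfin, hdim⟩ := finrank_coordinates hG
  have h1 := ((rigidityMap hG q r).prod (periodTrace hG hq)).finrank_range_add_finrank_ker
  rw [LinearMap.range_eq_top.2 (rigidityMap_prod_surjective hG hq hT r hr hr'), finrank_top,
    Module.finrank_prod, Module.finrank_fintype_fun_eq_card, Module.finrank_self, hdim,
    ← Nat.card_eq_fintype_card] at h1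
  have h2 := Submodule.finrank_mono (trivialMotions_le_map hG hq r)
  rw [finrank_map_extendLinear, finrank_trivialMotions hG hq] at h2
  -- `(e + 1) + 3 ≤ 2v + 4`.
  omega

theorem rigidityMap_surjective (hG : IsPeriodicGraph G Γ) (hq : IsPeriodicPlacement G Γ q)
    (hT : IsPseudoTriangulation G q.1) (r : EdgeOrbit G Γ → V × V)
    (hr : ∀ β, G.Adj (r β).1 (r β).2)
    (hr' : ∀ β, (Quotient.mk'' (⟨s((r β).1, (r β).2), hr β⟩ : G.edgeSet) : EdgeOrbit G Γ) = β) :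
    Function.Surjective (rigidityMap hG q r) := fun x => by
  obtain ⟨z, hz⟩ := rigidityMap_prod_surjective hG hq hT r hr hr' (x, 0)
  exact ⟨z, congrArg Prod.fst hz⟩

/-- The map has full rank `e = 2v` on a space of dimension `2v + 4`. -/
theorem finrank_ker_rigidityMap (hG : IsPeriodicGraph G Γ) (hq : IsPeriodicPlacement G Γ q)
    (hT : IsPseudoTriangulation G q.1) (r : EdgeOrbit G Γ → V × V)
    (hr : ∀ β, G.Adj (r β).1 (r β).2)
    (hr' : ∀ β, (Quotient.mk'' (⟨s((r β).1, (r β).2), hr β⟩ : G.edgeSet) : EdgeOrbit G Γ) = β) :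
    Module.finrank ℝ (LinearMap.ker (rigidityMap hG q r)) = 4 := by
  have := hG.finite_edges
  have := Fintype.ofFinite (EdgeOrbit G Γ)
  obtain ⟨hfin, hdim⟩ := finrank_coordinates hG
  have h1 := (rigidityMap hG q r).finrank_range_add_finrank_ker
  rw [LinearMap.range_eq_top.2 (rigidityMap_surjective hG hq hT r hr hr'), finrank_top,
    Module.finrank_fintype_fun_eq_card, hdim, ← Nat.card_eq_fintype_card,
    card_edgeOrbit_eq hG hq hT] at h1
  omega

theorem trivialMotions_le (hq : IsPeriodicPlacement G Γ q) :
    trivialMotions G Γ q ≤ infinitesimalMotions G Γ q := by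
  rintro w ⟨A, b, hA, h1, h2⟩
  refine ⟨fun γ δ => ?_, fun γ v => ?_, fun u v _ => ?_⟩
  · rw [h2, h2, h2, hq.map_mul, map_add]
  · rw [h1, h1, h2, hq.equivariant, map_add]; abel
  · rw [h1, h1, add_sub_add_right_eq_sub, ← map_sub, real_inner_comm, hA]

/-- A pseudo-triangulation has one degree of infinitesimal freedom. -/
theorem finrank_infinitesimalFlexes (hG : IsPeriodicGraph G Γ) (hq : IsPeriodicPlacement G Γ q)
    (hT : IsPseudoTriangulation G q.1) : Module.finrank ℝ (InfinitesimalFlexes G Γ q) = 1 := by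
  obtain ⟨r, hr, hr'⟩ := hG.exists_edge_section
  have := (finrank_coordinates hG).1
  have h1 : Module.finrank ℝ (infinitesimalMotions G Γ q) = 4 := by
    rw [infinitesimalMotions_eq_map hG hq r hr hr', finrank_map_extendLinear,
      finrank_ker_rigidityMap hG hq hT r hr hr']
  have : Module.Finite ℝ (infinitesimalMotions G Γ q) :=
    Module.finite_of_finrank_pos (by omega)
  have h2 := Submodule.finrank_quotient_add_finrank
    ((trivialMotions G Γ q).submoduleOf (infinitesimalMotions G Γ q))
  rw [(Submodule.submoduleOfEquivOfLe (trivialMotions_le hq)).finrank_eq,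
    finrank_trivialMotions hG hq, h1] at h2
  change Module.finrank ℝ (infinitesimalMotions G Γ q ⧸ _) = 1
  omega

/-! ### Periodic stresses -/

/-- The weight on oriented edges given by a stress. -/
def stressWeight (s : G.edgeSet → ℝ) (u v : V) : ℝ := open Classical in
  if h : G.Adj u v then s ⟨s(u, v), h⟩ else 0

theorem stressWeight_of_adj (s : G.edgeSet → ℝ) {u v : V} (h : G.Adj u v) :
    stressWeight s u v = s ⟨s(u, v), h⟩ := dif_pos h

theorem IsPeriodicStress.isStressWeight (hG : IsPeriodicGraph G Γ) {s : G.edgeSet → ℝ}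
    (hs : IsPeriodicStress G Γ q s) : IsStressWeight hG q.1 (stressWeight s) where
  support u v h := dif_neg h
  symm u v := by
    by_cases h : G.Adj u v
    · rw [stressWeight_of_adj s h, stressWeight_of_adj s h.symm]
      congr 1
      exact Subtype.ext Sym2.eq_swap
    · rw [stressWeight, dif_neg h, stressWeight, dif_neg fun h' => h h'.symm]
  invariant γ u v := by
    by_cases h : G.Adj u v
    · rw [stressWeight_of_adj s h, stressWeight_of_adj s ((adj_smul_iff γ).2 h),
        ← hs.invariant γ ⟨s(u, v), h⟩]
      rfl
    · rw [stressWeight, dif_neg fun h' => h ((adj_smul_iff γ).1 h'), stressWeight, dif_neg h]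
  equilibrium u := by
    rw [← hs.equilibrium u, hG.sum_nbr_eq_finsum]
    classical
    have h1 : ∀ v, (if G.Adj u v then stressWeight s u v • (q.1 v - q.1 u) else 0) =
        ∑ᶠ (_ : v ∈ G.neighborSet u), stressWeight s u v • (q.1 v - q.1 u) := fun v =>
      (finsum_eq_if (p := v ∈ G.neighborSet u)).symm
    rw [finsum_congr fun v => (by convert h1 v), ← finsum_set_coe_eq_finsum_mem]
    refine finsum_congr fun v => ?_
    rw [stressWeight_of_adj s v.2]

/-- Given equilibrium, the period equations make the whole stress tensor vanish, so `stress_eq_zero`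
applies with determinant zero. -/
theorem periodicStress_eq_zero (hG : IsPeriodicGraph G Γ) (hq : IsPeriodicPlacement G Γ q)
    (hT : IsPseudoTriangulation G q.1) {s : G.edgeSet → ℝ} (hs : IsPeriodicStress G Γ q s) :
    s = 0 := by
  classical
  have := hG.finite_vertices
  have := Fintype.ofFinite (VertexOrbit G Γ)
  have := hG.finite_edges
  have := Fintype.ofFinite (EdgeOrbit G Γ)
  have hσ := hs.isStressWeight hG
  obtain ⟨R, hR⟩ := hs.periods
  let r : EdgeOrbit G Γ → V × V := fun β =>
    (R.vert (R.tail β), R.shift β • R.vert (R.head β))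
  -- The coordinate `l` of an edge vector is a difference of positions of representatives plus a
  -- period. The first part contributes virtual work, zero by equilibrium; the second is a
  -- combination of the period equations.
  have hmom : ∀ k l : Fin 2, ∑ d ∈ hG.darts, stressWeight s d.1 d.2 *
      (dartVec q.1 d k * dartVec q.1 d l) = 0 := by
    intro k l
    -- Periods are expanded in the generators chosen in `R`, which need not be those of `hG.gen`.
    have hW : ∀ γ : Γ, q.2 γ = ∑ j, (Multiplicative.toAdd (R.gen γ) j : ℝ) •
        q.2 (R.gen.symm (Multiplicative.ofAdd (Pi.single j 1))) := by
      intro γ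
      let F : (Fin 2 → ℤ) →+ Plane :=
        AddMonoidHom.mk' (fun c => q.2 (R.gen.symm (Multiplicative.ofAdd c))) fun c d => by
          rw [ofAdd_add, map_mul, hq.map_mul]
      have h1 : q.2 γ = F (Multiplicative.toAdd (R.gen γ)) := by simp [F]
      have h2 : ∀ c : Fin 2 → ℤ, c = ∑ j, c j • (Pi.single j 1 : Fin 2 → ℤ) := fun c => by
        funext i
        fin_cases i <;> simp [Fin.sum_univ_two]
      rw [h1]
      conv_lhs => rw [h2 (Multiplicative.toAdd (R.gen γ))]
      rw [map_sum]
      refine Finset.sum_congr rfl fun j _ => ?_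
      rw [map_zsmul, Int.cast_smul_eq_zsmul]
      rfl
    -- The invariant displacement in direction `k` by the coordinate `l` of the orbit
    -- representative; its virtual work is the part of the moment that does not come from periods.
    set P : V → Plane := fun v => EuclideanSpace.single k (q.1 (R.vert (Quotient.mk'' v)) l) with hP
    have hPi : ∀ (γ : Γ) v, P (γ • v) = P v := fun γ v => by simp only [hP, mk_smul]
    have hwork := sum_darts_work hG hq hσ.symm hσ.invariant P hPi
    simp only [hσ.equilibrium, inner_zero_left, Finset.sum_const_zero, mul_zero] at hwork
    have key := fun (H : V × V → ℝ) hH => hG.sum_darts_eq_sum_edges r R.adj R.edge_mem H hH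
    rw [key _ fun γ u v => by rw [hσ.invariant, hq.dartVec_smul]; congr 2; simp [dartVec, hPi]] at hwork
    rw [key _ fun γ u v => by rw [hσ.invariant, hq.dartVec_smul]]
    simp only [dartVec_swap, Prod.fst_swap, Prod.snd_swap, inner_neg_neg, PiLp.neg_apply, neg_mul_neg,
      hσ.symm (r _).2, ← two_mul, ← Finset.mul_sum] at hwork ⊢
    have hper : ∀ j : Fin 2, ∑ β, s (R.edge β) * (R.coord β j : ℝ) * dartVec q.1 (r β) k = 0 := by
      intro j
      have h := hR j
      rw [finsum_eq_sum_of_fintype] at h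
      have h' := congrArg (fun x : Plane => x k) h
      simpa [WithLp.ofLp_sum, Finset.sum_apply, Representatives.edgeVector, dartVec, r] using h'
    have hrs : ∀ β, stressWeight s (r β).1 (r β).2 = s (R.edge β) := fun β =>
      stressWeight_of_adj s (R.adj β)
    have hdecomp : ∀ β, stressWeight s (r β).1 (r β).2 *
        (dartVec q.1 (r β) k * dartVec q.1 (r β) l) =
        stressWeight s (r β).1 (r β).2 * inner ℝ (dartVec q.1 (r β)) (dartVec P (r β)) +
        ∑ j, (s (R.edge β) * (R.coord β j : ℝ) * dartVec q.1 (r β) k) *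
          q.2 (R.gen.symm (Multiplicative.ofAdd (Pi.single j 1))) l := by
      intro β
      have h1 : inner ℝ (dartVec q.1 (r β)) (dartVec P (r β)) =
          dartVec q.1 (r β) k * (q.1 (R.vert (R.head β)) l - q.1 (R.vert (R.tail β)) l) := by
        simp only [dartVec, hP, r, mk_smul, R.vert_mem, inner_sub_right,
          EuclideanSpace.inner_single_right]
        simp
        ring
      have h2 : dartVec q.1 (r β) l = (q.1 (R.vert (R.head β)) l - q.1 (R.vert (R.tail β)) l) +
          ∑ j, (R.coord β j : ℝ) * q.2 (R.gen.symm (Multiplicative.ofAdd (Pi.single j 1))) l := by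
        have h3 := congrArg (fun x : Plane => x l) (hW (R.shift β))
        simp only [WithLp.ofLp_sum, Finset.sum_apply, PiLp.smul_apply, smul_eq_mul] at h3
        simp only [dartVec, r, hq.equivariant, PiLp.sub_apply, PiLp.add_apply]
        rw [h3]
        simp only [Representatives.coord]
        ring
      rw [h1, hrs]
      conv_lhs => rw [h2]
      rw [mul_add, mul_add, Finset.mul_sum, Finset.mul_sum]
      congr 1
      refine Finset.sum_congr rfl fun j _ => ?_
      ring
    simp only [hdecomp]
    rw [Finset.sum_add_distrib, Finset.sum_comm]
    simp only [← Finset.sum_mul, hper, zero_mul, Finset.sum_const_zero, add_zero]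
    exact hwork
  have hzero := stress_eq_zero hG hq hT.nonCrossing hT.pointed hσ (by
    rw [sum_sum_cross_sq hG.darts (fun d => stressWeight s d.1 d.2) (dartVec q.1), hmom, hmom, hmom]
    simp)
  funext e
  induction e using edge_induction with
  | h a b hab => rw [← stressWeight_of_adj s hab, hzero]; rfl

end Flexes

end PeriodicFramework

end

open scoped ContDiff
noncomputable section

namespace PeriodicFramework

/-! ### Local coordinates near a pseudo-triangulation. -/

section Chart

open Filter Topology

/-- Inverse function theorem with a smooth local inverse on the whole target. -/
theorem exists_openPartialHomeomorph_contDiffOn_symm {E F : Type*} [NormedAddCommGroup E]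
    [NormedSpace ℝ E] [CompleteSpace E] [NormedAddCommGroup F] [NormedSpace ℝ F] {f : E → F}
    (hf : ContDiff ℝ ω f) {a : E} (f' : E ≃L[ℝ] F) (hf' : HasFDerivAt f (f' : E →L[ℝ] F) a)
    {W : Set E} (hW : IsOpen W) (ha : a ∈ W) :
    ∃ Ψ : OpenPartialHomeomorph E F, (∀ x, Ψ x = f x) ∧ a ∈ Ψ.source ∧ Ψ.source ⊆ W ∧
      ContDiffOn ℝ ω Ψ.symm Ψ.target := by
  have hne : (ω : WithTop ℕ∞) ≠ 0 := by simp
  set Φ := hf.contDiffAt.toOpenPartialHomeomorph f hf' hne with hΦ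
  have hsymm : ContDiffAt ℝ ω Φ.symm (f a) := hf.contDiffAt.to_localInverse hf' hne
  -- The local inverse is smooth at one point, hence on a neighbourhood `O`; the chart is cut down
  -- until its target lies in `O`.
  obtain ⟨O, hO, hOopen, hfa⟩ := eventually_nhds_iff.1 (hsymm.eventually (by simp))
  have hs : IsOpen (W ∩ f ⁻¹' O) := hW.inter (hOopen.preimage hf.continuous)
  refine ⟨Φ.restrOpen _ hs, fun x => rfl, ⟨?_, ha, hfa⟩, fun x hx => hx.2.1, fun y hy => ?_⟩
  · exact ContDiffAt.mem_toOpenPartialHomeomorph_source hf.contDiffAt hf' hne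
  · have hy1 : y ∈ Φ.target ∧ Φ.symm y ∈ W ∩ f ⁻¹' O := by
      have h1 : y ∈ (Φ.restrOpen _ hs).target := hy
      have h2 := (Φ.restrOpen _ hs).map_target h1
      have h3 := (Φ.restrOpen _ hs).right_inv h1
      have h4 : Φ.symm y ∈ Φ.source ∩ (W ∩ f ⁻¹' O) := h2
      refine ⟨?_, h4.2⟩
      rw [← show Φ (Φ.symm y) = y from h3]
      exact Φ.map_source h4.1
    have h3 : f (Φ.symm y) = y := Φ.right_inv hy1.1
    have h4 : y ∈ O := by rw [← h3]; exact hy1.2.2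
    exact (hO y h4).contDiffWithinAt

variable {V : Type*} {G : SimpleGraph V} {Γ : Subgroup (G ≃g G)} {q : Configuration G Γ}

theorem extend_rep (hG : IsPeriodicGraph G Γ) (z : Coordinates G Γ) (o : VertexOrbit G Γ) :
    (hG.extend z).1 (hG.rep o) = z.1 o :=
  congrFun (congrArg Prod.fst (hG.restrict_extend z)) o

theorem extend_basis (hG : IsPeriodicGraph G Γ) (z : Coordinates G Γ) (j : Fin 2) :
    (hG.extend z).2 (hG.basis j) = z.2 j :=
  congrFun (congrArg Prod.snd (hG.restrict_extend z)) j

theorem inner_rot_rot (x y : Plane) : inner ℝ (rot x) (rot y) = inner ℝ x y := by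
  simp only [inner_plane, rot_zero, rot_one]; ring

/-- A trivial motion which fixes a vertex and the direction of a period is zero. -/
theorem eq_zero_of_trivial_of_gauge (hG : IsPeriodicGraph G Γ) {y₀ : Plane}
    (hy : inner ℝ y₀ (q.2 (hG.basis 0)) ≠ 0) {w : Configuration G Γ}
    (hw : w ∈ trivialMotions G Γ q) (v : V) (h1 : w.1 v = 0)
    (h2 : inner ℝ (rot y₀) (w.2 (hG.basis 0)) = 0) : w = 0 := by
  rw [trivialMotions_eq_range] at hw
  obtain ⟨⟨a, b⟩, rfl⟩ := hw
  have h3 : inner ℝ (rot y₀) (a • rot (q.2 (hG.basis 0))) = 0 := h2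
  rw [real_inner_smul_right, inner_rot_rot] at h3
  have ha : a = 0 := (mul_eq_zero.1 h3).resolve_right hy
  have h4 : a • rot (q.1 v) + b = 0 := h1
  rw [ha, zero_smul, zero_add] at h4
  rw [ha, h4]
  exact map_zero _

/-- A linear functional which is nonzero on normalized nontrivial infinitesimal motions. -/
theorem exists_transverse (hG : IsPeriodicGraph G Γ) (hq : IsPeriodicPlacement G Γ q)
    (hT : IsPseudoTriangulation G q.1) (r : EdgeOrbit G Γ → V × V)
    (hr : ∀ β, G.Adj (r β).1 (r β).2)
    (hr' : ∀ β, (Quotient.mk'' (⟨s((r β).1, (r β).2), hr β⟩ : G.edgeSet) : EdgeOrbit G Γ) = β)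
    (o : VertexOrbit G Γ) :
    ∃ θ : Coordinates G Γ →ₗ[ℝ] ℝ, ∀ w, rigidityMap hG q r w = 0 → w.1 o = 0 →
      inner ℝ (rot (q.2 (hG.basis 0))) (w.2 0) = 0 → θ w = 0 → w = 0 := by
  have hfin := (finrank_coordinates hG).1
  -- `K` consists of the normalized infinitesimal motions, `T` of the trivial ones. They are
  -- independent in a kernel of dimension 4, and `T` has dimension 3, so `K` is at most a line and
  -- one functional detects it.
  let K : Submodule ℝ (Coordinates G Γ) := LinearMap.ker (rigidityMap hG q r) ⊓
    (LinearMap.ker (LinearMap.proj o ∘ₗ LinearMap.fst ℝ (VertexOrbit G Γ → Plane) (Fin 2 → Plane)) ⊓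
      LinearMap.ker ((innerSL ℝ (rot (q.2 (hG.basis 0)))).toLinearMap ∘ₗ LinearMap.proj 0 ∘ₗ
        LinearMap.snd ℝ (VertexOrbit G Γ → Plane) (Fin 2 → Plane)))
  let T : Submodule ℝ (Coordinates G Γ) := (trivialMotions G Γ q).comap (extendLinear hG)
  have hTmap : T.map (extendLinear hG) = trivialMotions G Γ q := by
    rw [Submodule.map_comap_eq, inf_eq_right]
    exact (trivialMotions_le_map hG hq r).trans (LinearMap.map_le_range)
  have hT3 : Module.finrank ℝ T = 3 := by
    rw [← finrank_map_extendLinear hG, hTmap, finrank_trivialMotions hG hq]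
  have hTle : T ≤ LinearMap.ker (rigidityMap hG q r) := by
    intro z hz
    obtain ⟨z', hz', he⟩ := trivialMotions_le_map hG hq r hz
    rw [← extendLinear_injective hG he]
    exact congrArg Prod.fst hz'
  have hdisj : T ⊓ K = ⊥ := by
    rw [eq_bot_iff]
    rintro z ⟨hz, -, hz1, hz2⟩
    have hz1' : z.1 o = 0 := hz1
    have hz2' : inner ℝ (rot (q.2 (hG.basis 0))) (z.2 0) = 0 := hz2
    have := eq_zero_of_trivial_of_gauge hG
      (inner_self_ne_zero.2 (period_basis_ne_zero hG hq 0)) (w := hG.extend z) hz (hG.rep o)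
      (by rw [extend_rep]; exact hz1') (by rw [extend_basis]; exact hz2')
    exact extendLinear_injective hG (this.trans (map_zero _).symm)
  have h4 := finrank_ker_rigidityMap hG hq hT r hr hr'
  have hle : T ⊔ K ≤ LinearMap.ker (rigidityMap hG q r) := sup_le hTle inf_le_left
  have h5 := Submodule.finrank_sup_add_finrank_inf_eq T K
  have h6 := Submodule.finrank_mono hle
  rw [hdisj, finrank_bot, hT3] at h5
  obtain ⟨v, hv⟩ := finrank_le_one_iff.1 (show Module.finrank ℝ K ≤ 1 by omega)
  obtain ⟨θ, hθ⟩ : ∃ θ : Coordinates G Γ →ₗ[ℝ] ℝ, θ v.1 = 0 → v.1 = 0 := by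
    by_cases h : v.1 = 0
    · exact ⟨0, fun _ => h⟩
    · by_contra hcon
      push Not at hcon
      have hall : ∀ θ : Module.Dual ℝ (Coordinates G Γ), θ v.1 = 0 := fun θ => (hcon θ).1
      exact h ((Module.forall_dual_apply_eq_zero_iff ℝ v.1).1 hall)
  refine ⟨θ, fun w h1 h2 h3 h0 => ?_⟩
  obtain ⟨c, hc⟩ := hv ⟨w, h1, h2, h3⟩
  have hc' : c • v.1 = w := congrArg Subtype.val hc
  rw [← hc', map_smul, smul_eq_mul, mul_eq_zero] at h0
  rcases h0 with h0 | h0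
  · rw [← hc', h0, zero_smul]
  · rw [← hc', hθ h0, smul_zero]

variable [Fintype (VertexOrbit G Γ)]

/-- The vector of an oriented edge as a function of the coordinates. -/
def dartLinear (hG : IsPeriodicGraph G Γ) (d : V × V) : Coordinates G Γ →L[ℝ] Plane :=
  LinearMap.toContinuousLinearMap
    { toFun := fun z => dartVec (extendLinear hG z).1 d
      map_add' := fun z w => by
        simp only [dartVec, map_add, Prod.fst_add, Pi.add_apply]; abel
      map_smul' := fun a z => by
        simp only [dartVec, map_smul, Prod.smul_fst, Pi.smul_apply, smul_sub, RingHom.id_apply] }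

theorem dartLinear_apply (hG : IsPeriodicGraph G Γ) (d : V × V) (z : Coordinates G Γ) :
    dartLinear hG d z = dartVec (hG.extend z).1 d := rfl

variable [Fintype (EdgeOrbit G Γ)]

/-- Squared edge lengths, position of a vertex, direction of a period, and a further linear
functional. -/
def chartMap (hG : IsPeriodicGraph G Γ) (r : EdgeOrbit G Γ → V × V) (o : VertexOrbit G Γ)
    (y : Plane) (θ : Coordinates G Γ →L[ℝ] ℝ) (z : Coordinates G Γ) :
    (EdgeOrbit G Γ → ℝ) × (Plane × ℝ) × ℝ :=
  (fun β => inner ℝ (dartLinear hG (r β) z) (dartLinear hG (r β) z),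
    (z.1 o, inner ℝ (rot y) (z.2 0)), θ z)

theorem contDiff_chartMap (hG : IsPeriodicGraph G Γ) (r : EdgeOrbit G Γ → V × V)
    (o : VertexOrbit G Γ) (y : Plane) (θ : Coordinates G Γ →L[ℝ] ℝ) :
    ContDiff ℝ ω (chartMap hG r o y θ) := by
  unfold chartMap
  refine ContDiff.prodMk (contDiff_pi.2 fun β => ?_) (ContDiff.prodMk (ContDiff.prodMk ?_ ?_) ?_)
  · exact (dartLinear hG (r β)).contDiff.inner ℝ (dartLinear hG (r β)).contDiff
  · exact ((ContinuousLinearMap.proj (R := ℝ) o).comp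
      (ContinuousLinearMap.fst ℝ (VertexOrbit G Γ → Plane) (Fin 2 → Plane))).contDiff
  · exact contDiff_const.inner ℝ ((ContinuousLinearMap.proj (R := ℝ) 0).comp
      (ContinuousLinearMap.snd ℝ (VertexOrbit G Γ → Plane) (Fin 2 → Plane))).contDiff
  · exact θ.contDiff

theorem exists_hasFDerivAt_chartMap (hG : IsPeriodicGraph G Γ) (r : EdgeOrbit G Γ → V × V)
    (o : VertexOrbit G Γ) (y : Plane) (θ : Coordinates G Γ →L[ℝ] ℝ) (z : Coordinates G Γ) :
    ∃ L : Coordinates G Γ →L[ℝ] (EdgeOrbit G Γ → ℝ) × (Plane × ℝ) × ℝ,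
      HasFDerivAt (chartMap hG r o y θ) L z ∧ ∀ w, L w =
        (fun β => 2 * inner ℝ (dartLinear hG (r β) z) (dartLinear hG (r β) w),
          (w.1 o, inner ℝ (rot y) (w.2 0)), θ w) := by
  have h1 : ∀ β, HasFDerivAt (fun z => inner ℝ (dartLinear hG (r β) z) (dartLinear hG (r β) z))
      _ z := fun β => (dartLinear hG (r β)).hasFDerivAt.inner ℝ (dartLinear hG (r β)).hasFDerivAt
  have h2 := ((ContinuousLinearMap.proj (R := ℝ) o).comp
      (ContinuousLinearMap.fst ℝ (VertexOrbit G Γ → Plane) (Fin 2 → Plane))).hasFDerivAt (x := z)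
  have h3 := ((innerSL ℝ (rot y)).comp ((ContinuousLinearMap.proj (R := ℝ) 0).comp
      (ContinuousLinearMap.snd ℝ (VertexOrbit G Γ → Plane) (Fin 2 → Plane)))).hasFDerivAt (x := z)
  refine ⟨_, (hasFDerivAt_pi.2 h1).prodMk ((h2.prodMk h3).prodMk θ.hasFDerivAt), fun w => ?_⟩
  refine Prod.ext (funext fun β => ?_) rfl
  change inner ℝ (dartLinear hG (r β) z) (dartLinear hG (r β) w) +
    inner ℝ (dartLinear hG (r β) w) (dartLinear hG (r β) z) = _
  rw [real_inner_comm (dartLinear hG (r β) z)]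
  ring

/-- Near a pseudo-triangulation, edge lengths, a normalization and one more functional form smooth
coordinates. -/
theorem exists_chart (hG : IsPeriodicGraph G Γ) (hq : IsPeriodicPlacement G Γ q)
    (hT : IsPseudoTriangulation G q.1) (r : EdgeOrbit G Γ → V × V)
    (hr : ∀ β, G.Adj (r β).1 (r β).2)
    (hr' : ∀ β, (Quotient.mk'' (⟨s((r β).1, (r β).2), hr β⟩ : G.edgeSet) : EdgeOrbit G Γ) = β)
    (o : VertexOrbit G Γ) {W : Set (Coordinates G Γ)} (hW : IsOpen W) (hqW : hG.restrict q ∈ W) :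
    ∃ (θ : Coordinates G Γ →L[ℝ] ℝ)
      (Ψ : OpenPartialHomeomorph (Coordinates G Γ) ((EdgeOrbit G Γ → ℝ) × (Plane × ℝ) × ℝ)),
      (∀ z, Ψ z = chartMap hG r o (q.2 (hG.basis 0)) θ z) ∧ hG.restrict q ∈ Ψ.source ∧
      Ψ.source ⊆ W ∧ ContDiffOn ℝ ω Ψ.symm Ψ.target := by
  obtain ⟨θ, hθ⟩ := exists_transverse hG hq hT r hr hr' o
  obtain ⟨L, hL, hLw⟩ := exists_hasFDerivAt_chartMap hG r o (q.2 (hG.basis 0))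
    (LinearMap.toContinuousLinearMap θ) (hG.restrict q)
  have hext : hG.extend (hG.restrict q) = q := hG.extend_restrict q hq.map_mul hq.equivariant
  have hinj : Function.Injective L.toLinearMap := by
    rw [← LinearMap.ker_eq_bot, LinearMap.ker_eq_bot']
    intro w hw
    have hw' : L w = 0 := hw
    rw [hLw] at hw'
    simp only [Prod.mk_eq_zero] at hw'
    obtain ⟨h1, ⟨h2, h3⟩, h4⟩ := hw'
    refine hθ w (funext fun β => ?_) h2 h3 h4
    have h5 := congrFun h1 β
    simp only [dartLinear_apply, hext] at h5
    rw [rigidityMap_apply]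
    exact (mul_eq_zero.1 h5).resolve_left two_ne_zero
  -- Both spaces have dimension `2v + 4`: on the right there are `e = 2v` lengths, three
  -- normalizations and the functional `θ`.
  have hdim : Module.finrank ℝ (Coordinates G Γ) =
      Module.finrank ℝ ((EdgeOrbit G Γ → ℝ) × (Plane × ℝ) × ℝ) := by
    rw [(finrank_coordinates hG).2, Module.finrank_prod, Module.finrank_prod, Module.finrank_prod,
      Module.finrank_fintype_fun_eq_card, Module.finrank_self, finrank_euclideanSpace_fin,
      ← Nat.card_eq_fintype_card, card_edgeOrbit_eq hG hq hT]
  obtain ⟨L', hL'⟩ : ∃ L' : Coordinates G Γ ≃L[ℝ] (EdgeOrbit G Γ → ℝ) × (Plane × ℝ) × ℝ,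
      (L' : Coordinates G Γ →L[ℝ] (EdgeOrbit G Γ → ℝ) × (Plane × ℝ) × ℝ) = L :=
    ⟨(LinearEquiv.ofInjectiveOfFinrankEq L.toLinearMap hinj hdim).toContinuousLinearEquiv,
      ContinuousLinearMap.ext fun _ => rfl⟩
  obtain ⟨Ψ, h1, h2, h3, h4⟩ := exists_openPartialHomeomorph_contDiffOn_symm
    (contDiff_chartMap hG r o (q.2 (hG.basis 0)) (LinearMap.toContinuousLinearMap θ))
    L' (by rw [hL']; exact hL) hW hqW
  exact ⟨_, Ψ, h1, h2, h3, h4⟩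

end Chart

end PeriodicFramework

end

open scoped ContDiff
noncomputable section

namespace PeriodicFramework

/-! ### Normalizing realizations by isometries. -/

section Normalization

open Filter Topology

variable {V : Type*} {G : SimpleGraph V} {Γ : Subgroup (G ≃g G)} {q : Configuration G Γ}

theorem eq_cross_combination {x y w : Plane} (h : cross x y ≠ 0) :
    w = (cross w y / cross x y) • x + (cross x w / cross x y) • y := by
  have e0 : cross w y * x 0 + cross x w * y 0 = w 0 * cross x y := by simp only [cross]; ring
  have e1 : cross w y * x 1 + cross x w * y 1 = w 1 * cross x y := by simp only [cross]; ring
  apply plane_ext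
  · simp only [PiLp.add_apply, PiLp.smul_apply, smul_eq_mul]
    rw [div_mul_eq_mul_div, div_mul_eq_mul_div, ← add_div, e0, mul_div_cancel_right₀ _ h]
  · simp only [PiLp.add_apply, PiLp.smul_apply, smul_eq_mul]
    rw [div_mul_eq_mul_div, div_mul_eq_mul_div, ← add_div, e1, mul_div_cancel_right₀ _ h]

theorem dist_eq_iff_inner_dartVec {p p' : V → Plane} (d : V × V) :
    dist (p d.1) (p d.2) = dist (p' d.1) (p' d.2) ↔
      (inner ℝ (dartVec p d) (dartVec p d) : ℝ) = inner ℝ (dartVec p' d) (dartVec p' d) := by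
  rw [real_inner_self_eq_norm_sq, real_inner_self_eq_norm_sq, dist_comm, dist_comm (p' d.1),
    dist_eq_norm, dist_eq_norm, sq_eq_sq₀ (norm_nonneg _) (norm_nonneg _)]
  rfl

/-- Coordinates with the right edge lengths and independent periods give a realization. -/
theorem extend_mem_realizationSpace (hG : IsPeriodicGraph G Γ) (hq : IsPeriodicPlacement G Γ q)
    {r : EdgeOrbit G Γ → V × V} {hr : ∀ β, G.Adj (r β).1 (r β).2}
    (hr' : ∀ β, (Quotient.mk'' (⟨s((r β).1, (r β).2), hr β⟩ : G.edgeSet) : EdgeOrbit G Γ) = β)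
    {z : Coordinates G Γ} (hz : cross (z.2 0) (z.2 1) ≠ 0)
    (hlen : ∀ β, (inner ℝ (dartVec (hG.extend z).1 (r β)) (dartVec (hG.extend z).1 (r β)) : ℝ) =
      inner ℝ (dartVec q.1 (r β)) (dartVec q.1 (r β))) :
    hG.extend z ∈ realizationSpace G Γ q := by
  have hdist : ∀ u v, G.Adj u v →
      dist ((hG.extend z).1 u) ((hG.extend z).1 v) = dist (q.1 u) (q.1 v) := by
    intro u v huv
    refine dart_induction (P := fun u v => dist ((hG.extend z).1 u) ((hG.extend z).1 v) =
      dist (q.1 u) (q.1 v)) hr' (fun γ u v h => ?_) (fun u v h => ?_)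
      (fun β => (dist_eq_iff_inner_dartVec _).2 (hlen β)) huv
    · rw [hG.extend_smul, hG.extend_smul, hq.equivariant, hq.equivariant, dist_add_right,
        dist_add_right, h]
    · rw [dist_comm, h, dist_comm]
  refine ⟨⟨hG.extend_mul z, ?_, ?_, hG.extend_smul z, ?_⟩, hdist⟩
  · intro γ δ h
    have h' : (hG.deg γ 0 : ℝ) • z.2 0 + (hG.deg γ 1 : ℝ) • z.2 1 =
        (hG.deg δ 0 : ℝ) • z.2 0 + (hG.deg δ 1 : ℝ) • z.2 1 := by
      simpa [IsPeriodicGraph.extend, Fin.sum_univ_two, Int.cast_smul_eq_zsmul] using h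
    refine hG.deg_injective (funext fun j => ?_)
    have h0 := congrArg (fun x => cross x (z.2 1)) h'
    have h1 := congrArg (fun x => cross (z.2 0) x) h'
    simp only [cross_add_left, cross_add_right, cross_smul_left, cross_smul_right, cross_self,
      mul_zero, add_zero, zero_add] at h0 h1
    fin_cases j
    · exact_mod_cast mul_right_cancel₀ hz h0
    · exact_mod_cast mul_right_cancel₀ hz h1
  · rw [eq_top_iff]
    intro w _
    rw [eq_cross_combination (w := w) hz, ← extend_basis hG z 0, ← extend_basis hG z 1]
    exact Submodule.add_mem _ (Submodule.smul_mem _ _ (Submodule.subset_span ⟨_, rfl⟩))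
      (Submodule.smul_mem _ _ (Submodule.subset_span ⟨_, rfl⟩))
  · intro u v huv h
    have := hdist u v huv
    rw [h, dist_self] at this
    exact hq.ne_of_adj u v huv (dist_eq_zero.1 this.symm)

theorem inner_rot (x y : Plane) : inner ℝ (rot x) y = cross x y := by
  simp only [inner_plane, cross, rot_zero, rot_one]; ring

theorem cross_sq_add_inner_sq (x y : Plane) :
    cross x y ^ 2 + inner ℝ x y ^ 2 = inner ℝ x x * inner ℝ y y := by
  simp only [inner_plane, cross]; ring

/-- Congruent normalized realizations are equal. -/
theorem eq_of_congruent_of_normalized (hG : IsPeriodicGraph G Γ) {y₀ : Plane} {ε : ℝ}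
    {a b : Configuration G Γ} (ha : IsPeriodicPlacement G Γ a)
    (T : Plane ≃ᵃⁱ[ℝ] Plane) (h1 : ∀ v : V, b.1 v = T (a.1 v))
    (h2 : ∀ γ : Γ, b.2 γ = T.linearIsometryEquiv (a.2 γ)) (v₀ : V) (hv : a.1 v₀ = b.1 v₀)
    (ha0 : cross y₀ (a.2 (hG.basis 0)) = 0) (hb0 : cross y₀ (b.2 (hG.basis 0)) = 0)
    (ha1 : 0 < inner ℝ y₀ (a.2 (hG.basis 0))) (hb1 : 0 < inner ℝ y₀ (b.2 (hG.basis 0)))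
    (ha2 : 0 < ε * cross (a.2 (hG.basis 0)) (a.2 (hG.basis 1)))
    (hb2 : 0 < ε * cross (b.2 (hG.basis 0)) (b.2 (hG.basis 1))) : a = b := by
  set L := T.linearIsometryEquiv with hL
  have hy0 : y₀ ≠ 0 := by rintro rfl; simp at ha1
  have hyy : (0 : ℝ) < inner ℝ y₀ y₀ := real_inner_self_pos.2 hy0
  have e0 : b.2 (hG.basis 0) = a.2 (hG.basis 0) := by
    have h3 := eq_smul_of_cross_eq_zero hy0 ha0
    have h4 := eq_smul_of_cross_eq_zero hy0 hb0
    have hn : ‖b.2 (hG.basis 0)‖ = ‖a.2 (hG.basis 0)‖ := by rw [h2, L.norm_map]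
    rw [h3, h4, norm_smul, norm_smul, Real.norm_eq_abs, Real.norm_eq_abs,
      abs_of_pos (div_pos ha1 hyy), abs_of_pos (div_pos hb1 hyy)] at hn
    rw [h3, h4, mul_right_cancel₀ (norm_ne_zero_iff.2 hy0) hn]
  set y := a.2 (hG.basis 0) with hy
  have hyne : y ≠ 0 := by intro h; rw [h, inner_zero_right] at ha1; exact ha1.false
  have hLy : L y = y := (h2 _).symm.trans e0
  have e1 : b.2 (hG.basis 1) = a.2 (hG.basis 1) := by
    rw [e0] at hb2
    set x := a.2 (hG.basis 1)
    have hbx : b.2 (hG.basis 1) = L x := h2 _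
    rw [hbx] at hb2 ⊢
    have hin : inner ℝ y (L x) = inner ℝ y x := by
      conv_lhs => rw [← hLy]
      exact L.inner_map_map y x
    have hxx : inner ℝ (L x) (L x) = inner ℝ x x := L.inner_map_map x x
    have hsq := cross_sq_add_inner_sq y (L x)
    rw [hin, hxx, ← cross_sq_add_inner_sq y x, add_left_inj, sq_eq_sq_iff_eq_or_eq_neg] at hsq
    -- An isometry fixing `y` is the identity or the reflection in the line of `y`; the orientation
    -- sign `ε` excludes the reflection.
    have hc : cross y (L x) = cross y x := by
      rcases hsq with h | h
      · exact h
      · rw [h] at hb2; nlinarith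
    have hd : cross y (L x - x) = 0 := by
      rw [sub_eq_add_neg, cross_add_right, hc]
      simp only [cross, PiLp.neg_apply]; ring
    have := eq_smul_of_cross_eq_zero hyne hd
    rw [inner_sub_right, hin, sub_self, zero_div, zero_smul] at this
    exact sub_eq_zero.1 this
  have hLid : ∀ x, L x = x := by
    have : L.toLinearEquiv.toLinearMap = LinearMap.id := by
      refine (periodBasis hG ha).ext fun j => ?_
      rw [periodBasis_apply]
      change L (a.2 (hG.basis j)) = a.2 (hG.basis j)
      rw [← h2]
      fin_cases j
      · exact e0
      · exact e1
    exact fun x => congrArg (fun f : Plane →ₗ[ℝ] Plane => f x) this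
  refine Prod.ext (funext fun v => ?_) (funext fun γ => ?_)
  · have h3 := T.map_vsub (a.1 v) (a.1 v₀)
    rw [← hL, hLid, vsub_eq_sub, vsub_eq_sub, ← h1, ← h1, ← hv] at h3
    exact sub_left_inj.1 h3
  · rw [h2, hLid]

/-- The rotation with cosine `α` and sine `β`. -/
def rotation (α β : ℝ) (h : α ^ 2 + β ^ 2 = 1) : Plane ≃ₗᵢ[ℝ] Plane :=
  LinearIsometry.toLinearIsometryEquiv
    { toLinearMap := α • LinearMap.id + β • rotLinear
      norm_map' := fun x => by
        have h1 : inner ℝ (α • x + β • rot x) (α • x + β • rot x) = (inner ℝ x x : ℝ) := by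
          have : (inner ℝ x x : ℝ) = (α ^ 2 + β ^ 2) * inner ℝ x x := by rw [h, one_mul]
          rw [this]
          simp only [inner_plane, PiLp.add_apply, PiLp.smul_apply, smul_eq_mul, rot_zero, rot_one]
          ring
        change ‖α • x + β • rot x‖ = ‖x‖
        rw [real_inner_self_eq_norm_sq, real_inner_self_eq_norm_sq] at h1
        exact (sq_eq_sq₀ (norm_nonneg _) (norm_nonneg _)).1 h1 } rfl

theorem isometry_mem_realizationSpace {w : Configuration G Γ}
    (hw : w ∈ realizationSpace G Γ q) (T : Plane ≃ᵃⁱ[ℝ] Plane) :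
    ((fun v => T (w.1 v), fun γ => T.linearIsometryEquiv (w.2 γ)) : Configuration G Γ) ∈
      realizationSpace G Γ q := by
  obtain ⟨hp, hd⟩ := hw
  refine ⟨⟨fun γ δ => ?_, ?_, ?_, fun γ v => ?_, fun u v huv => ?_⟩, fun u v huv => ?_⟩
  · simp only [hp.map_mul, map_add]
  · exact T.linearIsometryEquiv.injective.comp hp.injective
  · have : Set.range (fun γ => T.linearIsometryEquiv (w.2 γ)) =
        T.linearIsometryEquiv.toLinearEquiv.toLinearMap '' Set.range w.2 := by
      rw [← Set.range_comp]; rfl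
    simp only [this]
    rw [Submodule.span_image, hp.rank_two, Submodule.map_top]
    exact LinearEquiv.range _
  · simp only [hp.equivariant]
    rw [add_comm (w.1 v), ← vadd_eq_add, T.map_vadd, vadd_eq_add, add_comm]
  · exact fun h => hp.ne_of_adj u v huv (T.injective h)
  · simp only [T.dist_map]
    exact hd u v huv

/-- Rotate the first period into the direction of `y₀` and move the vertex `v₀` to `x₀`. -/
def normalize (hG : IsPeriodicGraph G Γ) (y₀ x₀ : Plane) (v₀ : V) (w : Configuration G Γ) :
    Configuration G Γ :=
  let y := w.2 (hG.basis 0)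
  -- Cosine and sine of the angle from the first period to `y₀`.
  let α := inner ℝ y y₀ / (‖y‖ * ‖y₀‖)
  let β := cross y y₀ / (‖y‖ * ‖y₀‖)
  (fun v => α • (w.1 v - w.1 v₀) + β • rot (w.1 v - w.1 v₀) + x₀,
    fun γ => α • w.2 γ + β • rot (w.2 γ))

/-- For each `w` the normalization is effected by an isometry depending on `w`, so the congruence
class does not change. -/
theorem normalize_spec (hG : IsPeriodicGraph G Γ) {y₀ : Plane} (hy₀ : y₀ ≠ 0) (x₀ : Plane) (v₀ : V)
    (w : realizationSpace G Γ q) :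
    ∃ w' : realizationSpace G Γ q, w'.1 = normalize hG y₀ x₀ v₀ w.1 ∧
      (congruence G Γ q).r w w' := by
  have hy : w.1.2 (hG.basis 0) ≠ 0 := period_basis_ne_zero hG w.2.1 0
  have hcs : (inner ℝ (w.1.2 (hG.basis 0)) y₀ / (‖w.1.2 (hG.basis 0)‖ * ‖y₀‖)) ^ 2 +
      (cross (w.1.2 (hG.basis 0)) y₀ / (‖w.1.2 (hG.basis 0)‖ * ‖y₀‖)) ^ 2 = 1 := by
    rw [div_pow, div_pow, ← add_div, add_comm, cross_sq_add_inner_sq, real_inner_self_eq_norm_sq,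
      real_inner_self_eq_norm_sq, ← mul_pow]
    exact div_self (pow_ne_zero 2 (mul_ne_zero (norm_ne_zero_iff.2 hy) (norm_ne_zero_iff.2 hy₀)))
  let R := rotation _ _ hcs
  let T : Plane ≃ᵃⁱ[ℝ] Plane := AffineIsometryEquiv.mk' (fun x => R (x - w.1.1 v₀) + x₀) R
    (w.1.1 v₀) (fun x => by simp)
  exact ⟨⟨_, isometry_mem_realizationSpace w.2 T⟩, rfl, T, fun v => rfl, fun γ => rfl⟩

theorem normalize_vertex (hG : IsPeriodicGraph G Γ) (y₀ x₀ : Plane) (v₀ : V)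
    (w : Configuration G Γ) : (normalize hG y₀ x₀ v₀ w).1 v₀ = x₀ := by
  have h0 : rot (0 : Plane) = 0 := map_zero rotLinear
  simp [normalize, h0]

theorem cross_normalize_period (hG : IsPeriodicGraph G Γ) (y₀ x₀ : Plane) (v₀ : V)
    (w : Configuration G Γ) : cross y₀ ((normalize hG y₀ x₀ v₀ w).2 (hG.basis 0)) = 0 := by
  have : ∀ (y : Plane) (k : ℝ),
      cross y₀ ((inner ℝ y y₀ / k) • y + (cross y y₀ / k) • rot y) = 0 := by
    intro y k
    simp only [cross, inner_plane, PiLp.add_apply, PiLp.smul_apply, smul_eq_mul, rot_zero, rot_one]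
    ring
  exact this _ _

theorem normalize_eq_self (hG : IsPeriodicGraph G Γ) {y₀ x₀ : Plane} {v₀ : V}
    {w : Configuration G Γ} (h0 : w.1 v₀ = x₀) (h1 : cross y₀ (w.2 (hG.basis 0)) = 0)
    (h2 : 0 < inner ℝ y₀ (w.2 (hG.basis 0))) : normalize hG y₀ x₀ v₀ w = w := by
  have hα : inner ℝ (w.2 (hG.basis 0)) y₀ / (‖w.2 (hG.basis 0)‖ * ‖y₀‖) = 1 := by
    have h3 := cross_sq_add_inner_sq y₀ (w.2 (hG.basis 0))
    rw [h1, real_inner_self_eq_norm_sq, real_inner_self_eq_norm_sq, ← mul_pow, zero_pow two_ne_zero,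
      zero_add, sq_eq_sq₀ h2.le (mul_nonneg (norm_nonneg _) (norm_nonneg _))] at h3
    rw [real_inner_comm, mul_comm, ← h3, div_self h2.ne']
  have hβ : cross (w.2 (hG.basis 0)) y₀ / (‖w.2 (hG.basis 0)‖ * ‖y₀‖) = 0 := by
    rw [cross_swap, h1, neg_zero, zero_div]
  refine Prod.ext (funext fun v => ?_) (funext fun γ => ?_)
  · simp only [normalize, hα, hβ, one_smul, zero_smul, add_zero, h0, sub_add_cancel]
  · simp only [normalize, hα, hβ, one_smul, zero_smul, add_zero]

theorem continuous_rot : Continuous rot := by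
  have : Continuous rotLinear := LinearMap.continuous_of_finiteDimensional _
  exact this

theorem continuousAt_normalize (hG : IsPeriodicGraph G Γ) {y₀ : Plane} (hy₀ : y₀ ≠ 0) (x₀ : Plane)
    (v₀ : V) {w : Configuration G Γ} (hw : w.2 (hG.basis 0) ≠ 0) :
    ContinuousAt (normalize hG y₀ x₀ v₀) w := by
  have hp : ∀ γ, Continuous fun w : Configuration G Γ => w.2 γ := fun γ =>
    (continuous_apply γ).comp continuous_snd
  have hv : ∀ v, Continuous fun w : Configuration G Γ => w.1 v := fun v =>
    (continuous_apply v).comp continuous_fst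
  have hden : ContinuousAt (fun w : Configuration G Γ => ‖w.2 (hG.basis 0)‖ * ‖y₀‖) w :=
    ((hp _).norm.mul continuous_const).continuousAt
  have hne : ‖w.2 (hG.basis 0)‖ * ‖y₀‖ ≠ 0 :=
    mul_ne_zero (norm_ne_zero_iff.2 hw) (norm_ne_zero_iff.2 hy₀)
  have hα : ContinuousAt (fun w : Configuration G Γ =>
      inner ℝ (w.2 (hG.basis 0)) y₀ / (‖w.2 (hG.basis 0)‖ * ‖y₀‖)) w :=
    ((hp _).inner continuous_const).continuousAt.div hden hne
  have hβ : ContinuousAt (fun w : Configuration G Γ =>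
      cross (w.2 (hG.basis 0)) y₀ / (‖w.2 (hG.basis 0)‖ * ‖y₀‖)) w := by
    refine ContinuousAt.div ?_ hden hne
    have : Continuous fun w : Configuration G Γ => cross (w.2 (hG.basis 0)) y₀ := by
      have h := hp (hG.basis 0)
      unfold cross
      fun_prop
    exact this.continuousAt
  refine ContinuousAt.prodMk (continuousAt_pi.2 fun v => ?_) (continuousAt_pi.2 fun γ => ?_)
  · exact ((hα.smul ((hv v).sub (hv v₀)).continuousAt).add
      (hβ.smul (continuous_rot.comp ((hv v).sub (hv v₀))).continuousAt)).add continuousAt_const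
  · exact (hα.smul (hp γ).continuousAt).add (hβ.smul (continuous_rot.comp (hp γ)).continuousAt)

theorem continuous_restrict (hG : IsPeriodicGraph G Γ) :
    Continuous (hG.restrict : Configuration G Γ → Coordinates G Γ) :=
  (continuous_pi fun _ => (continuous_apply _).comp continuous_fst).prodMk
    (continuous_pi fun _ => (continuous_apply _).comp continuous_snd)

end Normalization

end PeriodicFramework

end

open scoped ContDiff
noncomputable section

namespace PeriodicFramework

/-! ### The smooth curve of realizations. -/

section Deformation

open Filter Topology

variable {V : Type*} {G : SimpleGraph V} {Γ : Subgroup (G ≃g G)} {q : Configuration G Γ}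

/-- The position of a vertex as a function of the coordinates. -/
def vertexLinear [Fintype (VertexOrbit G Γ)] (hG : IsPeriodicGraph G Γ) (v : V) :
    Coordinates G Γ →L[ℝ] Plane :=
  LinearMap.toContinuousLinearMap
    (LinearMap.proj v ∘ₗ LinearMap.fst ℝ (V → Plane) (Γ → Plane) ∘ₗ extendLinear hG)

/-- A period as a function of the coordinates. -/
def periodLinear [Fintype (VertexOrbit G Γ)] (hG : IsPeriodicGraph G Γ) (γ : Γ) :
    Coordinates G Γ →L[ℝ] Plane :=
  LinearMap.toContinuousLinearMap
    (LinearMap.proj γ ∘ₗ LinearMap.snd ℝ (V → Plane) (Γ → Plane) ∘ₗ extendLinear hG)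

/-- A normalized smooth curve in the fibre of the length map gives a smooth one-dimensional chart
of the deformation space. -/
theorem isSmoothOneDimensionalAt_of_isPseudoTriangulation (hG : IsPeriodicGraph G Γ)
    (hq : IsPeriodicPlacement G Γ q) {q₀ : Configuration G Γ}
    (hq₀ : q₀ ∈ realizationSpace G Γ q) (hT : IsPseudoTriangulation G q₀.1) :
    IsSmoothOneDimensionalAt G Γ q q₀ := by
  classical
  have := hG.finite_vertices
  have := Fintype.ofFinite (VertexOrbit G Γ)
  have := hG.finite_edges
  have := Fintype.ofFinite (EdgeOrbit G Γ)
  obtain ⟨hp₀, hd₀⟩ := hq₀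
  refine ⟨finrank_infinitesimalFlexes hG hp₀ hT, ?_⟩
  obtain ⟨r, hr, hr'⟩ := hG.exists_edge_section
  obtain ⟨v⟩ := hG.connected.nonempty
  set o : VertexOrbit G Γ := Quotient.mk'' v with ho
  set v₀ := hG.rep o with hv₀
  set y₀ := q₀.2 (hG.basis 0) with hy₀
  have hy₀ne : y₀ ≠ 0 := period_basis_ne_zero hG hp₀ 0
  set z₀ := hG.restrict q₀ with hz₀
  have hext₀ : hG.extend z₀ = q₀ := hG.extend_restrict q₀ hp₀.map_mul hp₀.equivariant
  -- Its sign is the orientation of the periods, which distinguishes a normalized realization from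
  -- its mirror image.
  set ε := cross y₀ (q₀.2 (hG.basis 1)) with hε
  have hε0 : ε ≠ 0 := by
    intro h
    have h1 := eq_smul_of_cross_eq_zero hy₀ne h
    have h2 := (periodBasis hG hp₀).linearIndependent
    rw [show ⇑(periodBasis hG hp₀) = ![y₀, q₀.2 (hG.basis 1)] by
      funext j; rw [periodBasis_apply]; fin_cases j <;> rfl,
      LinearIndependent.pair_iff' hy₀ne] at h2
    exact h2 _ h1.symm
  let W : Set (Coordinates G Γ) :=
    {z | 0 < inner ℝ y₀ (z.2 0)} ∩ {z | 0 < ε * cross (z.2 0) (z.2 1)}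
  have hz : ∀ j, Continuous fun z : Coordinates G Γ => z.2 j := fun j =>
    (continuous_apply j).comp continuous_snd
  have hW : IsOpen W := by
    refine (isOpen_lt continuous_const (continuous_const.inner (hz 0))).inter
      (isOpen_lt continuous_const (continuous_const.mul ?_))
    have h0 := hz 0
    have h1 := hz 1
    unfold cross
    fun_prop
  have hz₀W : z₀ ∈ W := ⟨real_inner_self_pos.2 hy₀ne, mul_self_pos.2 hε0⟩
  obtain ⟨θ, Ψ, hΨ, hΨ0, hΨW, hΨs⟩ := exists_chart hG hp₀ hT r hr hr' o hW hz₀W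
  -- The line in the chart on which lengths and normalization keep their values at `q₀` and only `θ`
  -- varies.
  let P : ℝ → (EdgeOrbit G Γ → ℝ) × (Plane × ℝ) × ℝ := fun τ =>
    (fun β => inner ℝ (dartVec q₀.1 (r β)) (dartVec q₀.1 (r β)), (q₀.1 v₀, 0), θ z₀ + τ)
  have hPz : Ψ z₀ = P 0 := by
    rw [hΨ, chartMap]
    simp only [dartLinear_apply, hext₀, P, add_zero]
    refine Prod.ext rfl (Prod.ext (Prod.ext rfl ?_) rfl)
    change inner ℝ (rot y₀) y₀ = (0 : ℝ)
    exact inner_rot_self y₀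
  have hPc : ContDiff ℝ ∞ P :=
    contDiff_const.prodMk (contDiff_const.prodMk (contDiff_const.add contDiff_id))
  obtain ⟨δ, hδ, hδt⟩ : ∃ δ > 0, ∀ τ : ℝ, |τ| < δ → P τ ∈ Ψ.target := by
    have h1 : P ⁻¹' Ψ.target ∈ 𝓝 (0 : ℝ) := by
      refine (Ψ.open_target.preimage hPc.continuous).mem_nhds ?_
      rw [Set.mem_preimage, ← hPz]
      exact Ψ.map_source hΨ0
    obtain ⟨δ, hδ, h⟩ := Metric.mem_nhds_iff.1 h1
    exact ⟨δ, hδ, fun τ hτ => h (by rwa [Metric.mem_ball, dist_zero_right, Real.norm_eq_abs])⟩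
  -- A reparametrization of an interval by `ℝ`; its values stay below `δ * π / 4 < δ` in absolute
  -- value.
  let h : ℝ → ℝ := fun t => δ / 2 * Real.arctan t
  have hh : ∀ t, |h t| < δ := by
    intro t
    rw [abs_mul, abs_of_pos (half_pos hδ)]
    have h1 : |Real.arctan t| < Real.pi / 2 :=
      abs_lt.2 ⟨Real.neg_pi_div_two_lt_arctan t, Real.arctan_lt_pi_div_two t⟩
    have h2 := Real.pi_lt_four
    nlinarith
  have hhinj : Function.Injective h := fun s t hst =>
    Real.arctan_injective (mul_left_cancel₀ (half_pos hδ).ne' hst)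
  have hhc : ContDiff ℝ ∞ h := contDiff_const.mul Real.contDiff_arctan
  have hhd : ∀ t, HasStrictDerivAt h (δ / 2 * (1 / (1 + t ^ 2))) t := fun t =>
    (Real.hasStrictDerivAt_arctan t).const_mul (δ / 2)
  have hhd0 : ∀ t : ℝ, δ / 2 * (1 / (1 + t ^ 2)) ≠ 0 := fun t => by positivity
  let z : ℝ → Coordinates G Γ := fun t => Ψ.symm (P (h t))
  have hzt : ∀ t, P (h t) ∈ Ψ.target := fun t => hδt _ (hh t)
  have hzs : ∀ t, z t ∈ Ψ.source := fun t => Ψ.map_target (hzt t)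
  have hzW : ∀ t, z t ∈ W := fun t => hΨW (hzs t)
  have hzP : ∀ t, chartMap hG r o y₀ θ (z t) = P (h t) := fun t => by
    rw [← hΨ]; exact Ψ.right_inv (hzt t)
  have hzc : ContDiff ℝ ∞ z :=
    (hΨs.of_le le_top).comp_contDiff (hPc.comp hhc) hzt
  have hz0 : z 0 = z₀ := by
    have : h 0 = 0 := by simp [h]
    change Ψ.symm (P (h 0)) = z₀
    rw [this, ← hPz]
    exact Ψ.left_inv hΨ0
  have hzv : ∀ t, (z t).1 o = q₀.1 v₀ := fun t => congrArg (fun x => x.2.1.1) (hzP t)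
  have hzr : ∀ t, inner ℝ (rot y₀) ((z t).2 0) = (0 : ℝ) := fun t =>
    congrArg (fun x => x.2.1.2) (hzP t)
  have hzθ : ∀ t, θ (z t) = θ z₀ + h t := fun t => congrArg (fun x => x.2.2) (hzP t)
  have hmem : ∀ t, hG.extend (z t) ∈ realizationSpace G Γ q := by
    intro t
    refine extend_mem_realizationSpace hG hq hr' (fun h0 => ?_) (fun β => ?_)
    · have := (hzW t).2
      simp only [Set.mem_ofPred_eq, h0, mul_zero, lt_self_iff_false] at this
    · have h1 := congrFun (congrArg Prod.fst (hzP t)) β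
      exact h1.trans ((dist_eq_iff_inner_dartVec _).1 (hd₀ _ _ (hr β)))
  let c : ℝ → realizationSpace G Γ q := fun t => ⟨hG.extend (z t), hmem t⟩
  have hcv : ∀ v t, (c t).1.1 v = vertexLinear hG v (z t) := fun _ _ => rfl
  have hcp : ∀ γ t, (c t).1.2 γ = periodLinear hG γ (z t) := fun _ _ => rfl
  have hcdv : ∀ v, ContDiff ℝ ∞ fun t => (c t).1.1 v := fun v =>
    (vertexLinear hG v).contDiff.comp hzc
  have hcdp : ∀ γ, ContDiff ℝ ∞ fun t => (c t).1.2 γ := fun γ =>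
    (periodLinear hG γ).contDiff.comp hzc
  have hc1 : ∀ t, (c t).1.1 v₀ = q₀.1 v₀ := fun t => (extend_rep hG (z t) o).trans (hzv t)
  have hc2 : ∀ t j, (c t).1.2 (hG.basis j) = (z t).2 j := fun t j => extend_basis hG (z t) j
  have hc3 : ∀ t, cross y₀ ((c t).1.2 (hG.basis 0)) = 0 := fun t => by
    rw [hc2, ← inner_rot]; exact hzr t
  have hc4 : ∀ t, 0 < inner ℝ y₀ ((c t).1.2 (hG.basis 0)) := fun t => by
    rw [hc2]; exact (hzW t).1
  have hc5 : ∀ t, 0 < ε * cross ((c t).1.2 (hG.basis 0)) ((c t).1.2 (hG.basis 1)) := fun t => by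
    rw [hc2, hc2]; exact (hzW t).2
  have hcinj : Function.Injective fun t : ℝ =>
      (Quotient.mk (congruence G Γ q) (c t) : DeformationSpace G Γ q) := by
    intro s t hst
    obtain ⟨T, h1, h2⟩ := Quotient.exact hst
    have heq := eq_of_congruent_of_normalized hG (c s).2.1 T h1 h2 v₀
      ((hc1 s).trans (hc1 t).symm) (hc3 s) (hc3 t) (hc4 s) (hc4 t) (hc5 s) (hc5 t)
    have h3 : z s = z t := extendLinear_injective hG heq
    have h4 := congrArg θ h3
    rw [hzθ, hzθ] at h4
    exact hhinj (add_left_cancel h4)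
  have hccont : Continuous c :=
    Continuous.subtype_mk ((continuous_pi fun v => (hcdv v).continuous).prodMk
      (continuous_pi fun γ => (hcdp γ).continuous)) _
  -- A realization near `c t` is normalized by a map that is continuous there and fixes `c t`. The
  -- result lies in the chart with the prescribed lengths and normalization, hence on the curve, at
  -- the parameter read off from `θ`.
  have hnear : ∀ (I : Set ℝ), IsOpen I → ∀ t ∈ I, ∀ᶠ w in 𝓝 (c t), ∃ s ∈ I,
      Quotient.mk (congruence G Γ q) (c s) = Quotient.mk (congruence G Γ q) w := by
    intro I hI t ht
    have hfix : normalize hG y₀ (q₀.1 v₀) v₀ (c t).1 = (c t).1 :=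
      normalize_eq_self hG (hc1 t) (hc3 t) (hc4 t)
    have hcont : Tendsto (fun w : realizationSpace G Γ q =>
        hG.restrict (normalize hG y₀ (q₀.1 v₀) v₀ w.1)) (𝓝 (c t)) (𝓝 (z t)) := by
      have h1 : ContinuousAt (fun w : realizationSpace G Γ q =>
          normalize hG y₀ (q₀.1 v₀) v₀ w.1) (c t) :=
        (continuousAt_normalize hG hy₀ne (q₀.1 v₀) v₀
          (period_basis_ne_zero hG (c t).2.1 0)).comp continuous_subtype_val.continuousAt
      have h2 := (continuous_restrict hG).continuousAt.tendsto.comp h1.tendsto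
      rw [hfix, show hG.restrict (c t).1 = z t from hG.restrict_extend (z t)] at h2
      exact h2
    have hsrc := hcont.eventually (Ψ.open_source.mem_nhds (hzs t))
    have himg : ∀ᶠ x in 𝓝 (z t), θ x - θ z₀ ∈ h '' I := by
      have h1 : Tendsto (fun x => θ x - θ z₀) (𝓝 (z t)) (𝓝 (h t)) := by
        have h2 : Continuous fun x => θ x - θ z₀ := by fun_prop
        have h3 := h2.tendsto (z t)
        rwa [hzθ, add_sub_cancel_left] at h3
      refine h1 ?_
      rw [← (hhd t).map_nhds_eq (hhd0 t)]
      exact image_mem_map (hI.mem_nhds ht)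
    filter_upwards [hsrc, hcont.eventually himg] with w hw1 hw2
    obtain ⟨s, hs, hs2⟩ := hw2
    obtain ⟨w', hw', hcongr⟩ := normalize_spec hG hy₀ne (q₀.1 v₀) v₀ w
    refine ⟨s, hs, ?_⟩
    rw [← hw'] at hw1 hs2
    have hext : hG.extend (hG.restrict w'.1) = w'.1 :=
      hG.extend_restrict w'.1 w'.2.1.map_mul w'.2.1.equivariant
    have hΨw : Ψ (hG.restrict w'.1) = P (h s) := by
      rw [hΨ, chartMap]
      simp only [dartLinear_apply, hext, P]
      refine Prod.ext (funext fun β => ?_) (Prod.ext (Prod.ext ?_ ?_) ?_)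
      · exact (dist_eq_iff_inner_dartVec _).1
          ((w'.2.2 _ _ (hr β)).trans (hd₀ _ _ (hr β)).symm)
      · change w'.1.1 v₀ = q₀.1 v₀
        rw [hw', normalize_vertex]
      · change inner ℝ (rot y₀) (w'.1.2 (hG.basis 0)) = (0 : ℝ)
        rw [inner_rot, hw', cross_normalize_period]
      · change θ (hG.restrict w'.1) = θ z₀ + h s
        rw [hs2, add_sub_cancel]
    have hzw : z s = hG.restrict w'.1 := by
      change Ψ.symm (P (h s)) = _
      rw [← hΨw]
      exact Ψ.left_inv hw1
    have hcw : c s = w' := Subtype.ext (by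
      change hG.extend (z s) = w'.1
      rw [hzw, hext])
    rw [hcw]
    exact (Quotient.sound hcongr).symm
  refine ⟨c, ?_, hcdv, hcdp, fun t ht => ?_, ?_⟩
  · change hG.extend (z 0) = q₀
    rw [hz0, hext₀]
  -- The curve is normalized, so a trivial velocity would be zero; but `θ` changes along the curve
  -- at nonzero speed.
  · have hzd : HasDerivAt z (deriv z t) t :=
      ((hzc.differentiable (by simp)) t).hasDerivAt
    have hvel : velocity (fun r => (c r).1) t = hG.extend (deriv z t) := by
      refine Prod.ext (funext fun v => ?_) (funext fun γ => ?_)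
      · exact ((vertexLinear hG v).hasFDerivAt.comp_hasDerivAt t hzd).deriv
      · exact ((periodLinear hG γ).hasFDerivAt.comp_hasDerivAt t hzd).deriv
    have hconst : ∀ {E : Type} [NormedAddCommGroup E] [NormedSpace ℝ E]
        (l : Coordinates G Γ →L[ℝ] E) (e : E), (∀ r, l (z r) = e) → l (deriv z t) = 0 := by
      intro E _ _ l e hl
      have h1 := l.hasFDerivAt.comp_hasDerivAt t hzd
      have h2 : (fun r => l (z r)) = fun _ => e := funext hl
      change HasDerivAt (fun r => l (z r)) _ t at h1
      rw [h2] at h1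
      exact h1.unique (hasDerivAt_const t e)
    have hd1 : (deriv z t).1 o = 0 := hconst ((ContinuousLinearMap.proj (R := ℝ) o).comp
      (ContinuousLinearMap.fst ℝ (VertexOrbit G Γ → Plane) (Fin 2 → Plane))) _ hzv
    have hd2 : inner ℝ (rot y₀) ((deriv z t).2 0) = (0 : ℝ) := hconst ((innerSL ℝ (rot y₀)).comp
      ((ContinuousLinearMap.proj (R := ℝ) 0).comp
      (ContinuousLinearMap.snd ℝ (VertexOrbit G Γ → Plane) (Fin 2 → Plane)))) _ hzr
    have hd3 : θ (deriv z t) = δ / 2 * (1 / (1 + t ^ 2)) := by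
      have h1 := θ.hasFDerivAt.comp_hasDerivAt t hzd
      have h2 : (fun r => θ (z r)) = fun r => θ z₀ + h r := funext hzθ
      change HasDerivAt (fun r => θ (z r)) _ t at h1
      rw [h2] at h1
      exact h1.unique ((hhd t).hasDerivAt.const_add _)
    rw [hvel] at ht
    have h0 := eq_zero_of_trivial_of_gauge hG (hc4 t).ne' ht v₀
      ((extend_rep hG _ o).trans hd1) (by rw [extend_basis]; exact hd2)
    have h1 : deriv z t = 0 := extendLinear_injective hG (h0.trans (map_zero _).symm)
    rw [h1, map_zero] at hd3
    exact hhd0 t hd3.symm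
  · refine Topology.IsOpenEmbedding.of_continuous_injective_isOpenMap
      (continuous_quotient_mk'.comp hccont) hcinj fun I hI => ?_
    refine isOpen_coinduced.2 (isOpen_iff_mem_nhds.2 ?_)
    rintro x ⟨t, ht, htx⟩
    obtain ⟨T, h1, h2⟩ := Quotient.exact htx
    -- The point `x` is only congruent to some `c t`; the isometry takes a neighbourhood of `x` to
    -- one of `c t` without changing classes.
    let A : realizationSpace G Γ q → realizationSpace G Γ q := fun w =>
      ⟨_, isometry_mem_realizationSpace w.2 T.symm⟩
    have hA : Continuous A := by
      refine Continuous.subtype_mk ((continuous_pi fun v => ?_).prodMk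
        (continuous_pi fun γ => ?_)) _
      · exact T.symm.continuous.comp ((continuous_apply v).comp
          (continuous_fst.comp continuous_subtype_val))
      · exact T.symm.linearIsometryEquiv.continuous.comp ((continuous_apply γ).comp
          (continuous_snd.comp continuous_subtype_val))
    have hAx : A x = c t := by
      refine Subtype.ext (Prod.ext (funext fun v => ?_) (funext fun γ => ?_))
      · change T.symm (x.1.1 v) = (c t).1.1 v
        rw [h1, AffineIsometryEquiv.symm_apply_apply]
      · change T.symm.linearIsometryEquiv (x.1.2 γ) = (c t).1.2 γ
        rw [h2]
        exact T.linearIsometryEquiv.symm_apply_apply _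
    have hev := hnear I hI t ht
    rw [← hAx] at hev
    filter_upwards [hA.continuousAt.eventually hev] with w hw
    obtain ⟨s, hs, hsw⟩ := hw
    refine ⟨s, hs, ?_⟩
    have hAw : (congruence G Γ q).r w (A w) := ⟨T.symm, fun _ => rfl, fun _ => rfl⟩
    exact hsw.trans (Quotient.sound hAw).symm

theorem self_mem_realizationSpace (hq : IsPeriodicPlacement G Γ q) :
    q ∈ realizationSpace G Γ q := ⟨hq, fun _ _ _ => rfl⟩

end Deformation

end PeriodicFramework

end

open scoped ContDiff
noncomputable section

namespace PeriodicFramework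

/-! ### Passage to subgroups of finite index. -/

section Relaxation

/-- A subgroup of finite index has finitely many orbits if the group has. -/
theorem finite_orbits_of_relIndex_ne_zero {A X : Type*} [Group A] [MulAction A X]
    {H K : Subgroup A} (hidx : H.relIndex K ≠ 0)
    [Finite (MulAction.orbitRel.Quotient K X)] : Finite (MulAction.orbitRel.Quotient H X) := by
  have hfi : (H.subgroupOf K).FiniteIndex := ⟨hidx⟩
  obtain ⟨r, hr⟩ := exists_orbit_section K X
  -- Inverses of coset representatives, applied to orbit representatives of `K`, meet every orbit of
  -- `H`.
  refine Finite.of_surjective (α := (K ⧸ H.subgroupOf K) × MulAction.orbitRel.Quotient K X)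
    (fun x => Quotient.mk'' (x.1.out⁻¹ • r x.2)) fun o => ?_
  induction o using Quotient.inductionOn' with
  | h x =>
    obtain ⟨γ, hγ⟩ := exists_smul_of_mk_eq (Γ := K) (hr (Quotient.mk'' x)).symm
    obtain ⟨h, hh⟩ := QuotientGroup.mk_out_eq_mul (H.subgroupOf K) γ⁻¹
    refine ⟨(QuotientGroup.mk γ⁻¹, Quotient.mk'' x), ?_⟩
    have h1 : (QuotientGroup.mk γ⁻¹ : K ⧸ H.subgroupOf K).out⁻¹ • r (Quotient.mk'' x) =
        (⟨h.1.1, h.2⟩⁻¹ : H) • x := by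
      rw [hh, mul_inv_rev, inv_inv, mul_smul, hγ]
      rfl
    change Quotient.mk'' ((QuotientGroup.mk γ⁻¹ : K ⧸ H.subgroupOf K).out⁻¹ •
      r (Quotient.mk'' x)) = _
    rw [h1]
    exact mk_smul _ x

/-- A subgroup of finite index in `ℤⁿ` is again free of rank `n`; the rest transports this between
additive and multiplicative notation. -/
theorem nonempty_mulEquiv_of_relIndex_ne_zero {A : Type*} [Group A] {H K : Subgroup A}
    (hle : H ≤ K) (hidx : H.relIndex K ≠ 0) {n : ℕ}
    (hK : Nonempty (K ≃* Multiplicative (Fin n → ℤ))) :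
    Nonempty (H ≃* Multiplicative (Fin n → ℤ)) := by
  obtain ⟨e⟩ := hK
  let B : Subgroup (Multiplicative (Fin n → ℤ)) := (H.subgroupOf K).map e.toMonoidHom
  let C : AddSubgroup (Fin n → ℤ) := Subgroup.toAddSubgroup' B
  have hCidx : C.index ≠ 0 := by
    change B.index ≠ 0
    rw [Subgroup.index_map_of_bijective e.bijective]
    exact hidx
  have : C.FiniteIndex := ⟨hCidx⟩
  have hrank : Module.finrank ℤ C = Module.finrank ℤ (Fin n → ℤ) :=
    AddSubgroup.finrank_eq_of_finiteIndex C
  rw [Module.finrank_fin_fun] at hrank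
  let b := Module.finBasisOfFinrankEq ℤ C hrank
  let e1 : H ≃* H.subgroupOf K := (Subgroup.subgroupOfEquivOfLe hle).symm
  let e2 : H.subgroupOf K ≃* B := e.subgroupMap (H.subgroupOf K)
  let e3 : Multiplicative C ≃* Multiplicative (Fin n → ℤ) :=
    AddEquiv.toMultiplicative b.equivFun.toAddEquiv
  let e4 : B ≃* Multiplicative C :=
    { toFun := fun x => Multiplicative.ofAdd ⟨Multiplicative.toAdd x.1, x.2⟩
      invFun := fun x => ⟨Multiplicative.ofAdd (Multiplicative.toAdd x).1, (Multiplicative.toAdd x).2⟩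
      left_inv := fun x => rfl
      right_inv := fun x => rfl
      map_mul' := fun x y => rfl }
  exact ⟨(e1.trans e2).trans (e4.trans e3)⟩

variable {V : Type*} {G : SimpleGraph V} {Γ Γ' : Subgroup (G ≃g G)} {q : Configuration G Γ}

theorem IsPeriodicGraph.relax (hG : IsPeriodicGraph G Γ) (hle : Γ' ≤ Γ)
    (hidx : Γ'.relIndex Γ ≠ 0) : IsPeriodicGraph G Γ' where
  connected := hG.connected
  free_abelian := nonempty_mulEquiv_of_relIndex_ne_zero hle hidx hG.free_abelian
  no_fixed_vertex γ hγ v := hG.no_fixed_vertex ⟨γ.1, hle γ.2⟩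
    (fun h => hγ (Subtype.ext (congrArg (fun x : Γ => x.1) h))) v
  no_fixed_edge γ hγ e := hG.no_fixed_edge ⟨γ.1, hle γ.2⟩
    (fun h => hγ (Subtype.ext (congrArg (fun x : Γ => x.1) h))) e
  finite_vertices := by
    have := hG.finite_vertices
    exact finite_orbits_of_relIndex_ne_zero hidx
  finite_edges := by
    have := hG.finite_edges
    exact finite_orbits_of_relIndex_ne_zero hidx

theorem IsPeriodicPlacement.relax (hq : IsPeriodicPlacement G Γ q) (hle : Γ' ≤ Γ)
    (hidx : Γ'.relIndex Γ ≠ 0) :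
    IsPeriodicPlacement G Γ' (PeriodicFramework.relax hle q) where
  map_mul γ δ := hq.map_mul ⟨γ.1, hle γ.2⟩ ⟨δ.1, hle δ.2⟩
  injective γ δ h := Subtype.ext (congrArg (fun x : Γ => x.1) (hq.injective h))
  rank_two := by
    rw [eq_top_iff, ← hq.rank_two, Submodule.span_le]
    rintro _ ⟨γ, rfl⟩
    -- A positive power of `γ` lies in the subgroup, so the period of `γ` is a rational multiple of
    -- a period that is kept.
    obtain ⟨n, hn, -, hmem⟩ := Subgroup.exists_pow_mem_of_relIndex_ne_zero hidx γ.2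
    have hpow : ∀ k : ℕ, q.2 (γ ^ k) = (k : ℝ) • q.2 γ := by
      intro k
      induction k with
      | zero => rw [pow_zero, hq.map_one, Nat.cast_zero, zero_smul]
      | succ k ih => rw [pow_succ, hq.map_mul, ih]; push_cast; module
    have hγ : q.2 γ = (n : ℝ)⁻¹ • q.2 (γ ^ n) := by
      rw [hpow, smul_smul, inv_mul_cancel₀ (Nat.cast_ne_zero.2 hn.ne'), one_smul]
    rw [SetLike.mem_coe, hγ]
    exact Submodule.smul_mem _ _ (Submodule.subset_span ⟨⟨γ.1 ^ n, hmem.1⟩, rfl⟩)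
  equivariant γ v := hq.equivariant ⟨γ.1, hle γ.2⟩ v
  ne_of_adj := hq.ne_of_adj

end Relaxation

end PeriodicFramework

end

open PeriodicFramework in
theorem mainTheorem3 {V : Type*} (G : SimpleGraph V) (Γ : Subgroup (G ≃g G))
    (hG : IsPeriodicGraph G Γ) (q : Configuration G Γ) (hq : IsPeriodicPlacement G Γ q)
    (hT : IsPseudoTriangulation G q.1) :
    ((∀ s : G.edgeSet → ℝ, IsPeriodicStress G Γ q s → s = 0) ∧
      IsSmoothOneDimensionalAt G Γ q q ∧
      (∀ q' ∈ realizationSpace G Γ q, IsPseudoTriangulation G q'.1 →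
        IsSmoothOneDimensionalAt G Γ q q')) ∧
    ∀ (Γ' : Subgroup (G ≃g G)) (hle : Γ' ≤ Γ), Γ'.relIndex Γ ≠ 0 →
      (∀ s : G.edgeSet → ℝ, IsPeriodicStress G Γ' (relax hle q) s → s = 0) ∧
      IsSmoothOneDimensionalAt G Γ' (relax hle q) (relax hle q) ∧
      (∀ q' ∈ realizationSpace G Γ' (relax hle q), IsPseudoTriangulation G q'.1 →
        IsSmoothOneDimensionalAt G Γ' (relax hle q) q') := by
  refine ⟨⟨fun s hs => periodicStress_eq_zero hG hq hT hs,
    isSmoothOneDimensionalAt_of_isPseudoTriangulation hG hq (self_mem_realizationSpace hq) hT,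
    fun q' hq' hT' => isSmoothOneDimensionalAt_of_isPseudoTriangulation hG hq hq' hT'⟩,
    fun Γ' hle hidx => ?_⟩
  -- Being a pseudo-triangulation concerns only the graph and the positions, so `hT` serves
  -- unchanged for the smaller group.
  have hG' := hG.relax hle hidx
  have hq' := hq.relax hle hidx
  exact ⟨fun s hs => periodicStress_eq_zero hG' hq' hT hs,
    isSmoothOneDimensionalAt_of_isPseudoTriangulation hG' hq' (self_mem_realizationSpace hq') hT,
    fun p hp hT' => isSmoothOneDimensionalAt_of_isPseudoTriangulation hG' hq' hp hT'⟩
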